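/- Let $R$ be a discrete valuation ring with fraction field $K$ of characteristic $0$ and residue field $k$ of characteristic $p>0$. For an $R$-scheme $Z$ write $Z_K=Z\times_R K$ and $Z_k=Z\times_R k$ for its generic and special fibres, and for a scheme $Z$ and $m\in\mathbb N$ put ${}_m\mathrm{Pic}(Z)=\ker(m:\mathrm{Pic}(Z)\to\mathrm{Pic}(Z))$. All schemes are noetherian. Let $G$ be a finite abelian group of order $m$ with $(m,p)=1$, and suppose that $R$ contains a primitive $m$-th root of unity. Let $X$ be a normal faithfully flat $R$-scheme such that $X_K$ and $X_k$ are integral and such that the restriction map ${}_m\mathrm{Pic}(X)\to{}_m\mathrm{Pic}(X_K)$ is bijective. Let $Y_K\to X_K$ be a connected $G$-torsor (that is, an fppf torsor, with $Y_K$ connected, under the constant group scheme $G_K$ over $K$), let $Y$ be the normalization of $X$ in $Y_K$, and assume that $Y_k$ is reduced. Then $Y_K\to X_K$ is strongly extendible: there are a finite flat $R$-group scheme $\mathcal G$ with an isomorphism of group schemes $\mathcal G_K\simeq G_K$, and an action of $\mathcal G$ on the $R$-scheme $Y$, such that $Y\to X$ is a $\mathcal G$-torsor and such that on the generic fibre the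 action of $\mathcal G$ coincides with the given action of $G_K$ on $Y_K$. -/

import Mathlib

open CategoryTheory Limits AlgebraicGeometry

universe u v

namespace TorsorExtension

section Pic

/-- Restriction of invertible functions from an open `U` to a smaller open `V`. -/
def resUnits (Z : Scheme.{u}) {U V : Z.Opens} (h : V ≤ U) : Γ(Z, U)ˣ →* Γ(Z, V)ˣ :=
  Units.map (Z.presheaf.map (homOfLE h).op).hom.toMonoidHom

@[simp]
theorem resUnits_res (Z : Scheme.{u}) {U V W : Z.Opens} (h : V ≤ U) (h' : W ≤ V)
    (s : Γ(Z, U)ˣ) : resUnits Z h' (resUnits Z h s) = resUnits Z (h'.trans h) s := by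
  ext
  simp only [resUnits, Units.coe_map]
  change (Z.presheaf.map (homOfLE h).op ≫ Z.presheaf.map (homOfLE h').op).hom _ = _
  rw [← Functor.map_comp]
  rfl

/-- Pulling back invertible functions along a morphism of schemes. -/
def appUnits {W Z : Scheme.{u}} (f : W ⟶ Z) (U : Z.Opens) : Γ(Z, U)ˣ →* Γ(W, f ⁻¹ᵁ U)ˣ :=
  Units.map (f.app U).hom.toMonoidHom

theorem resUnits_appUnits {W Z : Scheme.{u}} (f : W ⟶ Z) {U V : Z.Opens} (h : V ≤ U)
    (h' : f ⁻¹ᵁ V ≤ f ⁻¹ᵁ U) (s : Γ(Z, U)ˣ) :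
    resUnits W h' (appUnits f U s) = appUnits f V (resUnits Z h s) := by
  ext
  simp only [resUnits, appUnits, Units.coe_map]
  have := f.naturality (homOfLE h).op
  exact (congr(($this).hom (s : Γ(Z, U)))).symm

theorem resUnits_appUnits' {W Z : Scheme.{u}} (f : W ⟶ Z) {U V : Z.Opens} (h : V ≤ U)
    (s : Γ(Z, U)ˣ) :
    resUnits W (fun _ hx => h hx : f ⁻¹ᵁ V ≤ f ⁻¹ᵁ U) (appUnits f U s) =
      appUnits f V (resUnits Z h s) := resUnits_appUnits f h _ s

/-- A line bundle on `Z`, given by transition functions: an open neighbourhood `U x` of every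
point `x`, and a `1`-cocycle `g` of invertible functions for the open cover `(U x)`. -/
structure LineBundle (Z : Scheme.{u}) where
  U : Z → Z.Opens
  mem : ∀ x, x ∈ U x
  g : ∀ x y, Γ(Z, U x ⊓ U y)ˣ
  cocycle : ∀ x y z,
    resUnits Z (V := U x ⊓ U y ⊓ U z) inf_le_left (g x y) *
      resUnits Z (V := U x ⊓ U y ⊓ U z) (le_inf (inf_le_left.trans inf_le_right) inf_le_right)
        (g y z) =
    resUnits Z (V := U x ⊓ U y ⊓ U z) (le_inf (inf_le_left.trans inf_le_left) inf_le_right)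
        (g x z)

namespace LineBundle

variable {Z : Scheme.{u}}

/-- Two line bundles are isomorphic if, on a common refinement `(V x)` of their open covers, the
two cocycles differ by the coboundary of invertible functions `h x` on `V x`. -/
def Equiv (L M : LineBundle Z) : Prop :=
  ∃ (V : Z → Z.Opens) (_ : ∀ x, x ∈ V x) (hL : ∀ x, V x ≤ L.U x) (hM : ∀ x, V x ≤ M.U x)
    (h : ∀ x, Γ(Z, V x)ˣ), ∀ x y,
      resUnits Z (inf_le_inf (hL x) (hL y)) (L.g x y) *
        resUnits Z (V := V x ⊓ V y) inf_le_right (h y) =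
      resUnits Z (V := V x ⊓ V y) inf_le_left (h x) *
        resUnits Z (inf_le_inf (hM x) (hM y)) (M.g x y)

theorem equiv_refl (L : LineBundle Z) : L.Equiv L :=
  ⟨L.U, L.mem, fun _ => le_rfl, fun _ => le_rfl, fun _ => 1, fun x y => by simp⟩

theorem equiv_symm {L M : LineBundle Z} : L.Equiv M → M.Equiv L := by
  rintro ⟨V, hV, hL, hM, h, H⟩
  refine ⟨V, hV, hM, hL, fun x => (h x)⁻¹, fun x y => ?_⟩
  simp only [map_inv]
  rw [mul_inv_eq_iff_eq_mul, mul_assoc, eq_inv_mul_iff_mul_eq]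
  exact (H x y).symm

theorem equiv_trans {L M N : LineBundle Z} : L.Equiv M → M.Equiv N → L.Equiv N := by
  rintro ⟨V, hV, hL, hM, h, H⟩ ⟨V', hV', hM', hN', h', H'⟩
  refine ⟨fun x => V x ⊓ V' x, fun x => ⟨hV x, hV' x⟩, fun x => inf_le_left.trans (hL x),
    fun x => inf_le_right.trans (hN' x),
    fun x => resUnits Z inf_le_left (h x) * resUnits Z inf_le_right (h' x), fun x y => ?_⟩
  have e := congrArg (resUnits Z (V := V x ⊓ V' x ⊓ (V y ⊓ V' y))
    (inf_le_inf inf_le_left inf_le_left)) (H x y)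
  have e' := congrArg (resUnits Z (V := V x ⊓ V' x ⊓ (V y ⊓ V' y))
    (inf_le_inf inf_le_right inf_le_right)) (H' x y)
  simp only [map_mul, resUnits_res] at e e' ⊢
  rw [← mul_assoc, e, mul_assoc, e', mul_assoc]

instance setoid (Z : Scheme.{u}) : Setoid (LineBundle Z) :=
  ⟨Equiv, equiv_refl, equiv_symm, equiv_trans⟩

/-- The tensor product of two line bundles. -/
def tensor (L M : LineBundle Z) : LineBundle Z where
  U x := L.U x ⊓ M.U x
  mem x := ⟨L.mem x, M.mem x⟩
  g x y := resUnits Z (inf_le_inf inf_le_left inf_le_left) (L.g x y) *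
    resUnits Z (inf_le_inf inf_le_right inf_le_right) (M.g x y)
  cocycle x y z := by
    have e := congrArg (resUnits Z (V := L.U x ⊓ M.U x ⊓ (L.U y ⊓ M.U y) ⊓ (L.U z ⊓ M.U z))
      (inf_le_inf (inf_le_inf inf_le_left inf_le_left) inf_le_left)) (L.cocycle x y z)
    have e' := congrArg (resUnits Z (V := L.U x ⊓ M.U x ⊓ (L.U y ⊓ M.U y) ⊓ (L.U z ⊓ M.U z))
      (inf_le_inf (inf_le_inf inf_le_right inf_le_right) inf_le_right)) (M.cocycle x y z)
    simp only [map_mul, resUnits_res] at e e' ⊢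
    rw [← e, ← e', mul_mul_mul_comm]

/-- The trivial line bundle. -/
def trivial (Z : Scheme.{u}) : LineBundle Z where
  U _ := ⊤
  mem _ := TopologicalSpace.Opens.mem_top _
  g _ _ := 1
  cocycle _ _ _ := by simp

/-- The dual of a line bundle. -/
def dual (L : LineBundle Z) : LineBundle Z where
  U := L.U
  mem := L.mem
  g x y := (L.g x y)⁻¹
  cocycle x y z := by simp only [map_inv, ← mul_inv, L.cocycle]

/-- The pull-back of a line bundle along a morphism of schemes. -/
def pullback {W Z : Scheme.{u}} (f : W ⟶ Z) (L : LineBundle Z) : LineBundle W where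
  U w := f ⁻¹ᵁ L.U (f w)
  mem w := L.mem (f w)
  g w w' := appUnits f (L.U (f w) ⊓ L.U (f w')) (L.g (f w) (f w'))
  cocycle w₁ w₂ w₃ := by
    have e := congrArg (appUnits f _) (L.cocycle (f w₁) (f w₂) (f w₃))
    simp only [map_mul, ← resUnits_appUnits' f] at e
    exact e

theorem res_tensor (L M : LineBundle Z) {x y : Z} {V : Z.Opens}
    (h : V ≤ (L.tensor M).U x ⊓ (L.tensor M).U y) :
    resUnits Z h ((L.tensor M).g x y) =
      resUnits Z (h.trans (inf_le_inf inf_le_left inf_le_left)) (L.g x y) *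
        resUnits Z (h.trans (inf_le_inf inf_le_right inf_le_right)) (M.g x y) :=
  (map_mul (resUnits Z h) _ _).trans
    (congrArg₂ (· * ·) (resUnits_res Z _ h _) (resUnits_res Z _ h _))

theorem res_trivial {x y : Z} {V : Z.Opens} (h : V ≤ (trivial Z).U x ⊓ (trivial Z).U y) :
    resUnits Z h ((trivial Z).g x y) = 1 :=
  map_one (resUnits Z h)

theorem res_dual (L : LineBundle Z) {x y : Z} {V : Z.Opens} (h : V ≤ L.dual.U x ⊓ L.dual.U y) :
    resUnits Z h (L.dual.g x y) = (resUnits Z (U := L.U x ⊓ L.U y) h (L.g x y))⁻¹ :=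
  map_inv (resUnits Z h) _

theorem res_pullback {W : Scheme.{u}} (f : W ⟶ Z) (L : LineBundle Z) {w w' : W} {V : Z.Opens}
    (h : V ≤ L.U (f w) ⊓ L.U (f w'))
    (h' : f ⁻¹ᵁ V ≤ (L.pullback f).U w ⊓ (L.pullback f).U w') :
    resUnits W h' ((L.pullback f).g w w') = appUnits f V (resUnits Z h (L.g (f w) (f w'))) :=
  resUnits_appUnits f h _ _

theorem equiv_of_eq {L M : LineBundle Z} (V : Z → Z.Opens) (hV : ∀ x, x ∈ V x)
    (hL : ∀ x, V x ≤ L.U x) (hM : ∀ x, V x ≤ M.U x)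
    (H : ∀ x y, resUnits Z (inf_le_inf (hL x) (hL y)) (L.g x y) =
      resUnits Z (inf_le_inf (hM x) (hM y)) (M.g x y)) : L.Equiv M :=
  ⟨V, hV, hL, hM, fun _ => 1, fun x y => by simp [H]⟩

theorem tensor_equiv {L L' M M' : LineBundle Z} :
    L.Equiv L' → M.Equiv M' → (L.tensor M).Equiv (L'.tensor M') := by
  rintro ⟨V, hV, hL, hM, h, H⟩ ⟨V', hV', hL', hM', h', H'⟩
  refine ⟨fun x => V x ⊓ V' x, fun x => ⟨hV x, hV' x⟩, fun x => inf_le_inf (hL x) (hL' x),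
    fun x => inf_le_inf (hM x) (hM' x),
    fun x => resUnits Z inf_le_left (h x) * resUnits Z inf_le_right (h' x), fun x y => ?_⟩
  have e := congrArg (resUnits Z (V := V x ⊓ V' x ⊓ (V y ⊓ V' y))
    (inf_le_inf inf_le_left inf_le_left)) (H x y)
  have e' := congrArg (resUnits Z (V := V x ⊓ V' x ⊓ (V y ⊓ V' y))
    (inf_le_inf inf_le_right inf_le_right)) (H' x y)
  simp only [map_mul, resUnits_res, res_tensor] at e e' ⊢
  rw [mul_mul_mul_comm, e, e', mul_mul_mul_comm]

theorem dual_equiv {L M : LineBundle Z} : L.Equiv M → L.dual.Equiv M.dual := by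
  rintro ⟨V, hV, hL, hM, h, H⟩
  refine ⟨V, hV, hL, hM, fun x => (h x)⁻¹, fun x y => ?_⟩
  have e := congrArg (·⁻¹) (H x y)
  simpa only [map_inv, mul_inv, res_dual] using e

theorem pullback_equiv {W : Scheme.{u}} (f : W ⟶ Z) {L M : LineBundle Z} :
    L.Equiv M → (L.pullback f).Equiv (M.pullback f) := by
  rintro ⟨V, hV, hL, hM, h, H⟩
  refine ⟨fun w => f ⁻¹ᵁ V (f w), fun w => hV _, fun w _ hx => hL _ hx, fun w _ hx => hM _ hx,
    fun w => appUnits f _ (h (f w)), fun w w' => ?_⟩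
  have e := congrArg (appUnits f _) (H (f w) (f w'))
  simp only [map_mul, ← resUnits_appUnits' f] at e
  exact e

end LineBundle

/-- The Picard group of `Z`, the group `H¹(Z, 𝒪ˣ)` of isomorphism classes of line bundles. -/
def Pic (Z : Scheme.{u}) : Type u := Quotient (LineBundle.setoid Z)

namespace Pic

instance (Z : Scheme.{u}) : CommGroup (Pic Z) where
  mul := Quotient.map₂ LineBundle.tensor fun _ _ h _ _ h' => LineBundle.tensor_equiv h h'
  one := Quotient.mk _ (LineBundle.trivial Z)
  inv := Quotient.map LineBundle.dual fun _ _ h => LineBundle.dual_equiv h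
  mul_assoc := by
    rintro ⟨L⟩ ⟨M⟩ ⟨N⟩
    refine Quotient.sound (LineBundle.equiv_of_eq (fun x => L.U x ⊓ M.U x ⊓ N.U x)
      (fun x => ⟨⟨L.mem x, M.mem x⟩, N.mem x⟩) (fun x => le_rfl) (fun x => (inf_assoc _ _ _).le)
      fun x y => ?_)
    simp only [LineBundle.res_tensor, mul_assoc]
  one_mul := by
    rintro ⟨L⟩
    refine Quotient.sound (LineBundle.equiv_of_eq L.U L.mem (fun x => le_inf le_top le_rfl)
      (fun x => le_rfl) fun x y => ?_)
    simp only [LineBundle.res_tensor, LineBundle.res_trivial, one_mul]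
  mul_one := by
    rintro ⟨L⟩
    refine Quotient.sound (LineBundle.equiv_of_eq L.U L.mem (fun x => le_inf le_rfl le_top)
      (fun x => le_rfl) fun x y => ?_)
    simp only [LineBundle.res_tensor, LineBundle.res_trivial, mul_one]
  inv_mul_cancel := by
    rintro ⟨L⟩
    refine Quotient.sound (LineBundle.equiv_of_eq L.U L.mem (fun x => le_inf le_rfl le_rfl)
      (fun x => le_top) fun x y => ?_)
    simp only [LineBundle.res_tensor, LineBundle.res_dual, LineBundle.res_trivial, inv_mul_cancel]
  mul_comm := by
    rintro ⟨L⟩ ⟨M⟩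
    refine Quotient.sound (LineBundle.equiv_of_eq (fun x => L.U x ⊓ M.U x)
      (fun x => ⟨L.mem x, M.mem x⟩) (fun x => le_rfl) (fun x => (inf_comm _ _).le) fun x y => ?_)
    simp only [LineBundle.res_tensor]
    exact mul_comm _ _

/-- The homomorphism of Picard groups induced by a morphism of schemes. -/
def pullback {W Z : Scheme.{u}} (f : W ⟶ Z) : Pic Z →* Pic W where
  toFun := Quotient.map (LineBundle.pullback f) fun _ _ h => LineBundle.pullback_equiv f h
  map_one' := Quotient.sound (LineBundle.equiv_of_eq (fun _ => ⊤)
    (fun _ => TopologicalSpace.Opens.mem_top _) (fun _ => le_rfl) (fun _ => le_rfl)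
    fun x y => by
      rw [LineBundle.res_trivial]
      refine (LineBundle.res_pullback f (LineBundle.trivial Z) (w := x) (w' := y) (V := ⊤ ⊓ ⊤)
        (show _ ≤ (LineBundle.trivial Z).U (f x) ⊓ (LineBundle.trivial Z).U (f y) from le_rfl)
        _).trans ?_
      rw [LineBundle.res_trivial, map_one]
      rfl)
  map_mul' := by
    rintro ⟨L⟩ ⟨M⟩
    refine Quotient.sound (LineBundle.equiv_of_eq (fun w => f ⁻¹ᵁ (L.U (f w) ⊓ M.U (f w)))
      (fun w => ⟨L.mem _, M.mem _⟩) (fun w => le_rfl) (fun w => le_rfl) fun x y => ?_)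
    rw [LineBundle.res_tensor]
    have e (N : LineBundle Z)
      (h : L.U (f x) ⊓ M.U (f x) ⊓ (L.U (f y) ⊓ M.U (f y)) ≤ N.U (f x) ⊓ N.U (f y)) h' :=
      LineBundle.res_pullback f N (w := x) (w' := y) h h'
    refine (e (L.tensor M) (show _ ≤ (L.tensor M).U _ ⊓ (L.tensor M).U _ from le_rfl) _).trans ?_
    rw [LineBundle.res_tensor, map_mul]
    exact (congrArg₂ (· * ·) (e L (inf_le_inf inf_le_left inf_le_left) _)
      (e M (inf_le_inf inf_le_right inf_le_right) _)).symm

/-- `ₘPic(Z)`, the kernel of multiplication by `m` on the (here multiplicatively written) Picard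
group of `Z`. -/
def torsion (m : ℕ) (Z : Scheme.{u}) : Subgroup (Pic Z) := (powMonoidHom m : Pic Z →* Pic Z).ker

end Pic
end Pic

section ConstantGroup

variable (G : Type v) (S : Scheme.{u})

/-- The presheaf of groups on `S`-schemes which sends `T` to the group of locally constant
functions `T → G`. -/
def locConst [Group G] : (Over S)ᵒᵖ ⥤ GrpCat.{max u v} where
  obj T := GrpCat.of (LocallyConstant T.unop.left G)
  map f := GrpCat.ofHom (LocallyConstant.comapMonoidHom f.unop.left.base.hom)

variable [Finite G]

/-- The `S`-scheme `∐_{g ∈ G} S`. -/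
noncomputable def constScheme : Over S := Over.mk (Sigma.desc fun _ : G => 𝟙 S)

/-- The inclusion of the copy of `S` of index `g` in `∐_{g ∈ G} S`. -/
noncomputable def constι (g : G) : S ⟶ (constScheme G S).left := Sigma.ι (fun _ : G => S) g

instance (g : G) : IsOpenImmersion (constι G S g) :=
  (sigmaOpenCover fun _ : G => S).map_prop g

theorem constι_hom (g : G) : constι G S g ≫ (constScheme G S).hom = 𝟙 S := by
  simp [constι, constScheme]

theorem exists_constι (x : (constScheme G S).left) : ∃ g, ∃ s, constι G S g s = x := by
  obtain ⟨g, s, h⟩ := (sigmaOpenCover fun _ : G => S).exists_eq x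
  exact ⟨g, s, h⟩

theorem constι_inj {g h : G} {s t : S} (e : constι G S g s = constι G S h t) : g = h :=
  congrArg Sigma.fst ((sigmaι_eq_iff (fun _ : G => S) g h s t).1 e)

/-- The locally constant function on `∐_{g ∈ G} S` with value `g` on the copy of index `g`. -/
noncomputable def constIndex : LocallyConstant (constScheme G S).left G where
  toFun x := (exists_constι G S x).choose
  isLocallyConstant := by
    rw [IsLocallyConstant.iff_exists_open]
    intro x
    obtain ⟨g, s, rfl⟩ := exists_constι G S x
    refine ⟨(constι G S g).opensRange, (constι G S g).opensRange.2, ⟨s, rfl⟩, ?_⟩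
    rintro _ ⟨t, rfl⟩
    have h₁ := (exists_constι G S (constι G S g t)).choose_spec.choose_spec
    have h₂ := (exists_constι G S (constι G S g s)).choose_spec.choose_spec
    exact (constι_inj G S h₁).trans (constι_inj G S h₂).symm

theorem constIndex_ι (g : G) (s : S) : constIndex G S (constι G S g s) = g :=
  constι_inj G S (exists_constι G S (constι G S g s)).choose_spec.choose_spec

variable {G S}

/-- The open subscheme of `T` where a locally constant function has value `g`. -/
def levelSet {T : Scheme.{u}} (c : LocallyConstant T G) (g : G) : T.Opens :=
  ⟨c ⁻¹' {g}, c.isLocallyConstant.isOpen_fiber g⟩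

/-- A scheme is the disjoint union of the level sets of a locally constant function. -/
noncomputable def levelSetColimit {T : Scheme.{u}} (c : LocallyConstant T G) :
    IsColimit (Cofan.mk T fun g => (levelSet c g).ι) :=
  (nonempty_isColimit_cofanMk_of (fun g => (levelSet c g).ι)
    (by
      rw [eq_top_iff]
      intro x _
      exact TopologicalSpace.Opens.mem_iSup.2 ⟨c x, by rw [Scheme.Opens.opensRange_ι]; exact rfl⟩)
    (by
      intro g h hgh
      simp only [Function.onFun, Scheme.Opens.opensRange_ι]
      rw [← TopologicalSpace.Opens.coe_disjoint]
      exact Set.disjoint_left.2 fun x hx hx' => hgh (hx.symm.trans hx'))).some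

/-- The `S`-morphism `T ⟶ ∐_{g ∈ G} S` given by a locally constant function `T → G`. -/
noncomputable def constHom {T : Over S} (c : LocallyConstant T.left G) : T ⟶ constScheme G S :=
  Over.homMk (Cofan.IsColimit.desc (levelSetColimit c)
      fun g => (levelSet c g).ι ≫ T.hom ≫ constι G S g)
    (Cofan.IsColimit.hom_ext (levelSetColimit c) _ _ fun g => by
      rw [Cofan.IsColimit.fac_assoc, Category.assoc, Category.assoc, constι_hom, Category.comp_id]
      rfl)

theorem constHom_ι {T : Over S} (c : LocallyConstant T.left G) (g : G) :
    (levelSet c g).ι ≫ (constHom c).left = (levelSet c g).ι ≫ T.hom ≫ constι G S g :=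
  Cofan.IsColimit.fac (levelSetColimit c) _ g

variable (G S)

/-- `∐_{g ∈ G} S` represents the locally constant functions with values in `G`. -/
noncomputable def constRepresentableBy [Group G] :
    (locConst G S ⋙ forget GrpCat).RepresentableBy (constScheme G S) where
  homEquiv {T} :=
    { toFun := fun φ => (constIndex G S).comap φ.left.base.hom
      invFun := fun c => constHom c
      left_inv := fun φ => by
        refine Over.OverMorphism.ext (Cofan.IsColimit.hom_ext (levelSetColimit
          ((constIndex G S).comap φ.left.base.hom)) _ _ fun g => ?_)
        refine (constHom_ι _ g).trans ?_
        set U := levelSet ((constIndex G S).comap φ.left.base.hom) g with hU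
        have hr : Set.range (U.ι ≫ φ.left) ⊆ Set.range (constι G S g) := by
          rintro _ ⟨x, rfl⟩
          have hx : constIndex G S (φ.left (U.ι x)) = g := x.2
          obtain ⟨h, s, hs⟩ := exists_constι G S (φ.left (U.ι x))
          rw [← hs, constIndex_ι] at hx
          subst hx
          exact ⟨s, by simpa using hs⟩
        have e := IsOpenImmersion.lift_fac (constι G S g) (U.ι ≫ φ.left) hr
        have e' : IsOpenImmersion.lift (constι G S g) (U.ι ≫ φ.left) hr = U.ι ≫ T.hom := by
          have := congrArg (· ≫ (constScheme G S).hom) e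
          simpa only [Category.assoc, constι_hom, Category.comp_id, Over.w] using this
        rw [e'] at e
        simpa using e
      right_inv := fun (c : LocallyConstant T.left G) => by
        refine LocallyConstant.ext fun x => ?_
        have e := congrArg (fun f : (levelSet c (c x)).toScheme ⟶ (constScheme G S).left =>
          constIndex G S (f ⟨x, rfl⟩)) (constHom_ι c (c x))
        exact e.trans (constIndex_ι G S (c x) (T.hom x)) }
  homEquiv_comp f φ := rfl

/-- The constant group scheme over `S` with group `G`: its `T`-valued points are the locally
constant functions `T → G`. -/
noncomputable instance constGrpObj [Group G] : GrpObj (constScheme G S) :=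
  GrpObj.ofRepresentableBy _ (locConst G S) (constRepresentableBy G S)

end ConstantGroup

section Torsor

open MonoidalCategory CartesianMonoidalCategory MonObj

/-- A scheme is normal if all its local rings are integrally closed domains. -/
class IsNormalScheme (X : Scheme.{u}) : Prop where
  isDomain_stalk (x : X) : IsDomain (X.presheaf.stalk x)
  isIntegrallyClosed_stalk (x : X) : IsIntegrallyClosed (X.presheaf.stalk x)

/-- Let `H` be a group scheme over `S` acting on an `S`-scheme `Y`. The `S`-morphism `π : Y ⟶ X` is
an `H`-torsor if it is an fppf covering, is `H`-invariant, and if the map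
`H × Y ⟶ Y ×_X Y`, `(h, y) ↦ (h y, y)`, is an isomorphism. -/
structure IsTorsor {S : Scheme.{u}} (H : Over S) [GrpObj H] {Y X : Over S} [ModObj H Y]
    (π : Y ⟶ X) : Prop where
  flat : Flat π.left
  surjective : Surjective π.left
  locallyOfFinitePresentation : LocallyOfFinitePresentation π.left
  isPullback : IsPullback (γ[H, Y] : H ⊗ Y ⟶ Y) (snd H Y) π π

variable {R : Type u} [CommRing R] (K : Type u) [Field K] [Algebra R K]

/-- The morphism `Spec K ⟶ Spec R` for an `R`-algebra `K`. -/
noncomputable abbrev specMap (R : Type u) [CommRing R] (K : Type u) [CommRing K] [Algebra R K] :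
    Spec (.of K) ⟶ Spec (.of R) :=
  Spec.map (CommRingCat.ofHom (algebraMap R K))

/-- The `K`-scheme `X_K = X ×_R K`. -/
noncomputable abbrev genericFibre (X : Over (Spec (.of R))) : Over (Spec (.of K)) :=
  (Over.pullback (specMap R K)).obj X

/-- The projection `X_K ⟶ X`. -/
noncomputable abbrev genericFibreι (X : Over (Spec (.of R))) : (genericFibre K X).left ⟶ X.left :=
  pullback.fst X.hom (specMap R K)

/-- The special fibre `X_k` of a scheme over a local ring `R` with residue field `k`. -/
noncomputable abbrev specialFibre [IsLocalRing R] (X : Over (Spec (.of R))) :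
    Over (Spec (.of (IsLocalRing.ResidueField R))) :=
  (Over.pullback (specMap R (IsLocalRing.ResidueField R))).obj X

variable {K} {X : Over (Spec (.of R))} {YK : Over (Spec (.of K))}

/-- The composite `Y_K ⟶ X_K ⟶ X`. -/
noncomputable abbrev toModel (fK : YK ⟶ genericFibre K X) : YK.left ⟶ X.left :=
  fK.left ≫ genericFibreι K X

variable (fK : YK ⟶ genericFibre K X) [IsNoetherian YK.left]

/-- The normalization `Y` of `X` in `Y_K`, as an `R`-scheme. -/
noncomputable def normalizationIn : Over (Spec (.of R)) :=
  Over.mk ((toModel fK).fromNormalization ≫ X.hom)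

/-- The morphism `Y ⟶ X` from the normalization of `X` in `Y_K` to `X`. -/
noncomputable def normalizationInHom : normalizationIn fK ⟶ X :=
  Over.homMk (toModel fK).fromNormalization

/-- The canonical morphism `Y_K ⟶ Y` to the normalization of `X` in `Y_K`. -/
noncomputable def toNormalizationIn : YK.left ⟶ (normalizationIn fK).left :=
  (toModel fK).toNormalization

theorem toNormalizationIn_hom :
    toNormalizationIn fK ≫ (normalizationIn fK).hom = YK.hom ≫ specMap R K := by
  have h : fK.left ≫ pullback.snd X.hom (specMap R K) = YK.hom := Over.w fK
  change (toModel fK).toNormalization ≫ (toModel fK).fromNormalization ≫ X.hom = _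
  rw [Scheme.Hom.toNormalization_fromNormalization_assoc, Category.assoc, pullback.condition,
    ← Category.assoc, h]

/-- For an isomorphism `e : 𝒢_K ≅ H`, the morphism `H ×_K Y_K ⟶ 𝒢 ×_R Y` induced by
`H ≅ 𝒢_K ⟶ 𝒢` and by `Y_K ⟶ Y`. -/
noncomputable def modelMap {H : Over (Spec (.of K))} {𝒢 : Over (Spec (.of R))}
    (e : genericFibre K 𝒢 ≅ H) : (H ⊗ YK).left ⟶ (𝒢 ⊗ normalizationIn fK).left :=
  pullback.map H.hom YK.hom 𝒢.hom (normalizationIn fK).hom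
    (e.inv.left ≫ genericFibreι K 𝒢) (toNormalizationIn fK) (specMap R K)
    (by
      have h : e.inv.left ≫ pullback.snd 𝒢.hom (specMap R K) = H.hom := Over.w e.inv
      rw [Category.assoc, pullback.condition, ← Category.assoc, h])
    (toNormalizationIn_hom fK).symm

open scoped Obj in
/-- Let `fK : Y_K ⟶ X_K` be a torsor under a `K`-group scheme `H`, and let `Y` be the normalization
of `X` in `Y_K`. The torsor is strongly extendible if there are a finite flat `R`-group scheme `𝒢`,
an isomorphism of group schemes `𝒢_K ≅ H`, and an action of `𝒢` on `Y` such that `Y ⟶ X` is a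
`𝒢`-torsor and such that the action of `𝒢` on `Y` coincides with the action of `H` on `Y_K` on the
generic fibre. -/
def IsStronglyExtendible (H : Over (Spec (.of K))) [GrpObj H] [ModObj H YK] : Prop :=
  ∃ (𝒢 : Over (Spec (.of R))) (_ : GrpObj 𝒢) (e : genericFibre K 𝒢 ≅ H)
    (_ : ModObj 𝒢 (normalizationIn fK)),
    IsFinite 𝒢.hom ∧ Flat 𝒢.hom ∧ IsMonHom e.hom ∧
    IsTorsor 𝒢 (normalizationInHom fK) ∧
    modelMap fK e ≫ (γ[𝒢, normalizationIn fK] : 𝒢 ⊗ normalizationIn fK ⟶ _).left =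
      (γ[H, YK] : H ⊗ YK ⟶ YK).left ≫ toNormalizationIn fK

end Torsor

end TorsorExtension

/-! The extending group scheme is the constant group `G` over `R`. As `m` is prime to `p`, it is a
unit of `R`; as `R` contains a primitive `m`-th root of unity, the characters `χ : G →* Rˣ` satisfy
both orthogonality relations. Functions on a `G`-covering therefore split into eigenspaces, and the
point is to find, locally on `X`, an invertible function `ε χ` on `Y` in every eigenspace.

On the generic fibre, `Y_K → X_K` is a Galois covering and invertible eigenfunctions exist locally
on `X_K` (`IsGaloisCover.exists_isEigen`). Quotients of two of them for the same `χ` are invariant,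
so they form the cocycle of a line bundle on `X_K`; the `m`-th powers of the eigenfunctions
trivialize its `m`-th power. This torsion line bundle extends to `X` by hypothesis, so an invertible
eigenfunction `e` exists above `U_K` for small opens `U` of `X`
(`IsGaloisCover.exists_isEigen_preimage`).

Let `A` be the ring of functions on an affine `U`, `B` its integral closure in the functions on
`Y_K` above `U`, and `ϖ` a uniformizer. As `X_k` is integral, `ϖ` is prime or a unit in `A`, so the
unit `e ^ m` of `A[1/ϖ]` is a power of `ϖ` times a unit `w` of `A`. Multiplying `e` by a power of
`ϖ` gives `e ^ m = ϖ ^ r * w` with `0 ≤ r < m`. If `ϖ` is not a unit and `r > 0`, then `ϖ` divides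
`e ^ m` in `B`, hence divides `e` because `B / ϖ` is reduced, and then `ϖ ^ m` divides `ϖ ^ r * w`,
which is absurd. So `e` can be made a unit of `B` (`exists_isIntegral_rescale`,
`IsGaloisCover.exists_isEigen_normalization`).

The invariants of `B` are `A` because `X` is normal. Hence `B` is free over `A` on the `ε χ`, and in
this basis `B ⊗ B → ∏_G B` is a Fourier transform followed by multiplications by units, so it is
bijective (`IsKummerOn.exists_linearEquiv`, `IsKummerOn.bijective_app`, `isTorsor_of_isKummerOn`).
-/

namespace TorsorExtension

open MonoidalCategory CartesianMonoidalCategory MonObj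

/-! ### Actions of constant group schemes as actions by automorphisms. -/

section ConstantAction

variable {G : Type v} [Finite G] {S : Scheme.{u}}

/-- The constant `T`-valued point of the constant group scheme with value `g`. -/
noncomputable def constPt (T : Over S) (g : G) : T ⟶ constScheme G S :=
  Over.homMk (T.hom ≫ constι G S g) (by rw [Category.assoc, constι_hom, Category.comp_id])

theorem comp_constPt {T T' : Over S} (φ : T' ⟶ T) (g : G) :
    φ ≫ constPt T g = constPt T' g := by
  ext1
  simp [constPt]

/-- The inclusion of the copy of index `g` of `T` in the product of `T` with the constant group
scheme. -/
noncomputable def inc (T : Over S) (g : G) : T ⟶ constScheme G S ⊗ T :=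
  lift (constPt T g) (𝟙 T)

@[simp]
theorem inc_fst (T : Over S) (g : G) : inc T g ≫ fst _ _ = constPt T g := lift_fst _ _

@[simp]
theorem inc_snd (T : Over S) (g : G) : inc T g ≫ snd _ _ = 𝟙 T := lift_snd _ _

@[simp]
theorem inc_snd_assoc (T : Over S) (g : G) {Z : Over S} (φ : T ⟶ Z) :
    inc T g ≫ snd _ _ ≫ φ = φ := lift_snd_assoc _ _ _

/-- Pasting with the square defining the product leaves a square with two identities as horizontal
composites. It makes `inc T g` an open immersion, as a base change of `constι G S g`. -/
theorem isPullback_inc (T : Over S) (g : G) :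
    IsPullback (inc T g).left T.hom (pullback.fst (constScheme G S).hom T.hom) (constι G S g) := by
  refine IsPullback.of_right (h₁₂ := pullback.snd (constScheme G S).hom T.hom)
    (h₂₂ := (constScheme G S).hom) (v₁₃ := T.hom) ?_ ?_
    (IsPullback.of_hasPullback (constScheme G S).hom T.hom).flip
  · have h : (inc T g).left ≫ pullback.snd (constScheme G S).hom T.hom = 𝟙 _ :=
      congr_arg CommaMorphism.left (inc_snd T g)
    rw [h, constι_hom]
    exact IsPullback.of_horiz_isIso ⟨by simp⟩
  · exact congr_arg CommaMorphism.left (inc_fst T g)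

instance (T : Over S) (g : G) : IsOpenImmersion (inc T g).left :=
  MorphismProperty.of_isPullback (isPullback_inc T g).flip inferInstance

theorem exists_inc_eq (T : Over S) (x : (constScheme G S ⊗ T).left) :
    ∃ g, ∃ t, (inc T g).left t = x := by
  obtain ⟨g, s, h⟩ := exists_constι G S (pullback.fst (constScheme G S).hom T.hom x)
  obtain ⟨t, ht, -⟩ := Scheme.exists_preimage_of_isPullback (isPullback_inc T g) x s h.symm
  exact ⟨g, t, ht⟩

theorem inc_inj (T : Over S) {g h : G} {t t' : T.left} (e : (inc T g).left t = (inc T h).left t') :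
    g = h := by
  have e' := congrArg (pullback.fst (constScheme G S).hom T.hom) e
  rw [← Scheme.Hom.comp_apply, ← Scheme.Hom.comp_apply, (isPullback_inc T g).w,
    (isPullback_inc T h).w] at e'
  exact constι_inj G S e'

/-- The product of `T` with the constant group scheme is the disjoint union of the copies of `T`. -/
noncomputable def incColimit (T : Over S) :
    IsColimit (Cofan.mk (constScheme G S ⊗ T).left fun g => (inc T g).left) :=
  (nonempty_isColimit_cofanMk_of (fun g => (inc T g).left)
    (by
      rw [eq_top_iff]
      intro x _
      obtain ⟨g, t, h⟩ := exists_inc_eq T x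
      exact TopologicalSpace.Opens.mem_iSup.2 ⟨g, t, h⟩)
    (by
      intro g h hgh
      rw [Function.onFun, ← TopologicalSpace.Opens.coe_disjoint]
      refine Set.disjoint_left.2 ?_
      rintro _ ⟨t, rfl⟩ ⟨t', ht'⟩
      exact hgh (inc_inj T ht').symm)).some

theorem inc_hom_ext {T : Over S} {Z : Scheme.{u}} {φ ψ : (constScheme G S ⊗ T).left ⟶ Z}
    (h : ∀ g, (inc T g).left ≫ φ = (inc T g).left ≫ ψ) : φ = ψ :=
  Cofan.IsColimit.hom_ext (incColimit T) _ _ h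

theorem inc_over_hom_ext {T Z : Over S} {φ ψ : constScheme G S ⊗ T ⟶ Z}
    (h : ∀ g, inc T g ≫ φ = inc T g ≫ ψ) : φ = ψ :=
  Over.OverMorphism.ext (inc_hom_ext fun g => congr_arg CommaMorphism.left (h g))

/-- The morphism out of the product of `T` with the constant group scheme which is `φ g` on the
copy of `T` of index `g`. -/
noncomputable def incDesc {T Z : Over S} (φ : G → (T ⟶ Z)) : constScheme G S ⊗ T ⟶ Z :=
  Over.homMk (Cofan.IsColimit.desc (incColimit T) fun g => (φ g).left)
    (inc_hom_ext fun g => by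
      have h : (inc T g).left ≫ (constScheme G S ⊗ T).hom = T.hom := Over.w _
      rw [h, ← Over.w (φ g)]
      exact Cofan.IsColimit.fac_assoc (incColimit T) _ g _)

@[simp]
theorem inc_incDesc {T Z : Over S} (φ : G → (T ⟶ Z)) (g : G) : inc T g ≫ incDesc φ = φ g :=
  Over.OverMorphism.ext (Cofan.IsColimit.fac (incColimit T) _ g)

@[simp]
theorem inc_incDesc_assoc {T Z Z' : Over S} (φ : G → (T ⟶ Z)) (g : G) (ψ : Z ⟶ Z') :
    inc T g ≫ incDesc φ ≫ ψ = φ g ≫ ψ := by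
  rw [← Category.assoc, inc_incDesc]

theorem comp_inc {T T' : Over S} (φ : T' ⟶ T) (g : G) :
    φ ≫ inc T g = inc T' g ≫ (constScheme G S ◁ φ) := by
  ext1 <;> simp [inc, comp_constPt]

theorem comp_inc_assoc {T T' Z : Over S} (φ : T' ⟶ T) (g : G) (ψ : constScheme G S ⊗ T ⟶ Z) :
    φ ≫ inc T g ≫ ψ = inc T' g ≫ (constScheme G S ◁ φ) ≫ ψ := by
  rw [← Category.assoc, comp_inc, Category.assoc]

variable [Group G]

/-- This is Yoneda: `μ` corresponds to the product of the two projections, and every pair `(a, b)`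
is a pull-back of that universal pair. -/
theorem homEquiv_mul {T : Over S} (a b : T ⟶ constScheme G S) :
    (constRepresentableBy G S).homEquiv (lift a b ≫ μ[constScheme G S]) =
      ((constRepresentableBy G S).homEquiv a * (constRepresentableBy G S).homEquiv b :
        LocallyConstant T.left G) := by
  have h : (constRepresentableBy G S).homEquiv (μ[constScheme G S]) =
      ((constRepresentableBy G S).homEquiv (fst (constScheme G S) (constScheme G S)) *
        (constRepresentableBy G S).homEquiv (snd (constScheme G S) (constScheme G S)) :
        LocallyConstant _ G) :=
    (constRepresentableBy G S).homEquiv.apply_symm_apply _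
  rw [(constRepresentableBy G S).homEquiv_comp, h]
  conv_rhs => rw [← lift_fst a b, ← lift_snd a b]
  rw [(constRepresentableBy G S).homEquiv_comp, (constRepresentableBy G S).homEquiv_comp]
  simp only [lift_snd]
  rfl

theorem homEquiv_one {T : Over S} :
    (constRepresentableBy G S).homEquiv (toUnit T ≫ η[constScheme G S]) =
      (1 : LocallyConstant T.left G) := by
  have h : (constRepresentableBy G S).homEquiv (η[constScheme G S]) =
      (1 : LocallyConstant _ G) :=
    (constRepresentableBy G S).homEquiv.apply_symm_apply _
  rw [(constRepresentableBy G S).homEquiv_comp, h]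
  rfl

theorem homEquiv_constPt (T : Over S) (g : G) :
    (constRepresentableBy G S).homEquiv (constPt T g) = LocallyConstant.const T.left g :=
  LocallyConstant.ext fun x => constIndex_ι G S g (T.hom x)

theorem constPt_mul (T : Over S) (g h : G) :
    lift (constPt T g) (constPt T h) ≫ μ[constScheme G S] = constPt T (g * h) := by
  apply (constRepresentableBy G S).homEquiv.injective
  rw [homEquiv_mul, homEquiv_constPt, homEquiv_constPt, homEquiv_constPt]
  rfl

theorem constPt_one (T : Over S) :
    toUnit T ≫ η[constScheme G S] = constPt T (1 : G) := by
  apply (constRepresentableBy G S).homEquiv.injective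
  rw [homEquiv_one, homEquiv_constPt]
  rfl

section Extract

variable (Y : Over S) [ModObj (constScheme G S) Y]

/-- The automorphism of `Y` given by the action of an element of the constant group. -/
noncomputable def act (g : G) : Y ⟶ Y := inc Y g ≫ γ[constScheme G S, Y]

theorem act_eq_smul (g : G) : act Y g = constPt Y g • 𝟙 Y := rfl

theorem act_one : act Y (1 : G) = 𝟙 Y := by
  rw [act_eq_smul, ← constPt_one]
  exact one_smul _ _

theorem act_mul (g h : G) : act Y (g * h) = act Y h ≫ act Y g := by
  rw [act_eq_smul Y g, ModObj.comp_smul, comp_constPt, Category.comp_id, act_eq_smul Y h,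
    ← mul_smul, act_eq_smul]
  congr 1
  exact (constPt_mul Y g h).symm

end Extract

/-- The action of the constant group scheme given by an action of the group by automorphisms. -/
noncomputable abbrev modObjOfAct {Y : Over S} (ρ : G → (Y ⟶ Y)) (h1 : ρ 1 = 𝟙 Y)
    (hmul : ∀ g h, ρ (g * h) = ρ h ≫ ρ g) : ModObj (constScheme G S) Y where
  smul := incDesc ρ
  one_smul := by
    change η[constScheme G S] ▷ Y ≫ _ = (λ_ Y).hom
    rw [← cancel_epi (λ_ Y).inv, Iso.inv_hom_id, ← h1, ← inc_incDesc ρ, ← Category.assoc]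
    congr 1
    ext1
    · rw [inc_fst, ← constPt_one, Category.assoc, whiskerRight_fst, leftUnitor_inv_fst_assoc]
    · simp
  mul_smul := by
    change μ[constScheme G S] ▷ Y ≫ _ = (α_ _ _ _).hom ≫ _ ◁ _ ≫ _
    rw [← cancel_epi (α_ _ _ _).inv, Iso.inv_hom_id_assoc]
    refine inc_over_hom_ext fun g => inc_over_hom_ext fun h => ?_
    -- Associativity is tested on the copies of `Y`: multiplication sends the copy of index `(g, h)`
    -- to the copy of index `g * h`.
    have e : inc Y h ≫ inc (constScheme G S ⊗ Y) g ≫ (α_ _ _ _).inv ≫ μ[constScheme G S] ▷ Y =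
        inc Y (g * h) := by
      ext1
      · have e' : inc Y h ≫ inc (constScheme G S ⊗ Y) g ≫ (α_ _ _ _).inv ≫ fst _ _ =
            lift (constPt Y g) (constPt Y h) := by
          ext1 <;> simp [comp_constPt]
        rw [inc_fst, ← constPt_mul, ← e']
        simp only [Category.assoc, whiskerRight_fst]
      · simp
    rw [← comp_inc_assoc, inc_incDesc, inc_incDesc_assoc, ← hmul, ← inc_incDesc ρ (g * h), ← e]
    simp only [Category.assoc]

end ConstantAction

/-! ### Finiteness, flatness and base change of constant group schemes. -/

section ConstantGeneric

theorem isFinite_constScheme (G : Type v) [Finite G] (R : CommRingCat.{u}) :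
    IsFinite (constScheme G (Spec R)).hom := by
  -- `G` lives in its own universe; a small copy of it is needed to identify the coproduct with the
  -- spectrum of the ring of functions from `G` to `R`.
  let e := equivShrink.{u} G
  have : Finite (Shrink.{u} G) := Finite.of_equiv _ e
  have h : (constScheme G (Spec R)).hom =
      (Sigma.reindex e (fun _ : Shrink.{u} G => Spec R)).hom ≫
        sigmaSpec (fun _ : Shrink.{u} G => R) ≫
        Spec.map (CommRingCat.ofHom (RingHom.pi fun _ : Shrink.{u} G => RingHom.id R)) := by
    refine Sigma.hom_ext _ _ fun g => ?_
    have h' := Sigma.ι_reindex_hom_assoc e (fun _ : Shrink.{u} G => Spec R) g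
      (sigmaSpec (fun _ : Shrink.{u} G => R) ≫ Spec.map (CommRingCat.ofHom
        (RingHom.pi fun _ : Shrink.{u} G => RingHom.id R)))
    refine Eq.trans ?_ h'.symm
    rw [ι_sigmaSpec_assoc, ← Spec.map_comp]
    exact (constι_hom G _ g).trans (Spec.map_id _).symm
  rw [h]
  have : IsFinite (Spec.map (CommRingCat.ofHom
      (RingHom.pi fun _ : Shrink.{u} G => RingHom.id R))) := by
    rw [IsFinite.SpecMap_iff]
    exact (inferInstance : Module.Finite R (Shrink.{u} G → R))
  have : IsFinite (sigmaSpec (fun _ : Shrink.{u} G => R) ≫ Spec.map (CommRingCat.ofHom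
      (RingHom.pi fun _ : Shrink.{u} G => RingHom.id R))) := inferInstance
  exact MorphismProperty.comp_mem @IsFinite _ _
    (inferInstanceAs (IsFinite (Sigma.reindex e (fun _ : Shrink.{u} G => Spec R)).hom)) this

theorem flat_constScheme (G : Type v) [Finite G] (S : Scheme.{u}) :
    Flat (constScheme G S).hom :=
  inferInstanceAs (Flat (Sigma.desc fun _ : G => 𝟙 S))

variable {G : Type v} [Finite G] {S S' : Scheme.{u}} (j : S' ⟶ S)

/-- The canonical morphism from the base change of the constant group scheme. -/
noncomputable def constPullbackHom :
    (Over.pullback j).obj (constScheme G S) ⟶ constScheme G S' :=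
  constHom ((constIndex G S).comap (pullback.fst (constScheme G S).hom j).base.hom)

/-- The projection from a constant group scheme over `S'` to the one over `S`. -/
noncomputable def constProj : (constScheme G S').left ⟶ (constScheme G S).left :=
  (constHom (T := Over.mk ((constScheme G S').hom ≫ j)) (constIndex G S')).left

theorem constProj_hom :
    constProj (G := G) j ≫ (constScheme G S).hom = (constScheme G S').hom ≫ j :=
  Over.w (constHom (T := Over.mk ((constScheme G S').hom ≫ j)) (constIndex G S'))

variable [Group G]

/-- Morphisms over `S` into the constant scheme are locally constant functions, so points suffice to
compare them. The base change identities below rest on this. -/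
theorem constScheme_hom_ext {T : Over S} {φ ψ : T ⟶ constScheme G S}
    (h : ∀ x, constIndex G S (φ.left x) = constIndex G S (ψ.left x)) : φ = ψ :=
  (constRepresentableBy G S).homEquiv.injective (LocallyConstant.ext h)

theorem constIndex_constHom {T : Over S} (c : LocallyConstant T.left G) (x : T.left) :
    constIndex G S ((constHom c).left x) = c x :=
  LocallyConstant.congr_fun ((constRepresentableBy G S).homEquiv.apply_symm_apply c) x

theorem constIndex_mul (x : (constScheme G S ⊗ constScheme G S).left) :
    constIndex G S ((μ[constScheme G S]).left x) =
      constIndex G S ((fst (constScheme G S) (constScheme G S)).left x) *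
        constIndex G S ((snd (constScheme G S) (constScheme G S)).left x) := by
  have h := homEquiv_mul (fst (constScheme G S) (constScheme G S)) (snd _ _)
  rw [lift_fst_snd, Category.id_comp] at h
  exact LocallyConstant.congr_fun h x

theorem constIndex_one (x : (𝟙_ (Over S)).left) :
    constIndex G S ((η[constScheme G S]).left x) = 1 :=
  LocallyConstant.congr_fun ((constRepresentableBy G S).homEquiv.apply_symm_apply
    (1 : LocallyConstant _ G)) x

theorem constIndex_constProj (x : (constScheme G S').left) :
    constIndex G S (constProj j x) = constIndex G S' x :=
  constIndex_constHom (T := Over.mk ((constScheme G S').hom ≫ j)) _ _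

theorem constι_constProj (g : G) :
    constι G S' g ≫ constProj j = j ≫ constι G S g := by
  have e : (constι G S' g ≫ constProj j) ≫ (constScheme G S).hom = (Over.mk j).hom := by
    rw [Category.assoc, constProj_hom, ← Category.assoc, constι_hom, Category.id_comp]
    rfl
  refine congr_arg CommaMorphism.left (constScheme_hom_ext (G := G) (T := Over.mk j)
    (φ := Over.homMk (constι G S' g ≫ constProj j) e) (ψ := constPt (Over.mk j) g) fun x => ?_)
  exact ((constIndex_constProj j _).trans (constIndex_ι G S' g x)).trans
    (constIndex_ι G S g (j x)).symm

theorem constPullbackHom_constProj :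
    (constPullbackHom (G := G) j).left ≫ constProj j = pullback.fst (constScheme G S).hom j := by
  let T : Over S := Over.mk (pullback.snd (constScheme G S).hom j ≫ j)
  have e : ((constPullbackHom (G := G) j).left ≫ constProj j) ≫ (constScheme G S).hom =
      T.hom := by
    rw [Category.assoc, constProj_hom, ← Category.assoc, Over.w]
    rfl
  refine congr_arg CommaMorphism.left (constScheme_hom_ext (G := G) (T := T)
    (φ := Over.homMk ((constPullbackHom (G := G) j).left ≫ constProj j) e)
    (ψ := Over.homMk (pullback.fst (constScheme G S).hom j) pullback.condition) fun x => ?_)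
  exact (constIndex_constProj j _).trans (constIndex_constHom _ _)

/-- The formation of the constant group scheme commutes with base change. -/
noncomputable def constPullbackIso :
    (Over.pullback j).obj (constScheme G S) ≅ constScheme G S' where
  hom := constPullbackHom j
  inv := Over.homMk (V := (Over.pullback j).obj (constScheme G S))
    (pullback.lift (constProj j) (constScheme G S').hom (constProj_hom j))
    (pullback.lift_snd _ _ _)
  hom_inv_id := by
    refine Over.OverMorphism.ext (pullback.hom_ext ?_ ?_)
    · refine (Category.assoc _ _ _).trans ?_
      refine (congr_arg ((constPullbackHom j).left ≫ ·) (pullback.lift_fst _ _ _)).trans ?_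
      exact (constPullbackHom_constProj j).trans (Category.id_comp _).symm
    · refine (Category.assoc _ _ _).trans ?_
      refine (congr_arg ((constPullbackHom j).left ≫ ·) (pullback.lift_snd _ _ _)).trans ?_
      exact (Over.w (constPullbackHom j)).trans (Category.id_comp _).symm
  inv_hom_id := by
    refine constScheme_hom_ext fun x => ?_
    refine (constIndex_constHom _ _).trans ?_
    change constIndex G S ((pullback.lift (constProj j) (constScheme G S').hom
      (constProj_hom j) ≫ pullback.fst _ _) x) = _
    rw [pullback.lift_fst]
    exact constIndex_constProj j x

theorem constPullbackIso_inv_fst :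
    (constPullbackIso (G := G) j).inv.left ≫ pullback.fst (constScheme G S).hom j = constProj j :=
  pullback.lift_fst _ _ _

theorem constIndex_constPullbackIso (x : ((Over.pullback j).obj (constScheme G S)).left) :
    constIndex G S' ((constPullbackIso j).hom.left x) =
      constIndex G S (pullback.fst (constScheme G S).hom j x) :=
  constIndex_constHom _ _

open scoped Obj in
theorem isMonHom_constPullbackIso : IsMonHom (constPullbackIso (G := G) j).hom where
  one_hom := by
    refine constScheme_hom_ext fun x => ?_
    rw [constIndex_one, Over.comp_left, Scheme.Hom.comp_apply, constIndex_constPullbackIso,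
      Functor.obj.η_def, Over.comp_left, ← Scheme.Hom.comp_apply, Category.assoc]
    have h : ((Over.pullback j).map η[constScheme G S]).left ≫
        pullback.fst (constScheme G S).hom j = pullback.fst _ j ≫ (η[constScheme G S]).left :=
      pullback.lift_fst _ _ _
    rw [h, Scheme.Hom.comp_apply, Scheme.Hom.comp_apply, constIndex_one]
  mul_hom := by
    refine constScheme_hom_ext fun x => ?_
    rw [Over.comp_left, Over.comp_left, Scheme.Hom.comp_apply, Scheme.Hom.comp_apply,
      constIndex_mul, constIndex_constPullbackIso, Functor.obj.μ_def, Over.comp_left,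
      ← Scheme.Hom.comp_apply, Category.assoc]
    have h : ((Over.pullback j).map μ[constScheme G S]).left ≫
        pullback.fst (constScheme G S).hom j = pullback.fst _ j ≫ (μ[constScheme G S]).left :=
      pullback.lift_fst _ _ _
    rw [h, Scheme.Hom.comp_apply, Scheme.Hom.comp_apply, constIndex_mul]
    simp only [← Scheme.Hom.comp_apply, ← Over.comp_left, tensorHom_fst, tensorHom_snd]
    simp only [Over.comp_left, Scheme.Hom.comp_apply, constIndex_constPullbackIso]
    congr 2
    · exact congr_arg (fun φ => φ.base x) (Over.μ_pullback_left_fst_fst (f := j)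
        (constScheme G S) (constScheme G S))
    · exact congr_arg (fun φ => φ.base x) (Over.μ_pullback_left_fst_snd (f := j)
        (constScheme G S) (constScheme G S))

end ConstantGeneric

/-! ### Torsors under constant groups are finite. -/

theorem isFinite_of_finite_fibres {Y X : Scheme.{u}} (f : Y ⟶ X)
    [UniversallyClosed f] [IsSeparated f] [LocallyOfFiniteType f] [QuasiCompact f]
    (h : ∀ x, (f ⁻¹' {x}).Finite) : IsFinite f := by
  have : LocallyQuasiFinite f := .of_finite_preimage_singleton f h
  have : IsProper f := {}
  exact IsFinite.of_isProper_of_locallyQuasiFinite f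

section Torsor

variable {G : Type v} [Group G] [Finite G] {R : CommRingCat.{u}} {X Y : Over (Spec R)}
  [ModObj (constScheme G (Spec R)) Y] {π : Y ⟶ X}

theorem IsTorsor.isPullback_left (hπ : IsTorsor (constScheme G (Spec R)) π) :
    IsPullback (γ[constScheme G (Spec R), Y]).left (pullback.snd (constScheme G (Spec R)).hom Y.hom)
      π.left π.left :=
  hπ.isPullback.map (Over.forget _)

theorem IsTorsor.act_comp (hπ : IsTorsor (constScheme G (Spec R)) π) (g : G) :
    act Y g ≫ π = π := by
  rw [act, Category.assoc, hπ.isPullback.w, inc_snd_assoc]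

instance isFinite_snd_constScheme (T : Over (Spec R)) :
    IsFinite (pullback.snd (constScheme G (Spec R)).hom T.hom) :=
  have := isFinite_constScheme G R
  inferInstance

/-- The morphism is proper with finite fibres. Universal closedness descends along `π` from the
projection `G × Y → Y`, the base change of `π` along itself; the diagonal of `π` is the unit section
of that projection followed by an isomorphism, hence closed; the fibres are orbits of `G`. -/
theorem IsTorsor.isFinite (hπ : IsTorsor (constScheme G (Spec R)) π) [QuasiCompact π.left] :
    IsFinite π.left := by
  have h1 := hπ.flat
  have h2 := hπ.surjective
  have h3 := hπ.locallyOfFinitePresentation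
  have hp := hπ.isPullback_left
  have : UniversallyClosed π.left :=
    MorphismProperty.of_isPullback_of_descendsAlong (P := @UniversallyClosed)
      (Q := @Surjective ⊓ @Flat ⊓ @QuasiCompact) hp.flip ⟨⟨h2, h1⟩, inferInstance⟩
      inferInstance
  have : IsClosedImmersion (inc Y (1 : G)).left := by
    have h : (inc Y (1 : G)).left ≫ pullback.snd (constScheme G (Spec R)).hom Y.hom = 𝟙 _ :=
      congr_arg CommaMorphism.left (inc_snd Y (1 : G))
    have : IsClosedImmersion ((inc Y (1 : G)).left ≫
      pullback.snd (constScheme G (Spec R)).hom Y.hom) := h ▸ inferInstance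
    exact IsClosedImmersion.of_comp _ (pullback.snd (constScheme G (Spec R)).hom Y.hom)
  have : IsSeparated π.left := by
    constructor
    have e : pullback.diagonal π.left = (inc Y (1 : G)).left ≫ hp.isoPullback.hom := by
      have h1 : (inc Y (1 : G)).left ≫ (γ[constScheme G (Spec R), Y]).left = 𝟙 _ :=
        congr_arg CommaMorphism.left (act_one (G := G) Y)
      have h2 : (inc Y (1 : G)).left ≫ pullback.snd (constScheme G (Spec R)).hom Y.hom = 𝟙 _ :=
        congr_arg CommaMorphism.left (inc_snd Y (1 : G))
      refine pullback.hom_ext ?_ ?_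
      · simp [h1]
      · simp [h2]
    rw [e]
    infer_instance
  refine isFinite_of_finite_fibres _ fun x => ?_
  rcases (π.left ⁻¹' {x}).eq_empty_or_nonempty with h | ⟨y, hy⟩
  · rw [h]
    exact Set.finite_empty
  refine (Set.finite_range fun g : G => (act Y g).left y).subset fun y' hy' => ?_
  obtain ⟨z, hz, hz'⟩ := Scheme.exists_preimage_of_isPullback hp y' y
    ((show π.left y' = x from hy').trans (show π.left y = x from hy).symm)
  obtain ⟨g, t, rfl⟩ := exists_inc_eq Y z
  refine ⟨g, ?_⟩
  have h2 : (inc Y g).left ≫ pullback.snd (constScheme G (Spec R)).hom Y.hom = 𝟙 _ :=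
    congr_arg CommaMorphism.left (inc_snd Y g)
  have : t = y := by
    have := congr_arg (fun φ => φ.base t) h2
    exact this.symm.trans hz'
  subst this
  exact hz

end Torsor

/-! ### Functions on preimages of opens, and their faithfully flat descent. -/

section Sections

variable {Y Z : Scheme.{u}} (f : Y ⟶ Z)

theorem le_preimage_of_comp_eq {ρ : Y ⟶ Y} (h : ρ ≫ f = f) (V : Z.Opens) :
    f ⁻¹ᵁ V ≤ ρ ⁻¹ᵁ (f ⁻¹ᵁ V) := by
  rw [← Scheme.Hom.comp_preimage, h]

/-- The action of an endomorphism of `Y` over `Z` on the functions on the preimage of an open of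
`Z`. -/
noncomputable def secAct {ρ : Y ⟶ Y} (h : ρ ≫ f = f) (V : Z.Opens) :
    Γ(Y, f ⁻¹ᵁ V) →+* Γ(Y, f ⁻¹ᵁ V) :=
  (ρ.appLE (f ⁻¹ᵁ V) (f ⁻¹ᵁ V) (le_preimage_of_comp_eq f h V)).hom

/-- Restriction of functions to preimages of opens. -/
noncomputable def secRes {V V' : Z.Opens} (h : V' ≤ V) : Γ(Y, f ⁻¹ᵁ V) →+* Γ(Y, f ⁻¹ᵁ V') :=
  (Y.presheaf.map (homOfLE (f.preimage_mono h)).op).hom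

theorem secRes_secRes {V V' V'' : Z.Opens} (h : V' ≤ V) (h' : V'' ≤ V') (b : Γ(Y, f ⁻¹ᵁ V)) :
    secRes f h' (secRes f h b) = secRes f (h'.trans h) b := by
  change (Y.presheaf.map _ ≫ Y.presheaf.map _).hom b = _
  rw [← Functor.map_comp]
  rfl

theorem secAct_secRes {ρ : Y ⟶ Y} (h : ρ ≫ f = f) {V V' : Z.Opens} (hV : V' ≤ V)
    (b : Γ(Y, f ⁻¹ᵁ V)) : secAct f h V' (secRes f hV b) = secRes f hV (secAct f h V b) := by
  change (Y.presheaf.map _ ≫ ρ.appLE _ _ _).hom b = (ρ.appLE _ _ _ ≫ Y.presheaf.map _).hom b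
  rw [Scheme.Hom.map_appLE, Scheme.Hom.appLE_map]

theorem secRes_app {V V' : Z.Opens} (hV : V' ≤ V) (a : Γ(Z, V)) :
    secRes f hV ((f.app V).hom a) = (f.app V').hom ((Z.presheaf.map (homOfLE hV).op).hom a) :=
  congr($(f.naturality (homOfLE hV).op) a).symm

theorem secAct_app {ρ : Y ⟶ Y} (h : ρ ≫ f = f) (V : Z.Opens) (a : Γ(Z, V)) :
    secAct f h V ((f.app V).hom a) = (f.app V).hom a := by
  change (f.app V ≫ ρ.appLE _ _ _).hom a = _
  rw [Scheme.Hom.app_eq_appLE, Scheme.Hom.appLE_comp_appLE]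
  simp only [h]

theorem secAct_id (V : Z.Opens) (b : Γ(Y, f ⁻¹ᵁ V)) :
    secAct f (Category.id_comp f) V b = b := by
  rw [secAct]
  simp only [Scheme.Hom.appLE, Scheme.Hom.id_app]
  exact congr($((Y.presheaf.map_id (.op (f ⁻¹ᵁ V)))) b)

/-- Pull-back of functions is contravariant: from `ρ (g * h) = ρ h ≫ ρ g` the operator of `g * h` is
that of `g` followed by that of `h`. -/
theorem secAct_comp {ρ σ τ : Y ⟶ Y} (hρ : ρ ≫ f = f) (hσ : σ ≫ f = f) (hτ : τ ≫ f = f)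
    (e : τ = ρ ≫ σ) (V : Z.Opens) (b : Γ(Y, f ⁻¹ᵁ V)) :
    secAct f hτ V b = secAct f hρ V (secAct f hσ V b) := by
  subst e
  change _ = (σ.appLE _ _ _ ≫ ρ.appLE _ _ _).hom b
  rw [Scheme.Hom.appLE_comp_appLE]
  rfl

theorem sec_ext {V : Z.Opens} {b b' : Γ(Y, f ⁻¹ᵁ V)}
    (h : ∀ z ∈ V, ∃ (V' : Z.Opens) (hV : V' ≤ V), z ∈ V' ∧ secRes f hV b = secRes f hV b') :
    b = b' := by
  apply Y.IsSheaf.section_ext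
  intro y hy
  obtain ⟨V', hV, hz, e⟩ := h (f y) hy
  exact ⟨f ⁻¹ᵁ V', f.preimage_mono hV, hz, e⟩

/-- Functions on the preimages of opens can be glued. -/
theorem exists_glue {σ : Type*} {V : Z.Opens} (W : σ → Z.Opens) (hW : ∀ i, W i ≤ V)
    (hcov : ∀ z ∈ V, ∃ i, z ∈ W i) (s : ∀ i, Γ(Y, f ⁻¹ᵁ W i))
    (hs : ∀ i j, secRes f (inf_le_left : W i ⊓ W j ≤ W i) (s i) =
      secRes f (inf_le_right : W i ⊓ W j ≤ W j) (s j)) :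
    ∃ b : Γ(Y, f ⁻¹ᵁ V), ∀ i, secRes f (hW i) b = s i := by
  obtain ⟨b, hb, -⟩ := Y.sheaf.existsUnique_gluing' (fun i => f ⁻¹ᵁ W i) (f ⁻¹ᵁ V)
    (fun i => homOfLE (f.preimage_mono (hW i))) (fun y hy => by
      obtain ⟨i, hi⟩ := hcov (f y) hy
      exact TopologicalSpace.Opens.mem_iSup.2 ⟨i, hi⟩) s (fun i j => hs i j)
  exact ⟨b, hb⟩

end Sections

section Pushout

open TensorProduct

theorem pushout_exists_sum {A B C P : CommRingCat.{u}} {f : A ⟶ B} {g : A ⟶ C} {i : B ⟶ P}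
    {j : C ⟶ P} (h : IsPushout f g i j) (x : P) :
    ∃ (n : ℕ) (b : Fin n → B) (c : Fin n → C), x = ∑ k, i (b k) * j (c k) := by
  algebraize [f.hom, g.hom]
  have tp := CommRingCat.isPushout_tensorProduct A B C
  let e := tp.isoIsPushout _ _ h
  have e1 : ∀ b : B, e.hom.hom (b ⊗ₜ 1) = i b := fun b =>
    congr($(tp.inl_isoIsPushout_hom _ _ h) b)
  have e2 : ∀ c : C, e.hom.hom (1 ⊗ₜ c) = j c := fun c =>
    congr($(tp.inr_isoIsPushout_hom _ _ h) c)
  obtain ⟨t, rfl⟩ : ∃ t : B ⊗[A] C, e.hom.hom t = x :=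
    ⟨e.inv.hom x, congr($(e.inv_hom_id) x)⟩
  obtain ⟨n, b, c, rfl⟩ := TensorProduct.exists_sum_tmul_eq t
  refine ⟨n, b, c, ?_⟩
  rw [map_sum]
  refine Finset.sum_congr rfl fun k _ => ?_
  rw [← e1, ← e2, ← map_mul, Algebra.TensorProduct.tmul_mul_tmul, _root_.one_mul, _root_.mul_one]

/-- Faithfully flat descent for elements: `A` is the equalizer of the two maps from `B` to `B ⊗[A]
B`, and `P` is this tensor product. -/
theorem pushout_exists_of_eq {A B P : CommRingCat.{u}} {f : A ⟶ B} {i j : B ⟶ P}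
    (h : IsPushout f f i j) (hf : f.hom.FaithfullyFlat) (b : B) (hb : i b = j b) :
    ∃ a, f a = b := by
  algebraize [f.hom]
  have tp := CommRingCat.isPushout_tensorProduct A B B
  let e := tp.isoIsPushout _ _ h
  have e1 : ∀ b : B, e.hom.hom (b ⊗ₜ 1) = i b := fun b =>
    congr($(tp.inl_isoIsPushout_hom _ _ h) b)
  have e2 : ∀ c : B, e.hom.hom (1 ⊗ₜ c) = j c := fun c =>
    congr($(tp.inr_isoIsPushout_hom _ _ h) c)
  have : (b ⊗ₜ 1 : B ⊗[A] B) = 1 ⊗ₜ b := by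
    have h := congr(e.inv.hom $(((e1 b).trans hb).trans (e2 b).symm))
    have h' : ∀ t, e.inv.hom (e.hom.hom t) = t := fun t => congr($(e.hom_inv_id) t)
    rwa [h', h'] at h
  have hx := (Algebra.IsEffective.of_faithfullyFlat A B).eqLocus_includeLeft_includeRight
  have hb' : b ∈ Set.range (algebraMap A B) := hx ▸ this
  exact hb'

end Pushout

section FaithfullyFlat

variable {Y Z : Scheme.{u}} (f : Y ⟶ Z) [Flat f] [Surjective f] [IsAffineHom f]

theorem faithfullyFlat_app {V : Z.Opens} (hV : IsAffineOpen V) :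
    (f.app V).hom.FaithfullyFlat := by
  have hV' : IsAffineOpen (f ⁻¹ᵁ V) := hV.preimage f
  have hflat : (f.app V).hom.Flat := by
    rw [Scheme.Hom.app_eq_appLE]
    exact HasRingHomProperty.appLE (P := @Flat) f inferInstance ⟨V, hV⟩ ⟨_, hV'⟩ le_rfl
  have e := hV.SpecMap_appLE_fromSpec f hV' le_rfl
  rw [← Scheme.Hom.app_eq_appLE] at e
  rw [RingHom.FaithfullyFlat.iff_flat_and_comap_surjective]
  refine ⟨hflat, fun p => ?_⟩
  obtain ⟨y, hy⟩ := f.surjective (hV.fromSpec p)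
  have hyV : y ∈ f ⁻¹ᵁ V := by
    change f y ∈ V
    rw [hy, ← SetLike.mem_coe, ← hV.range_fromSpec]
    exact ⟨p, rfl⟩
  rw [← SetLike.mem_coe, ← hV'.range_fromSpec] at hyV
  obtain ⟨q, rfl⟩ := hyV
  refine ⟨q, hV.fromSpec.isOpenEmbedding.injective ?_⟩
  rw [← hy]
  exact congr_arg (fun φ => φ.base q) e

theorem app_injective (V : Z.Opens) : Function.Injective (f.app V) := by
  intro a a' h
  apply Z.IsSheaf.section_ext
  intro z hz
  obtain ⟨_, ⟨V', hV', rfl⟩, hzV', hV'V : V' ≤ V⟩ :=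
    Z.isBasis_affineOpens.exists_subset_of_mem_open hz V.2
  refine ⟨V', hV'V, hzV', (faithfullyFlat_app f hV').injective ?_⟩
  exact ((secRes_app f hV'V a).symm.trans (congr_arg (secRes f hV'V) h)).trans
    (secRes_app f hV'V a')

end FaithfullyFlat

/-- A morphism `f : Y ⟶ Z` together with an action `ρ` of a finite group on `Y` over `Z` is a Galois
covering if functions descend and if there are Galois coordinates on affine opens. -/
structure IsGaloisCover {G : Type v} [Group G] [Finite G] {Y Z : Scheme.{u}} (f : Y ⟶ Z)
    (ρ : G → (Y ⟶ Y)) : Prop where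
  act_one : ρ 1 = 𝟙 Y
  act_mul : ∀ g h, ρ (g * h) = ρ h ≫ ρ g
  act_comp : ∀ g, ρ g ≫ f = f
  injective : ∀ V, Function.Injective (f.app V)
  invariants : ∀ V (b : Γ(Y, f ⁻¹ᵁ V)), (∀ g, secAct f (act_comp g) V b = b) →
    ∃ a, (f.app V).hom a = b
  coordinates : ∀ V, IsAffineOpen V → ∃ (n : ℕ) (b c : Fin n → Γ(Y, f ⁻¹ᵁ V)), ∀ g : G,
    (g = 1 → ∑ i, secAct f (act_comp g) V (b i) * c i = 1) ∧
    (g ≠ 1 → ∑ i, secAct f (act_comp g) V (b i) * c i = 0)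

/-! ### Torsors under constant groups are Galois coverings. -/

section IncSections

variable {G : Type v} [Finite G] {S : Scheme.{u}} (T : Over S)

theorem eq_of_app_eq_of_isOpenImmersion {U P : Scheme.{u}} (j : U ⟶ P) [IsOpenImmersion j]
    {W W' : P.Opens} (hW : W' ≤ W) (hj : W' ≤ j.opensRange) {x y : Γ(P, W)}
    (h : (j.app W).hom x = (j.app W).hom y) :
    (P.presheaf.map (homOfLE hW).op).hom x = (P.presheaf.map (homOfLE hW).op).hom y := by
  have := j.isIso_app W' hj
  have hinj : Function.Injective (j.app W').hom :=
    (ConcreteCategory.bijective_of_isIso (j.app W')).1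
  apply hinj
  have e (z : Γ(P, W)) : (j.app W').hom ((P.presheaf.map (homOfLE hW).op).hom z) =
      (U.presheaf.map (homOfLE (j.preimage_mono hW)).op).hom ((j.app W).hom z) :=
    congr($(j.naturality (homOfLE hW).op) z)
  rw [e, e, h]

theorem inc_app_ext {W : (constScheme G S ⊗ T).left.Opens} {x y : Γ((constScheme G S ⊗ T).left, W)}
    (h : ∀ g, ((inc T g).left.app W).hom x = ((inc T g).left.app W).hom y) : x = y := by
  apply (constScheme G S ⊗ T).left.IsSheaf.section_ext
  intro p hp
  obtain ⟨g, t, rfl⟩ := exists_inc_eq T p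
  exact ⟨W ⊓ (inc T g).left.opensRange, inf_le_left, ⟨hp, t, rfl⟩,
    eq_of_app_eq_of_isOpenImmersion _ inf_le_left inf_le_right (h g)⟩

/-- The copies of `T` are open and disjoint, so constants prescribed on each of them glue. The case
used is the indicator function of the copy of index `1`. -/
theorem exists_inc_app_eq (W : (constScheme G S ⊗ T).left.Opens) (c : G → ℤ) :
    ∃ x : Γ((constScheme G S ⊗ T).left, W), ∀ g, ((inc T g).left.app W).hom x = c g := by
  obtain ⟨x, hx, -⟩ := (constScheme G S ⊗ T).left.sheaf.existsUnique_gluing'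
    (fun g => W ⊓ (inc T g).left.opensRange) W (fun g => homOfLE inf_le_left)
    (fun p hp => by
      obtain ⟨g, t, rfl⟩ := exists_inc_eq T p
      exact TopologicalSpace.Opens.mem_iSup.2 ⟨g, hp, t, rfl⟩)
    (fun g => ((c g : ℤ) : Γ((constScheme G S ⊗ T).left, W ⊓ (inc T g).left.opensRange)))
    (fun g h => by
      by_cases hgh : g = h
      · subst hgh; rfl
      · apply (constScheme G S ⊗ T).left.IsSheaf.section_ext
        rintro p ⟨⟨-, t, ht⟩, ⟨-, t', ht'⟩⟩
        exact absurd (inc_inj T (ht.trans ht'.symm)) hgh)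
  refine ⟨x, fun g => ?_⟩
  apply T.left.IsSheaf.section_ext
  intro t ht
  refine ⟨(inc T g).left ⁻¹ᵁ (W ⊓ (inc T g).left.opensRange),
    (inc T g).left.preimage_mono inf_le_left, ⟨ht, t, rfl⟩, ?_⟩
  have e := congr($((inc T g).left.naturality
    (homOfLE (inf_le_left : W ⊓ (inc T g).left.opensRange ≤ W)).op) x)
  have e' : ((constScheme G S ⊗ T).left.presheaf.map (homOfLE (inf_le_left :
    W ⊓ (inc T g).left.opensRange ≤ W)).op).hom x = c g := hx g
  refine e.symm.trans ((congr_arg ((inc T g).left.app _).hom e').trans ?_)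
  rw [map_intCast]
  exact (map_intCast (T.left.presheaf.map _).hom _).symm

end IncSections

section GaloisSquare

variable {G : Type v} [Group G] [Finite G] {P Y X : Scheme.{u}} {a s : P ⟶ Y} {f : Y ⟶ X}
  (hp : IsPullback a s f f) (i : G → (Y ⟶ P))

include hp

theorem preimage_le_of_isPullback (V : X.Opens) : s ⁻¹ᵁ (f ⁻¹ᵁ V) ≤ a ⁻¹ᵁ (f ⁻¹ᵁ V) := by
  rw [← Scheme.Hom.comp_preimage, ← Scheme.Hom.comp_preimage, hp.w]

theorem isPushout_of_isPullback [IsAffineHom f] {V : X.Opens} (hV : IsAffineOpen V) :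
    IsPushout (f.app V) (f.app V)
      (a.appLE (f ⁻¹ᵁ V) (s ⁻¹ᵁ (f ⁻¹ᵁ V)) (preimage_le_of_isPullback hp V))
      (s.app (f ⁻¹ᵁ V)) := by
  have h := (isIso_pushoutSection_iff hp (le_refl (f ⁻¹ᵁ V)) le_rfl
    (UY := s ⁻¹ᵁ (f ⁻¹ᵁ V)) (inf_eq_right.2 (preimage_le_of_isPullback hp V)).symm).1
    (isIso_pushoutSection_of_isAffineOpen hp le_rfl le_rfl _ hV (hV.preimage f) (hV.preimage f))
  rwa [← Scheme.Hom.app_eq_appLE, ← Scheme.Hom.app_eq_appLE] at h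

end GaloisSquare

section GaloisSquare

variable {G : Type v} [Group G] [Finite G] {P Y X : Scheme.{u}} {a s : P ⟶ Y} {f : Y ⟶ X}

theorem appLE_section {i : Y ⟶ P} {ρ : Y ⟶ Y} (ha : i ≫ a = ρ)
    (hρ : ρ ≫ f = f) {V : X.Opens} (h1 : s ⁻¹ᵁ (f ⁻¹ᵁ V) ≤ a ⁻¹ᵁ (f ⁻¹ᵁ V))
    (h : f ⁻¹ᵁ V ≤ i ⁻¹ᵁ (s ⁻¹ᵁ (f ⁻¹ᵁ V))) (b : Γ(Y, f ⁻¹ᵁ V)) :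
    (i.appLE _ _ h).hom ((a.appLE _ _ h1).hom b) = secAct f hρ V b := by
  subst ha
  rw [← CommRingCat.comp_apply, Scheme.Hom.appLE_comp_appLE]
  rfl

theorem appLE_section_app {i : Y ⟶ P} (hi : i ≫ s = 𝟙 Y) {V : X.Opens}
    (h : f ⁻¹ᵁ V ≤ i ⁻¹ᵁ (s ⁻¹ᵁ (f ⁻¹ᵁ V))) (b : Γ(Y, f ⁻¹ᵁ V)) :
    (i.appLE _ _ h).hom ((s.app _).hom b) = b := by
  rw [← CommRingCat.comp_apply, Scheme.Hom.app_eq_appLE, Scheme.Hom.appLE_comp_appLE]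
  simp only [hi]
  exact secAct_id f V b

theorem le_section_preimage {i : Y ⟶ P} (hi : i ≫ s = 𝟙 Y) (V : X.Opens) :
    f ⁻¹ᵁ V ≤ i ⁻¹ᵁ (s ⁻¹ᵁ (f ⁻¹ᵁ V)) := by
  rw [← Scheme.Hom.comp_preimage i s, hi, Scheme.Hom.id_preimage]

/-- A torsor under a constant group is a Galois covering. -/
theorem isGaloisCover_of_isPullback [Flat f] [Surjective f] [IsAffineHom f]
    (hp : IsPullback a s f f) (ρ : G → (Y ⟶ Y)) (h1 : ρ 1 = 𝟙 Y)
    (hmul : ∀ g h, ρ (g * h) = ρ h ≫ ρ g) (hρ : ∀ g, ρ g ≫ f = f)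
    (i : G → (Y ⟶ P)) (hs : ∀ g, i g ≫ s = 𝟙 Y) (ha : ∀ g, i g ≫ a = ρ g)
    (hext : ∀ (W : P.Opens) (x y : Γ(P, W)),
      (∀ g, ((i g).app W).hom x = ((i g).app W).hom y) → x = y)
    (hex : ∀ (W : P.Opens) (c : G → ℤ), ∃ x : Γ(P, W), ∀ g, ((i g).app W).hom x = c g) :
    IsGaloisCover f ρ where
  act_one := h1
  act_mul := hmul
  act_comp := hρ
  injective := app_injective _
  invariants V b hb := by
    have key : ∀ W : X.affineOpens, ∀ h : W.1 ≤ V, ∃ a,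
        (f.app W).hom a = secRes f h b := fun W h => by
      -- The pull-backs of an invariant function along `a` and `s` agree on every copy of `Y` in
      -- `P`, hence on `P`, so the function descends.
      refine pushout_exists_of_eq (isPushout_of_isPullback hp W.2) (faithfullyFlat_app _ W.2) _ ?_
      refine hext _ _ _ fun g => ?_
      have hle := le_section_preimage (f := f) (hs g) W.1
      have hinj : Function.Injective (Y.presheaf.map (homOfLE hle).op).hom := by
        have : (f ⁻¹ᵁ W.1) = (i g) ⁻¹ᵁ (s ⁻¹ᵁ (f ⁻¹ᵁ W.1)) := by
          rw [← Scheme.Hom.comp_preimage (i g) s, hs, Scheme.Hom.id_preimage]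
        have : IsIso (homOfLE hle) := ⟨homOfLE this.ge, rfl, rfl⟩
        exact (ConcreteCategory.bijective_of_isIso (Y.presheaf.map (homOfLE hle).op)).1
      apply hinj
      refine (appLE_section (ha g) (hρ g) (preimage_le_of_isPullback hp W.1) hle
        (secRes f h b)).trans (Eq.trans ?_ (appLE_section_app (hs g) hle (secRes f h b)).symm)
      rw [secAct_secRes, hb]
    choose a ha using key
    obtain ⟨c, hc⟩ := X.sheaf.existsUnique_gluing'
      (fun W : {W : X.affineOpens // W.1 ≤ V} => W.1.1) V (fun W => homOfLE W.2)
      (fun z hz => by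
        obtain ⟨_, ⟨V', hV', rfl⟩, hzV', hV'V : V' ≤ V⟩ :=
          X.isBasis_affineOpens.exists_subset_of_mem_open hz V.2
        exact TopologicalSpace.Opens.mem_iSup.2 ⟨⟨⟨V', hV'⟩, hV'V⟩, hzV'⟩) (fun W => a W.1 W.2)
      (fun W W' => by
        apply app_injective f
        refine (secRes_app f inf_le_left _).symm.trans
          (Eq.trans ?_ (secRes_app f inf_le_right _))
        rw [ha, ha, secRes_secRes, secRes_secRes])
    refine ⟨c, sec_ext f fun z hz => ?_⟩
    obtain ⟨_, ⟨V', hV', rfl⟩, hzV', hV'V : V' ≤ V⟩ :=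
      X.isBasis_affineOpens.exists_subset_of_mem_open hz V.2
    refine ⟨V', hV'V, hzV', ?_⟩
    rw [← ha ⟨V', hV'⟩ hV'V]
    exact (secRes_app f hV'V c).trans (congr_arg _ (hc.1 ⟨⟨V', hV'⟩, hV'V⟩))
  coordinates V hV := by
    classical
    -- The idempotent of the diagonal. Written as `∑ b k ⊗ c k`, it restricts on the copy of index
    -- `g` to the sum of the products of the `g`-translate of `b k` with `c k`.
    obtain ⟨x, hx⟩ := hex (s ⁻¹ᵁ (f ⁻¹ᵁ V)) (fun g : G => if g = 1 then 1 else 0)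
    obtain ⟨n, b, c, rfl⟩ := pushout_exists_sum (isPushout_of_isPullback hp hV) x
    have key : ∀ g : G, ∑ k, secAct f (hρ g) V (b k) * c k =
        ((if g = 1 then 1 else 0 : ℤ) : Γ(Y, f ⁻¹ᵁ V)) := fun g => by
      have hle := le_section_preimage (f := f) (hs g) V
      have e := congr_arg (Y.presheaf.map (homOfLE hle).op).hom (hx g)
      rw [map_intCast] at e
      rw [← e]
      refine Eq.trans ?_ (map_sum ((i g).appLE _ _ hle).hom _ _).symm
      refine Finset.sum_congr rfl fun k _ => ?_
      refine Eq.trans ?_ (map_mul ((i g).appLE _ _ hle).hom _ _).symm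
      exact congr_arg₂ _
        (appLE_section (ha g) (hρ g) (preimage_le_of_isPullback hp V) hle _).symm
        (appLE_section_app (hs g) hle _).symm
    exact ⟨n, b, c, fun g => ⟨fun h => by rw [key, if_pos h, Int.cast_one],
      fun h => by rw [key, if_neg h, Int.cast_zero]⟩⟩

end GaloisSquare

theorem IsTorsor.isGaloisCover {G : Type v} [Group G] [Finite G] {R : CommRingCat.{u}}
    {X Y : Over (Spec R)} [ModObj (constScheme G (Spec R)) Y] {π : Y ⟶ X}
    (hπ : IsTorsor (constScheme G (Spec R)) π) [QuasiCompact π.left] :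
    IsGaloisCover π.left fun g : G => (act Y g).left :=
  have := hπ.isFinite
  have := hπ.flat
  have := hπ.surjective
  isGaloisCover_of_isPullback hπ.isPullback_left _ (by rw [act_one]; rfl)
    (fun g h => by rw [act_mul]; rfl) (fun g => congr_arg CommaMorphism.left (hπ.act_comp g))
    (fun g => (inc Y g).left) (fun g => congr_arg CommaMorphism.left (inc_snd Y g))
    (fun g => rfl) (fun W x y h => inc_app_ext Y h) (fun W c => exists_inc_app_eq Y W c)

end TorsorExtension

namespace TorsorExtension

/-! ### Scalars from the base ring, and local existence of invertible eigenfunctions. -/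

section Scalars

variable {R : CommRingCat.{u}} {Y Z : Scheme.{u}} (h : Y ⟶ Spec R)

theorem le_preimage_top (W : Y.Opens) : W ≤ h ⁻¹ᵁ ⊤ := fun _ _ => trivial

/-- The map from the base ring to the functions on an open of a scheme over it. -/
noncomputable def scal (W : Y.Opens) : R →+* Γ(Y, W) :=
  (h.appLE ⊤ W (le_preimage_top h W)).hom.comp (Scheme.ΓSpecIso R).inv.hom

theorem res_scal {W W' : Y.Opens} (hW : W' ≤ W) (r : R) :
    (Y.presheaf.map (homOfLE hW).op).hom (scal h W r) = scal h W' r := by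
  simp only [scal, RingHom.comp_apply]
  change (h.appLE _ _ _ ≫ Y.presheaf.map _).hom _ = _
  rw [Scheme.Hom.appLE_map]

theorem appLE_scal {X : Scheme.{u}} (ρ : X ⟶ Y) {h' : X ⟶ Spec R} (hρ : ρ ≫ h = h')
    {W : X.Opens} {V : Y.Opens} (hW : W ≤ ρ ⁻¹ᵁ V) (r : R) :
    (ρ.appLE V W hW).hom (scal h V r) = scal h' W r := by
  subst hρ
  simp only [scal, RingHom.comp_apply]
  change (h.appLE _ _ _ ≫ ρ.appLE _ _ _).hom _ = _
  rw [Scheme.Hom.appLE_comp_appLE]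

theorem app_scal {X : Scheme.{u}} (ρ : X ⟶ Y) (V : Y.Opens) (r : R) :
    (ρ.app V).hom (scal h V r) = scal (ρ ≫ h) (ρ ⁻¹ᵁ V) r := by
  rw [Scheme.Hom.app_eq_appLE]
  exact appLE_scal h ρ rfl le_rfl r

variable (f : Y ⟶ Z)

theorem secAct_scal {ρ : Y ⟶ Y} (hρ : ρ ≫ f = f) (hρ' : ρ ≫ h = h) (V : Z.Opens) (r : R) :
    secAct f hρ V (scal h (f ⁻¹ᵁ V) r) = scal h (f ⁻¹ᵁ V) r :=
  appLE_scal h ρ hρ' _ r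

theorem secRes_scal {V V' : Z.Opens} (hV : V' ≤ V) (r : R) :
    secRes f hV (scal h (f ⁻¹ᵁ V) r) = scal h (f ⁻¹ᵁ V') r :=
  res_scal h _ r

end Scalars

section Eigen

variable {G : Type v} [CommGroup G] {R : CommRingCat.{u}} {Y Z : Scheme.{u}}
  (f : Y ⟶ Z) (h : Y ⟶ Spec R) {ρ : G → (Y ⟶ Y)} (hρ : ∀ g, ρ g ≫ f = f)

/-- A function on the preimage of an open is an eigenfunction for the character `χ` of the group. -/
def IsEigen (χ : G →* Rˣ) (V : Z.Opens) (b : Γ(Y, f ⁻¹ᵁ V)) : Prop :=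
  ∀ g, secAct f (hρ g) V b = scal h (f ⁻¹ᵁ V) (χ g) * b

variable {f h hρ}

theorem IsEigen.secRes {χ : G →* Rˣ} {V V' : Z.Opens} {b : Γ(Y, f ⁻¹ᵁ V)}
    (hb : IsEigen f h hρ χ V b) (hV : V' ≤ V) : IsEigen f h hρ χ V' (secRes f hV b) := fun g => by
  rw [secAct_secRes, hb g, map_mul, secRes_scal]

theorem IsEigen.mul {χ ψ : G →* Rˣ} {V : Z.Opens} {b c : Γ(Y, f ⁻¹ᵁ V)}
    (hb : IsEigen f h hρ χ V b) (hc : IsEigen f h hρ ψ V c) :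
    IsEigen f h hρ (χ * ψ) V (b * c) := fun g => by
  rw [map_mul, hb g, hc g, MonoidHom.mul_apply, Units.val_mul, map_mul, mul_mul_mul_comm]

theorem IsEigen.secAct_eq {V : Z.Opens} {b : Γ(Y, f ⁻¹ᵁ V)}
    (hb : IsEigen f h hρ 1 V b) (g : G) : secAct f (hρ g) V b = b := by
  rw [hb g, MonoidHom.one_apply, Units.val_one, map_one, one_mul]

theorem IsEigen.inv {χ : G →* Rˣ} {V : Z.Opens} {b : Γ(Y, f ⁻¹ᵁ V)ˣ}
    (hb : IsEigen f h hρ χ V b) : IsEigen f h hρ χ⁻¹ V (b⁻¹ : Γ(Y, f ⁻¹ᵁ V)ˣ) := fun g => by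
  have e : secAct f (hρ g) V (b⁻¹ : Γ(Y, f ⁻¹ᵁ V)ˣ) * secAct f (hρ g) V b = 1 := by
    rw [← map_mul, Units.inv_mul, map_one]
  rw [hb g] at e
  have e' : scal h (f ⁻¹ᵁ V) (χ⁻¹ g : Rˣ) * scal h (f ⁻¹ᵁ V) (χ g) = 1 := by
    rw [← map_mul, MonoidHom.inv_apply, Units.inv_mul, map_one]
  calc _ = secAct f (hρ g) V (b⁻¹ : Γ(Y, f ⁻¹ᵁ V)ˣ) * (scal h (f ⁻¹ᵁ V) (χ g) * b) *
        (scal h (f ⁻¹ᵁ V) (χ⁻¹ g : Rˣ) * (b⁻¹ : Γ(Y, f ⁻¹ᵁ V)ˣ)) := by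
          rw [mul_assoc, mul_mul_mul_comm, mul_comm (scal h _ _) (scal h _ _), e',
            Units.mul_inv, mul_one, mul_one]
    _ = _ := by rw [e, one_mul]

theorem IsEigen.pow {χ : G →* Rˣ} {V : Z.Opens} {b : Γ(Y, f ⁻¹ᵁ V)}
    (hb : IsEigen f h hρ χ V b) (n : ℕ) : IsEigen f h hρ (χ ^ n) V (b ^ n) := fun g => by
  rw [map_pow, hb g, mul_pow, MonoidHom.pow_apply, Units.val_pow_eq_pow_val, map_pow]

variable [Finite G]

/-- Invertible eigenfunctions exist locally. -/
theorem IsGaloisCover.exists_isEigen (hG : IsGaloisCover f ρ) (k : Z ⟶ Spec R) (hk : f ≫ k = h)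
    (hm : IsUnit (Nat.card G : R)) (χ : G →* Rˣ) (z : Z) :
    ∃ V : Z.Opens, z ∈ V ∧ ∃ s : Γ(Y, f ⁻¹ᵁ V)ˣ, IsEigen f h hG.act_comp χ V s := by
  classical
  have := Fintype.ofFinite G
  have hh : ∀ g, ρ g ≫ h = h := fun g => by rw [← hk, ← Category.assoc, hG.act_comp]
  obtain ⟨_, ⟨V, hV, rfl⟩, hz, -⟩ :=
    Z.isBasis_affineOpens.exists_subset_of_mem_open (Set.mem_univ z) isOpen_univ
  obtain ⟨n, b, c, hbc⟩ := hG.coordinates V hV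
  set A := fun g => secAct f (hG.act_comp g) V with hA
  set κ := scal h (f ⁻¹ᵁ V) with hκ
  have hAκ : ∀ g r, A g (κ r) = κ r := fun g r => secAct_scal h f _ (hh g) V r
  have hAmul : ∀ g k x, A (g * k) x = A k (A g x) := fun g k x =>
    secAct_comp f _ _ _ (hG.act_mul g k) V x
  -- Up to the factor `|G|`, this sum is the projector onto the `ψ`-eigenspace.
  have hproj : ∀ (ψ : G →* Rˣ) (x : Γ(Y, f ⁻¹ᵁ V)),
      IsEigen f h hG.act_comp ψ V (∑ g, κ (ψ g⁻¹ : Rˣ) * A g x) := fun ψ x k => by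
    change A k _ = κ _ * _
    rw [map_sum, Finset.mul_sum]
    refine Fintype.sum_equiv (Equiv.mulRight k) _ _ fun g => ?_
    rw [map_mul, hAκ, ← hAmul, ← mul_assoc, ← map_mul, ← Units.val_mul, ← map_mul,
      Equiv.coe_mulRight, mul_inv, mul_comm g⁻¹, mul_inv_cancel_left]
  set s := fun i => ∑ g, κ (χ g⁻¹ : Rˣ) * A g (b i) with hs
  set t := fun i => ∑ g, κ (χ⁻¹ g⁻¹ : Rˣ) * A g (c i) with ht
  -- In the expanded double sum the Galois coordinates kill all terms with `g ≠ k`, and the others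
  -- contribute `χ g⁻¹ * χ g = 1` each.
  have hst : ∑ i, s i * t i = (Nat.card G : Γ(Y, f ⁻¹ᵁ V)) := by
    have key : ∀ g k, ∑ i, A g (b i) * A k (c i) = if g = k then 1 else 0 := fun g k => by
      have e : ∑ i, A g (b i) * A k (c i) = A k (∑ i, A (g * k⁻¹) (b i) * c i) := by
        rw [map_sum]
        refine Finset.sum_congr rfl fun i _ => ?_
        rw [map_mul, ← hAmul, inv_mul_cancel_right]
      rw [e]
      split_ifs with hgk
      · rw [(hbc _).1 (by rw [hgk, mul_inv_cancel]), map_one]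
      · rw [(hbc _).2 (by rwa [Ne, mul_inv_eq_one]), map_zero]
    calc ∑ i, s i * t i = ∑ g, ∑ k, κ (χ g⁻¹ : Rˣ) * κ (χ⁻¹ k⁻¹ : Rˣ) *
          ∑ i, A g (b i) * A k (c i) := by
          rw [Finset.sum_congr rfl fun i _ => Finset.sum_mul_sum _ _ _ _, Finset.sum_comm]
          refine Finset.sum_congr rfl fun g _ => ?_
          rw [Finset.sum_comm]
          refine Finset.sum_congr rfl fun k _ => ?_
          rw [Finset.mul_sum]
          exact Finset.sum_congr rfl fun i _ => mul_mul_mul_comm _ _ _ _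
      _ = ∑ g : G, 1 := by
          refine Finset.sum_congr rfl fun g _ => ?_
          simp only [key, mul_ite, mul_one, mul_zero, Finset.sum_ite_eq, Finset.mem_univ, if_true]
          rw [← map_mul, ← Units.val_mul, MonoidHom.inv_apply, mul_inv_cancel, Units.val_one,
            map_one]
      _ = _ := by simp
  have hinv : ∀ i, ∃ a, (f.app V).hom a = s i * t i := fun i => by
    refine hG.invariants V _ fun g => ?_
    refine IsEigen.secAct_eq (?_ : IsEigen f h hG.act_comp 1 V _) g
    convert (hproj χ (b i)).mul (hproj χ⁻¹ (c i))
    exact (mul_inv_cancel χ).symm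
  choose a ha using hinv
  have hsum : ∑ i, a i = (Nat.card G : Γ(Z, V)) := by
    apply hG.injective V
    rw [map_natCast]
    refine (map_sum (f.app V).hom _ _).trans ?_
    rw [← hst]
    exact Finset.sum_congr rfl fun i _ => ha i
  -- The sum of the `a i` is the unit `|G|`, so some `a i` is a unit in the local ring at `z`; where
  -- it is invertible, so is its factor `s i`.
  obtain ⟨i, hi⟩ : ∃ i, z ∈ Z.basicOpen (a i) := by
    have hu : IsUnit (Z.presheaf.germ V z hz (∑ i, a i)) := by
      rw [hsum, ← map_natCast (scal k V)]
      exact (hm.map _).map _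
    rw [map_sum] at hu
    obtain ⟨i, -, hi⟩ := IsLocalRing.exists_of_isUnit_sum hu
    exact ⟨i, (Z.mem_basicOpen _ _ hz).2 hi⟩
  have hle := Z.basicOpen_le (a i)
  refine ⟨Z.basicOpen (a i), hi, ?_⟩
  have hu : IsUnit (secRes f hle (s i)) := by
    refine isUnit_of_mul_isUnit_left (y := secRes f hle (t i)) ?_
    rw [← map_mul, ← ha, secRes_app]
    exact (RingedSpace.isUnit_res_basicOpen _ _).map _
  exact ⟨hu.unit, (hproj χ (b i)).secRes hle⟩

end Eigen

/-! ### Powers of line bundles, and gluing and descent of invertible functions. -/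

namespace LineBundle

variable {Z : Scheme.{u}}

/-- The powers of a line bundle. -/
def npow (L : LineBundle Z) (n : ℕ) : LineBundle Z where
  U := L.U
  mem := L.mem
  g x y := L.g x y ^ n
  cocycle x y z := by simp only [map_pow, ← mul_pow, L.cocycle]

/-- The class of a line bundle. -/
def toPic (L : LineBundle Z) : Pic Z := Quotient.mk _ L

theorem toPic_npow (L : LineBundle Z) (n : ℕ) : (L.npow n).toPic = L.toPic ^ n := by
  induction n with
  | zero =>
    rw [pow_zero]
    refine Quotient.sound (equiv_of_eq L.U L.mem (fun x => le_rfl) (fun x => le_top) fun x y => ?_)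
    rw [res_trivial]
    exact (map_pow (resUnits Z _) (L.g x y) 0).trans (pow_zero _)
  | succ n ih =>
    rw [pow_succ, ← ih]
    refine Quotient.sound (equiv_of_eq L.U L.mem (fun x => le_rfl) (fun x => le_inf le_rfl le_rfl)
      fun x y => ?_)
    rw [res_tensor]
    exact (map_pow (resUnits Z _) (L.g x y) (n + 1)).trans ((pow_succ _ _).trans
      (congrArg (· * _) (map_pow (resUnits Z _) (L.g x y) n).symm))

end LineBundle

section Units

variable {Y Z : Scheme.{u}} (f : Y ⟶ Z)

/-- Invertible functions on the preimages of opens can be glued. -/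
theorem exists_glue_units {σ : Type*} {V : Z.Opens} (W : σ → Z.Opens) (hW : ∀ i, W i ≤ V)
    (hcov : ∀ z ∈ V, ∃ i, z ∈ W i) (s : ∀ i, Γ(Y, f ⁻¹ᵁ W i)ˣ)
    (hs : ∀ i j, resUnits Y (f.preimage_mono (inf_le_left : W i ⊓ W j ≤ W i)) (s i) =
      resUnits Y (f.preimage_mono (inf_le_right : W i ⊓ W j ≤ W j)) (s j)) :
    ∃ b : Γ(Y, f ⁻¹ᵁ V)ˣ, ∀ i, resUnits Y (f.preimage_mono (hW i)) b = s i := by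
  obtain ⟨b, hb⟩ := exists_glue f W hW hcov (fun i => (s i : Γ(Y, f ⁻¹ᵁ W i)))
    fun i j => congrArg Units.val (hs i j)
  obtain ⟨c, hc⟩ := exists_glue f W hW hcov (fun i => ((s i)⁻¹ : Γ(Y, f ⁻¹ᵁ W i)ˣ))
    fun i j => by
      have := congrArg (·⁻¹) (hs i j)
      simp only [← map_inv] at this
      exact congrArg Units.val this
  have hbc : b * c = 1 := sec_ext f fun z hz => by
    obtain ⟨i, hi⟩ := hcov z hz
    refine ⟨W i, hW i, hi, ?_⟩
    rw [map_mul, hb, hc, Units.mul_inv, map_one]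
  refine ⟨⟨b, c, hbc, (mul_comm _ _).trans hbc⟩, fun i => Units.ext (hb i)⟩

theorem appUnits_resUnits {V V' : Z.Opens} (hV : V' ≤ V) (c : Γ(Z, V)ˣ) :
    appUnits f V' (resUnits Z hV c) = resUnits Y (f.preimage_mono hV) (appUnits f V c) :=
  (resUnits_appUnits f hV _ c).symm

variable {G : Type v} [Group G] [Finite G] {ρ : G → (Y ⟶ Y)}
variable {f}

theorem IsGaloisCover.appUnits_injective (hG : IsGaloisCover f ρ) (V : Z.Opens) :
    Function.Injective (appUnits f V) :=
  Units.map_injective (hG.injective V)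

theorem IsGaloisCover.exists_appUnits (hG : IsGaloisCover f ρ) {V : Z.Opens}
    (b : Γ(Y, f ⁻¹ᵁ V)ˣ) (hb : ∀ g, secAct f (hG.act_comp g) V b = b) :
    ∃ a, appUnits f V a = b := by
  obtain ⟨a, ha⟩ := hG.invariants V b hb
  obtain ⟨c, hc⟩ := hG.invariants V (b⁻¹ : Γ(Y, f ⁻¹ᵁ V)ˣ) fun g => by
    have := map_inv (Units.map (secAct f (hG.act_comp g) V).toMonoidHom) b
    rw [show Units.map (secAct f (hG.act_comp g) V).toMonoidHom b = b from Units.ext (hb g)] at this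
    exact congrArg Units.val this
  have hac : a * c = 1 := hG.injective V <| by
    refine (map_mul (f.app V).hom a c).trans ?_
    rw [ha, hc, Units.mul_inv]
    exact (map_one (f.app V).hom).symm
  exact ⟨⟨a, c, hac, (mul_comm _ _).trans hac⟩, Units.ext ha⟩

end Units

/-! ### Extending eigenfunctions through torsion line bundles. -/

section Extension

variable {G : Type v} [CommGroup G] {R : CommRingCat.{u}} {Y Z X : Scheme.{u}}
  {f : Y ⟶ Z} {h : Y ⟶ Spec R} {ρ : G → (Y ⟶ Y)}

theorem IsEigen.congr {hρ : ∀ g, ρ g ≫ f = f} {χ ψ : G →* Rˣ} {V : Z.Opens}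
    {b : Γ(Y, f ⁻¹ᵁ V)} (hb : IsEigen f h hρ χ V b) (e : ∀ g, χ g = ψ g) :
    IsEigen f h hρ ψ V b := fun g => by rw [hb g, e]

theorem isEigen_appUnits (hρ : ∀ g, ρ g ≫ f = f) {V : Z.Opens} (a : Γ(Z, V)ˣ) :
    IsEigen f h hρ 1 V (appUnits f V a) := fun g => by
  rw [MonoidHom.one_apply, Units.val_one, map_one, one_mul]
  exact secAct_app f (hρ g) V a

variable [Finite G]

/-- If all torsion line bundles on `Z` extend to `X`, then invertible eigenfunctions exist locally
on `X`. -/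
theorem IsGaloisCover.exists_isEigen_preimage (hG : IsGaloisCover f ρ) (k : Z ⟶ Spec R)
    (hk : f ≫ k = h) (hm : IsUnit (Nat.card G : R)) (ι : Z ⟶ X)
    (hPic : Set.SurjOn (Pic.pullback ι) (Pic.torsion (Nat.card G) X)
      (Pic.torsion (Nat.card G) Z)) (χ : G →* Rˣ) (x : X) :
    ∃ U : X.Opens, x ∈ U ∧ ∃ s : Γ(Y, f ⁻¹ᵁ (ι ⁻¹ᵁ U))ˣ,
      IsEigen f h hG.act_comp χ (ι ⁻¹ᵁ U) s := by
  choose V hV s hs using fun z => hG.exists_isEigen k hk hm χ z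
  have hχ : χ ^ Nat.card G = 1 := by
    ext g
    rw [MonoidHom.pow_apply, ← map_pow, pow_card_eq_one', map_one]
    rfl
  -- Quotients of eigenfunctions for the same character are invariant, so they come from `Z` and
  -- form the cocycle of a line bundle `L`.
  have hquot : ∀ z w, ∃ a, appUnits f (V z ⊓ V w) a =
      resUnits Y (f.preimage_mono inf_le_left) (s z) *
        (resUnits Y (f.preimage_mono inf_le_right) (s w))⁻¹ := fun z w => by
    refine hG.exists_appUnits _ (IsEigen.secAct_eq (h := h) ?_)
    have h1 := ((hs z).secRes (inf_le_left : V z ⊓ V w ≤ V z))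
    have h2 : IsEigen f h hG.act_comp χ (V z ⊓ V w)
      (resUnits Y (f.preimage_mono inf_le_right) (s w) : Γ(Y, f ⁻¹ᵁ (V z ⊓ V w))ˣ) :=
      (hs w).secRes (inf_le_right : V z ⊓ V w ≤ V w)
    exact (h1.mul h2.inv).congr fun g => mul_inv_cancel (χ g)
  choose a ha using hquot
  -- The powers `s z ^ |G|` are invariant as well; they trivialize the `|G|`-th power of `L`.
  have hpow : ∀ z, ∃ b, appUnits f (V z) b = s z ^ Nat.card G := fun z => by
    refine hG.exists_appUnits _ (IsEigen.secAct_eq (h := h) ?_)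
    exact ((hs z).pow (Nat.card G)).congr fun g => DFunLike.congr_fun hχ g
  choose b hb using hpow
  have hres {V V' : Z.Opens} (hV : V' ≤ V) := appUnits_resUnits f hV
  let L : LineBundle Z :=
    { U := V
      mem := hV
      g := a
      cocycle := fun z₁ z₂ z₃ => by
        apply hG.appUnits_injective
        simp only [map_mul, hres, ha, map_inv, resUnits_res]
        rw [mul_assoc, inv_mul_cancel_left] }
  have hL : L.toPic ∈ Pic.torsion (Nat.card G) Z := by
    refine (LineBundle.toPic_npow L _).symm.trans (Quotient.sound
      ⟨V, hV, fun z => le_rfl, fun z => le_top, b, fun z w => ?_⟩)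
    rw [LineBundle.res_trivial, mul_one]
    change resUnits Z (le_refl (V z ⊓ V w)) (a z w ^ Nat.card G) * resUnits Z inf_le_right (b w) =
      resUnits Z inf_le_left (b z)
    apply hG.appUnits_injective
    rw [map_mul, hres, hres, hres, hb, hb, map_pow, ha, map_pow, map_pow, map_pow, map_mul,
      map_inv, resUnits_res, resUnits_res, mul_pow, inv_pow, inv_mul_cancel_right]
  obtain ⟨M', -, hM'⟩ := hPic hL
  obtain ⟨M, rfl⟩ := Quotient.exists_rep M'
  obtain ⟨W, hW, hWM, hWL, c, hc⟩ : (M.pullback ι).Equiv L := Quotient.exact hM'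
  have hWι : ∀ z, W z ≤ ι ⁻¹ᵁ M.U (ι z) := hWM
  have hWV : ∀ z, W z ≤ V z := hWL
  have hW2 : ∀ z w, W z ⊓ W w ≤ ι ⁻¹ᵁ (M.U (ι z) ⊓ M.U (ι w)) := fun z w =>
    le_inf (inf_le_left.trans (hWι z)) (inf_le_right.trans (hWι w))
  have hcM : ∀ z w, resUnits Z (hW2 z w) (appUnits ι _ (M.g (ι z) (ι w))) * resUnits Z inf_le_right (c w) =
      resUnits Z inf_le_left (c z) * resUnits Z (inf_le_inf (hWV z) (hWV w)) (a z w) := hc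
  -- On `U` the transition functions `M.g x` trivialize `M`. Combined with the isomorphism `c` from
  -- the pull-back of `M` to `L`, they trivialize `L` on `ι ⁻¹ᵁ U` by the functions `d z`, and the
  -- corrected eigenfunctions `d z * s z` glue.
  let U := M.U x
  let N : Z → Z.Opens := fun z => W z ⊓ ι ⁻¹ᵁ U
  have hN : ∀ z, N z ≤ ι ⁻¹ᵁ (M.U x ⊓ M.U (ι z)) := fun z =>
    le_inf inf_le_right (inf_le_left.trans (hWι z))
  let d : ∀ z, Γ(Z, N z)ˣ := fun z => resUnits Z (hN z) (appUnits ι _ (M.g x (ι z))) *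
    resUnits Z inf_le_left (c z)
  let e : ∀ z, Γ(Y, f ⁻¹ᵁ N z)ˣ := fun z => appUnits f (N z) (d z) *
    resUnits Y (f.preimage_mono (inf_le_left.trans (hWV z))) (s z)
  have he : ∀ z, IsEigen f h hG.act_comp χ (N z) (e z) := fun z => by
    exact ((isEigen_appUnits (h := h) hG.act_comp (d z)).mul
      ((hs z).secRes (inf_le_left.trans (hWV z)))).congr fun g => one_mul (χ g)
  have hd : ∀ z w, resUnits Z (inf_le_left : N z ⊓ N w ≤ N z) (d z) *
      resUnits Z (inf_le_inf (inf_le_left.trans (hWV z)) (inf_le_left.trans (hWV w))) (a z w) =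
      resUnits Z (inf_le_right : N z ⊓ N w ≤ N w) (d w) := fun z w => by
    have h1 := congrArg (resUnits Z (inf_le_inf inf_le_left inf_le_left : N z ⊓ N w ≤ _)) (hcM z w)
    have h2 := congrArg (appUnits ι _) (M.cocycle x (ι z) (ι w))
    have hle : N z ⊓ N w ≤ ι ⁻¹ᵁ (M.U x ⊓ M.U (ι z) ⊓ M.U (ι w)) :=
      le_inf (inf_le_left.trans (hN z))
        (inf_le_right.trans ((hN w).trans (ι.preimage_mono inf_le_right)))
    rw [map_mul, appUnits_resUnits, appUnits_resUnits, appUnits_resUnits] at h2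
    replace h2 := congrArg (resUnits Z hle) h2
    rw [map_mul, resUnits_res, resUnits_res, resUnits_res] at h2
    simp only [map_mul, resUnits_res] at h1
    simp only [d, map_mul, resUnits_res]
    rw [← h2, mul_assoc, mul_assoc, h1]
  obtain ⟨t, ht⟩ := exists_glue_units f (V := ι ⁻¹ᵁ U) N (fun z => inf_le_right)
    (fun z hz => ⟨z, hW z, hz⟩) e fun z w => by
      have := congrArg (appUnits f _) (hd z w)
      simp only [map_mul, hres, ha, resUnits_res] at this
      simp only [e, map_mul, resUnits_res]
      rw [← this, map_inv, resUnits_res, mul_assoc, inv_mul_cancel_right]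
  refine ⟨U, M.mem x, t, fun g => sec_ext f fun z hz => ⟨N z, inf_le_right, ⟨hW z, hz⟩, ?_⟩⟩
  have h1 : secRes f (inf_le_right : N z ≤ ι ⁻¹ᵁ U) (t : Γ(Y, _)) = e z :=
    congrArg Units.val (ht z)
  rw [← secAct_secRes, map_mul, secRes_scal, h1]
  exact he z g

end Extension

/-! ### Rescaling by powers of a prime element. -/

section CommutativeAlgebra

variable {A B : Type*} [CommRing A] [CommRing B] [Algebra A B]

/-- The element becomes invertible in the integral closure of `A` in `B`, and injective integral
extensions reflect units. -/
theorem isUnit_of_isIntegral_inverse [FaithfulSMul A B] {a : A} {b : B} (hb : IsIntegral A b)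
    (h : algebraMap A B a * b = 1) : IsUnit a := by
  have : FaithfulSMul A (integralClosure A B) :=
    (faithfulSMul_iff_algebraMap_injective A _).2 fun x y hxy =>
      FaithfulSMul.algebraMap_injective A B (congrArg Subtype.val hxy)
  have := Algebra.IsIntegral.isLocalHom A (integralClosure A B)
  refine isUnit_of_map_unit (algebraMap A (integralClosure A B)) a ?_
  exact IsUnit.of_mul_eq_one (⟨b, hb⟩ : integralClosure A B) (Subtype.ext h)

/-- An invertible element whose `m`-th power comes from `A[1/ϖ]` can be multiplied by a power of the
prime element `ϖ` such that it and its inverse become integral over `A`, if `ϖ` generates a radical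
ideal in the integral closure of `A`. -/
theorem exists_isIntegral_rescale [IsDomain A] [FaithfulSMul A B] {ϖ : A}
    (hϖ : ∀ a b, ϖ ∣ a * b → ϖ ∣ a ∨ ϖ ∣ b) (u : Bˣ) (hu : (u : B) = algebraMap A B ϖ) {m : ℕ}
    (hm : 0 < m) (hrad : ∀ x : B, IsIntegral A x → (∃ y, IsIntegral A y ∧ x ^ m = u * y) →
      ∃ y, IsIntegral A y ∧ x = u * y)
    (e : Bˣ) {a a' : A} {n n' : ℕ} (ha : algebraMap A B a = u ^ n * e ^ m)
    (ha' : algebraMap A B a' = u ^ n' * (e⁻¹ : Bˣ) ^ m) :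
    ∃ k : ℤ, IsIntegral A ((e * u ^ k : Bˣ) : B) ∧ IsIntegral A (((e * u ^ k)⁻¹ : Bˣ) : B) := by
  have hinj := FaithfulSMul.algebraMap_injective A B
  -- `hϖ` does not exclude units. A unit occurs when an affine open misses the special fibre; then
  -- `e` and its inverse are integral without rescaling.
  by_cases hunit : IsUnit ϖ
  · obtain ⟨v, rfl⟩ := hunit
    have hv : (Units.map (algebraMap A B).toMonoidHom v) = u := Units.ext hu.symm
    have key : ∀ (w : B) (c : A) (l : ℕ), algebraMap A B c = u ^ l * w ^ m → IsIntegral A w :=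
      fun w c l hc => by
        refine IsIntegral.of_pow hm ?_
        have : w ^ m = algebraMap A B (c * (v⁻¹ : Aˣ) ^ l) := by
          rw [map_mul, hc, map_pow, hu, mul_right_comm, ← mul_pow, ← map_mul, Units.mul_inv,
            map_one, one_pow, one_mul]
        rw [this]
        exact isIntegral_algebraMap
    refine ⟨0, ?_, ?_⟩
    · rw [zpow_zero, mul_one]
      exact key _ _ _ ha
    · rw [zpow_zero, mul_one]
      exact key _ _ _ ha'
  have : Nontrivial B := hinj.nontrivial
  have hprime : Prime ϖ :=
    ⟨fun h => by rw [h, map_zero] at hu; exact u.ne_zero hu, hunit, hϖ⟩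
  -- The factors `e ^ m` and its inverse cancel, so `a` divides a power of the prime `ϖ`, hence is
  -- itself such a power up to a unit `v`.
  have haa : a * a' = ϖ ^ (n + n') := by
    apply hinj
    rw [map_mul, ha, ha', map_pow, ← hu, mul_mul_mul_comm, ← pow_add, ← mul_pow, Units.mul_inv,
      one_pow, mul_one]
  obtain ⟨i, -, hi⟩ := (dvd_prime_pow hprime (n + n')).1 ⟨a', haa.symm⟩
  obtain ⟨v, hv⟩ := hi.symm
  set w : Bˣ := Units.map (algebraMap A B).toMonoidHom v with hw
  have hem : e ^ m = u ^ ((i : ℤ) - n) * w := by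
    have : u ^ n * e ^ m = u ^ i * w := by
      ext
      rw [Units.val_mul, Units.val_pow_eq_pow_val, Units.val_pow_eq_pow_val, ← ha, ← hv, map_mul,
        map_pow, ← hu]
      rfl
    rw [zpow_sub, zpow_natCast, zpow_natCast, mul_right_comm, ← this, mul_right_comm,
      mul_inv_cancel, one_mul]
  -- `j` is the exponent of `ϖ` in `e ^ m`. Its quotient by `m` is removed by rescaling, its
  -- remainder `r` is left over in `e' ^ m = u ^ r * w`.
  set j : ℤ := (i : ℤ) - n with hj
  obtain ⟨r, hr⟩ := Int.eq_ofNat_of_zero_le (Int.emod_nonneg j (by positivity : (m : ℤ) ≠ 0))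
  have hrm : r < m := by
    have := Int.emod_lt_of_pos j (by positivity : (0 : ℤ) < m)
    omega
  set e' : Bˣ := e * u ^ (-(j / m)) with he'
  have hem' : e' ^ m = u ^ r * w := by
    rw [he', mul_pow, hem, ← zpow_natCast (u ^ (-(j / m))), ← zpow_mul, mul_right_comm, ← zpow_add,
      ← zpow_natCast u r, ← hr, Int.emod_def]
    congr 2
    ring
  have hwint : IsIntegral A (w : B) := isIntegral_algebraMap
  have hwint' : IsIntegral A ((w⁻¹ : Bˣ) : B) := by
    rw [hw, ← map_inv]
    exact isIntegral_algebraMap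
  have huint : IsIntegral A (u : B) := hu ▸ isIntegral_algebraMap
  have heint : IsIntegral A (e' : B) := by
    refine IsIntegral.of_pow hm ?_
    rw [← Units.val_pow_eq_pow_val, hem', Units.val_mul, Units.val_pow_eq_pow_val]
    exact (huint.pow r).mul hwint
  refine ⟨-(j / m), heint, ?_⟩
  rcases Nat.eq_zero_or_pos r with rfl | hr0
  · refine IsIntegral.of_pow hm ?_
    rw [← Units.val_pow_eq_pow_val, inv_pow, ← he', hem', pow_zero, one_mul]
    exact hwint'
  -- For `r > 0`, `u` divides `e' ^ m` among integral elements, so `hrad` gives `e' = u * c`.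
  -- Cancelling `u ^ r` in `u ^ m * c ^ m = u ^ r * w`, where `r < m`, shows that `ϖ` has an
  -- integral inverse.
  · exfalso
    obtain ⟨s, rfl⟩ := Nat.exists_eq_succ_of_ne_zero hr0.ne'
    obtain ⟨t, rfl⟩ := Nat.exists_eq_add_of_lt hrm
    obtain ⟨c, hc, hec⟩ := hrad e' heint ⟨u ^ s * w, (huint.pow s).mul hwint, by
      rw [← Units.val_pow_eq_pow_val, hem', pow_succ', mul_assoc]
      push_cast
      rfl⟩
    refine hunit (isUnit_of_isIntegral_inverse (b := u ^ t * c ^ (s.succ + t + 1) * (w⁻¹ : Bˣ))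
      (((huint.pow t).mul (hc.pow _)).mul hwint') ?_)
    have h1 : (u : B) ^ (s + 1) * w = u ^ (s + 1) * (u * (u ^ t * c ^ (s.succ + t + 1))) := by
      have := congrArg Units.val hem'
      rw [Units.val_pow_eq_pow_val, hec, Units.val_mul, Units.val_pow_eq_pow_val] at this
      rw [← Nat.succ_eq_add_one, ← this, mul_pow, pow_add, pow_add, pow_one]
      ring
    rw [← hu]
    have h2 : (w : B) = u * (u ^ t * c ^ (s.succ + t + 1)) := by
      refine (Units.mul_right_inj (u ^ (s + 1))).1 ?_
      rw [Units.val_pow_eq_pow_val]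
      exact h1
    rw [← mul_assoc, ← h2, Units.mul_inv]

/-- An integrally closed domain `A` is integrally closed in `A[1/ϖ]`. -/
theorem exists_algebraMap_eq_of_isIntegral [IsDomain A] [IsIntegrallyClosed A] {ϖ : A}
    (h0 : ϖ ≠ 0) [IsLocalization.Away ϖ B] {x : B} (hx : IsIntegral A x) :
    ∃ a, algebraMap A B a = x := by
  -- `B` embeds over `A` into the fraction field, where integral elements already lie in `A`.
  let ψ : B →ₐ[A] FractionRing A :=
    { IsLocalization.Away.lift ϖ (g := algebraMap A (FractionRing A)) (IsUnit.mk0 _ (by simpa)) with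
      commutes' := fun a => IsLocalization.Away.lift_eq ϖ _ a }
  have hle : Submonoid.powers ϖ ≤ nonZeroDivisors A :=
    powers_le_nonZeroDivisors_of_noZeroDivisors h0
  have hψ : Function.Injective ψ := by
    rw [injective_iff_map_eq_zero]
    intro y hy
    obtain ⟨a, s, rfl⟩ := IsLocalization.exists_mk'_eq (Submonoid.powers ϖ) y
    have h1 := IsLocalization.mk'_spec B a s
    have h2 := congrArg ψ h1
    rw [map_mul, hy, zero_mul, ψ.commutes] at h2
    have : a = 0 := FaithfulSMul.algebraMap_injective A (FractionRing A) (by rw [← h2, map_zero])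
    rw [this, IsLocalization.mk'_zero]
  obtain ⟨a, ha⟩ := IsIntegrallyClosed.isIntegral_iff.1 (hx.map ψ)
  exact ⟨a, hψ (by rw [ψ.commutes, ha])⟩

end CommutativeAlgebra

/-! ### Functions on the generic and special fibres. -/

section Pushout

/-- The quotient of `A` by `f ϖ` receives compatible maps from `A` and from `S`, because the kernel
of `g` lies in the ideal of `ϖ`. So the projection of `A` onto it factors through `P`. -/
theorem dvd_of_isPushout {R S A P : CommRingCat.{u}} {f : R ⟶ A} {g : R ⟶ S} {i : A ⟶ P}
    {j : S ⟶ P} (h : IsPushout f g i j) (hg : Function.Surjective g.hom) {ϖ : R}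
    (hker : ∀ r, g.hom r = 0 → ϖ ∣ r) {a : A} (ha : i.hom a = 0) : f.hom ϖ ∣ a := by
  let q : A ⟶ CommRingCat.of (A ⧸ Ideal.span {f.hom ϖ}) :=
    CommRingCat.ofHom (Ideal.Quotient.mk _)
  let ψ : { ψ : R →+* (A ⧸ Ideal.span {f.hom ϖ}) // RingHom.ker g.hom ≤ RingHom.ker ψ } :=
    ⟨(Ideal.Quotient.mk _).comp f.hom, fun r hr => by
      obtain ⟨s, rfl⟩ := hker r hr
      change Ideal.Quotient.mk _ (f.hom (ϖ * s)) = 0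
      rw [Ideal.Quotient.eq_zero_iff_mem, Ideal.mem_span_singleton, map_mul]
      exact dvd_mul_right _ _⟩
  let l : S ⟶ CommRingCat.of (A ⧸ Ideal.span {f.hom ϖ}) :=
    CommRingCat.ofHom (RingHom.liftOfSurjective g.hom hg ψ)
  have hl : f ≫ q = g ≫ l := by
    ext r
    exact (RingHom.liftOfSurjective_comp_apply g.hom hg ψ r).symm
  have e := congr($(h.inl_desc q l hl) a)
  have e' : q.hom a = 0 := by
    rw [← e]
    change (h.desc q l hl).hom (i.hom a) = 0
    rw [ha, map_zero]
  exact Ideal.mem_span_singleton.1 (Ideal.Quotient.eq_zero_iff_mem.1 e')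

theorem isLocalization_of_isPushout {R S : Type u} [CommRing R] [CommRing S] [Algebra R S]
    {A P : CommRingCat.{u}} {f : .of R ⟶ A} {i : A ⟶ P} {j : .of S ⟶ P}
    (h : IsPushout f (CommRingCat.ofHom (algebraMap R S)) i j) (ϖ : R) [IsLocalization.Away ϖ S] :
    letI := i.hom.toAlgebra; IsLocalization.Away (f.hom ϖ) P := by
  let _ : Algebra R A := f.hom.toAlgebra
  let _ : Algebra A P := i.hom.toAlgebra
  let _ : Algebra S P := j.hom.toAlgebra
  let _ : Algebra R P := (f ≫ i).hom.toAlgebra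
  have e : (f ≫ i).hom = (CommRingCat.ofHom (algebraMap R S) ≫ j).hom := congrArg _ h.w
  have : IsScalarTower R A P := .of_algebraMap_eq' rfl
  have : IsScalarTower R S P := .of_algebraMap_eq' e
  have : Algebra.IsPushout R A S P :=
    (CommRingCat.isPushout_iff_isPushout (R := R) (S := S) (R' := A) (S' := P)).1 h
  have := (Algebra.isLocalization_iff_isPushout (Submonoid.powers ϖ) (A := S) (T := A) (B := P)).2
    this
  rwa [Algebra.algebraMapSubmonoid_powers] at this

end Pushout

section Fibres

variable {R S : CommRingCat.{u}} {X : Scheme.{u}}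

/-- Functions on the base change of an affine open are a tensor product; the canonical isomorphisms
`Scheme.ΓSpecIso` replace global functions on the two spectra by `R` and `S`. -/
theorem isPushout_scal (φ : R ⟶ S) (h : X ⟶ Spec R) {W : X.Opens} (hW : IsAffineOpen W) :
    IsPushout (CommRingCat.ofHom (scal h W)) φ ((pullback.fst h (Spec.map φ)).app W)
      (CommRingCat.ofHom (scal (pullback.snd h (Spec.map φ))
        ((pullback.fst h (Spec.map φ)) ⁻¹ᵁ W))) := by
  have hp := IsPullback.of_hasPullback h (Spec.map φ)
  have key := (isIso_pushoutSection_iff hp (le_preimage_top (Spec.map φ) ⊤) (le_preimage_top h W)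
    (UY := pullback.fst h (Spec.map φ) ⁻¹ᵁ W) (by simp)).1
    (isIso_pushoutSection_of_isAffineOpen hp _ _ _ (isAffineOpen_top _) (isAffineOpen_top _) hW)
  refine key.of_iso (Scheme.ΓSpecIso R) (.refl _) (Scheme.ΓSpecIso S) (.refl _) ?_ ?_ ?_ ?_
  · exact (Category.comp_id _).trans ((Scheme.ΓSpecIso R).hom_inv_id_assoc _).symm
  · refine Eq.trans ?_ (Scheme.ΓSpecIso_naturality φ)
    exact congrArg (· ≫ _) (Scheme.Hom.app_eq_appLE _).symm
  · exact (Category.comp_id _).trans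
      ((Scheme.Hom.app_eq_appLE _).symm.trans (Category.id_comp _).symm)
  · exact (Category.comp_id _).trans ((Scheme.ΓSpecIso S).hom_inv_id_assoc _).symm

end Fibres

theorem subsingleton_app {X : Scheme.{u}} (W : X.Opens) (hW : IsEmpty W) (a b : Γ(X, W)) : a = b :=
  X.IsSheaf.section_ext fun x hx => (hW.false ⟨x, hx⟩).elim

section DVR

variable {R : Type u} [CommRing R] [IsDomain R] [IsDiscreteValuationRing R] {ϖ : R}
  (hϖ : Irreducible ϖ)

-- Every nonzero element of `R` is a unit times a power of `ϖ`, so inverting `ϖ` inverts all of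
-- them.
include hϖ in
theorem isLocalization_away_of_irreducible (K : Type u) [Field K] [Algebra R K]
    [IsFractionRing R K] : IsLocalization.Away ϖ K := by
  have hinj := IsFractionRing.injective R K
  have h0 : algebraMap R K ϖ ≠ 0 := by
    rw [Ne, map_eq_zero_iff _ hinj]
    exact hϖ.ne_zero
  refine ⟨?_, fun x => ?_, fun {x y} h => ⟨1, by rw [hinj h]⟩⟩
  · rintro ⟨_, n, rfl⟩
    exact IsUnit.mk0 _ (by simpa using fun h => absurd h hϖ.ne_zero)
  · obtain ⟨a, b, hb, rfl⟩ := IsFractionRing.div_surjective (A := R) x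
    have hb0 := nonZeroDivisors.ne_zero hb
    obtain ⟨n, v, rfl⟩ := IsDiscreteValuationRing.eq_unit_mul_pow_irreducible hb0 hϖ
    refine ⟨(a * (v⁻¹ : Rˣ), ⟨ϖ ^ n, n, rfl⟩), ?_⟩
    have hv : algebraMap R K v * algebraMap R K (v⁻¹ : Rˣ) = 1 := by
      rw [← map_mul, Units.mul_inv, map_one]
    have hv0 : algebraMap R K v ≠ 0 := left_ne_zero_of_mul_eq_one hv
    rw [map_mul, map_mul, map_pow, eq_comm, mul_comm, eq_inv_of_mul_eq_one_right hv]
    field_simp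

include hϖ in
/-- A function on an affine open whose restriction to the special fibre vanishes is divisible by the
uniformizer. -/
theorem dvd_of_specialFibre (Z : Over (Spec (.of R))) {W : Z.left.Opens} (hW : IsAffineOpen W)
    {a : Γ(Z.left, W)}
    (ha : ((pullback.fst Z.hom (specMap R (IsLocalRing.ResidueField R))).app W).hom a = 0) :
    scal Z.hom W ϖ ∣ a := by
  refine dvd_of_isPushout (isPushout_scal _ Z.hom hW) IsLocalRing.residue_surjective
    (fun r hr => ?_) ha
  have : r ∈ IsLocalRing.maximalIdeal R := (IsLocalRing.residue_eq_zero_iff r).1 hr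
  rwa [hϖ.maximalIdeal_eq, Ideal.mem_span_singleton] at this

include hϖ in
theorem specialFibre_scal (Z : Over (Spec (.of R))) {W : Z.left.Opens} (hW : IsAffineOpen W) :
    ((pullback.fst Z.hom (specMap R (IsLocalRing.ResidueField R))).app W).hom
      (scal Z.hom W ϖ) = 0 := by
  have e := congr($((isPushout_scal (CommRingCat.ofHom
    (algebraMap R (IsLocalRing.ResidueField R))) Z.hom hW).w) ϖ)
  have h0 : algebraMap R (IsLocalRing.ResidueField R) ϖ = 0 :=
    (IsLocalRing.residue_eq_zero_iff ϖ).2 (by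
      rw [hϖ.maximalIdeal_eq]
      exact Ideal.mem_span_singleton_self ϖ)
  refine e.trans ((congrArg (scal (R := .of (IsLocalRing.ResidueField R)) _ _) h0).trans ?_)
  exact map_zero (scal (R := .of (IsLocalRing.ResidueField R)) _ _)

variable (K : Type u) [Field K] [Algebra R K] [IsFractionRing R K]

include hϖ in
theorem isLocalization_genericFibre (Z : Over (Spec (.of R))) {W : Z.left.Opens}
    (hW : IsAffineOpen W) :
    letI := ((genericFibreι K Z).app W).hom.toAlgebra
    IsLocalization.Away (scal Z.hom W ϖ) Γ((genericFibre K Z).left, genericFibreι K Z ⁻¹ᵁ W) :=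
  have := isLocalization_away_of_irreducible hϖ K
  isLocalization_of_isPushout (isPushout_scal _ Z.hom hW) ϖ

omit [IsDiscreteValuationRing R] in
theorem scal_mem_nonZeroDivisors (Z : Over (Spec (.of R))) [Flat Z.hom] {W : Z.left.Opens}
    (hW : IsAffineOpen W) {r : R} (hr : r ≠ 0) :
    scal Z.hom W r ∈ nonZeroDivisors Γ(Z.left, W) := by
  have h1 : (Z.hom.appLE ⊤ W (le_preimage_top Z.hom W)).hom.Flat :=
    HasRingHomProperty.appLE (P := @Flat) Z.hom inferInstance ⟨⊤, isAffineOpen_top _⟩ ⟨W, hW⟩ _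
  have h2 : (scal Z.hom W).Flat := RingHom.Flat.comp
    (RingHom.Flat.of_bijective (ConcreteCategory.bijective_of_isIso (Scheme.ΓSpecIso (.of R)).inv))
    h1
  let _ : Algebra R Γ(Z.left, W) := (scal Z.hom W).toAlgebra
  have : Module.Flat R Γ(Z.left, W) := h2
  have h3 := Module.Flat.isSMulRegular_of_nonZeroDivisors (M := Γ(Z.left, W))
    (mem_nonZeroDivisors_of_ne_zero hr)
  rw [mem_nonZeroDivisors_iff_right]
  intro x hx
  refine h3 (Eq.trans ?_ (smul_zero r).symm)
  exact (Algebra.smul_def r x).trans ((mul_comm _ _).trans hx)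

theorem genericFibre_app_injective (Z : Over (Spec (.of R))) [Flat Z.hom] {W : Z.left.Opens}
    (hW : IsAffineOpen W) : Function.Injective ((genericFibreι K Z).app W).hom := by
  obtain ⟨ϖ, hϖ⟩ := IsDiscreteValuationRing.exists_irreducible R
  let _ := ((genericFibreι K Z).app W).hom.toAlgebra
  have := isLocalization_genericFibre hϖ K Z hW
  exact IsLocalization.injective _ (Submonoid.powers_le.2
    (scal_mem_nonZeroDivisors Z hW hϖ.ne_zero))

/-- By flatness these functions embed into those on the generic fibre, which is integral. -/
theorem isDomain_of_genericFibre (Z : Over (Spec (.of R))) [Flat Z.hom]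
    [IsIntegral (genericFibre K Z).left] {W : Z.left.Opens} (hW : IsAffineOpen W) [Nonempty W] :
    IsDomain Γ(Z.left, W) := by
  have hinj := genericFibre_app_injective K Z hW
  have : Nontrivial Γ((genericFibre K Z).left, genericFibreι K Z ⁻¹ᵁ W) := hinj.nontrivial
  have : Nonempty (genericFibreι K Z ⁻¹ᵁ W) := by
    by_contra h
    exact zero_ne_one (subsingleton_app (genericFibreι K Z ⁻¹ᵁ W) (not_nonempty_iff.1 h) 0 1)
  exact hinj.isDomain ((genericFibreι K Z).app W).hom

-- Functions modulo `ϖ` embed into the functions on the special fibre. Those form a domain if `W`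
-- meets that fibre; otherwise `ϖ` divides everything. Units being allowed, this is the form of
-- primality that `exists_isIntegral_rescale` asks for.
include hϖ in
theorem dvd_or_dvd_of_specialFibre (Z : Over (Spec (.of R)))
    [IsIntegral (specialFibre Z).left] {W : Z.left.Opens} (hW : IsAffineOpen W)
    (a b : Γ(Z.left, W)) (h : scal Z.hom W ϖ ∣ a * b) :
    scal Z.hom W ϖ ∣ a ∨ scal Z.hom W ϖ ∣ b := by
  set j := pullback.fst Z.hom (specMap R (IsLocalRing.ResidueField R))
  have hab : (j.app W).hom a * (j.app W).hom b = 0 := by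
    obtain ⟨c, hc⟩ := h
    rw [← map_mul, hc, map_mul, specialFibre_scal hϖ _ hW, zero_mul]
  rcases isEmpty_or_nonempty (j ⁻¹ᵁ W) with he | he
  · left
    exact dvd_of_specialFibre hϖ Z hW (subsingleton_app _ he _ _)
  · have : IsDomain Γ((specialFibre Z).left, j ⁻¹ᵁ W) := inferInstance
    exact (mul_eq_zero (M₀ := Γ((specialFibre Z).left, j ⁻¹ᵁ W)).1 hab).imp (dvd_of_specialFibre hϖ Z hW) (dvd_of_specialFibre hϖ Z hW)

-- Reducedness of the fibre makes `ϖ` generate a radical ideal. On the normalization of `X` in `Y_K`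
-- this is how the reducedness of `Y_k` enters.
include hϖ in
theorem dvd_of_dvd_pow_of_specialFibre (Z : Over (Spec (.of R)))
    [IsReduced (specialFibre Z).left] {W : Z.left.Opens} (hW : IsAffineOpen W)
    {a : Γ(Z.left, W)} {n : ℕ} (h : scal Z.hom W ϖ ∣ a ^ n) : scal Z.hom W ϖ ∣ a := by
  apply dvd_of_specialFibre hϖ Z hW
  obtain ⟨c, hc⟩ := h
  have : _root_.IsReduced Γ((specialFibre Z).left,
    pullback.fst Z.hom (specMap R (IsLocalRing.ResidueField R)) ⁻¹ᵁ W) := inferInstance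
  refine IsReduced.eq_zero (R := Γ((specialFibre Z).left, _)) _ ⟨n, ?_⟩
  rw [← map_pow, hc, map_mul, specialFibre_scal hϖ _ hW, zero_mul]

end DVR

/-- Integral closedness can be checked at maximal ideals, where the localizations are stalks of `X`.
-/
theorem isIntegrallyClosed_of_isNormalScheme (X : Scheme.{u}) [IsNormalScheme X] {W : X.Opens}
    (hW : IsAffineOpen W) [IsDomain Γ(X, W)] : IsIntegrallyClosed Γ(X, W) := by
  refine IsIntegrallyClosed.of_localization_maximal fun p _ hp => ?_
  let y : PrimeSpectrum Γ(X, W) := ⟨p, hp.isPrime⟩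
  have hy : hW.fromSpec y ∈ W := by
    rw [← SetLike.mem_coe, ← hW.range_fromSpec]
    exact ⟨y, rfl⟩
  let _ := TopCat.Presheaf.algebra_section_stalk X.presheaf ⟨hW.fromSpec y, hy⟩
  have h1 : IsLocalization.AtPrime (X.presheaf.stalk (hW.fromSpec y)) p :=
    hW.isLocalization_stalk' y hy
  have := IsNormalScheme.isIntegrallyClosed_stalk (hW.fromSpec y)
  exact IsIntegrallyClosed.of_equiv (IsLocalization.algEquiv p.primeCompl
    (X.presheaf.stalk (hW.fromSpec y)) (Localization.AtPrime p)).toRingEquiv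

/-! ### The normalization of a scheme in another, and its endomorphisms. -/

section Normalization

variable {Y X : Scheme.{u}} (q : Y ⟶ X) [QuasiCompact q] [QuasiSeparated q]

theorem le_toNormalization_preimage (U : X.Opens) :
    q ⁻¹ᵁ U ≤ q.toNormalization ⁻¹ᵁ (q.fromNormalization ⁻¹ᵁ U) := by
  rw [← Scheme.Hom.comp_preimage, Scheme.Hom.toNormalization_fromNormalization]

/-- The map from the functions on the normalization of `X` in `Y` to the functions on `Y`. -/
noncomputable def normApp (U : X.Opens) :
    Γ(q.normalization, q.fromNormalization ⁻¹ᵁ U) →+* Γ(Y, q ⁻¹ᵁ U) :=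
  (q.toNormalization.appLE _ _ (le_toNormalization_preimage q U)).hom

theorem normApp_app (U : X.Opens) (a : Γ(X, U)) :
    normApp q U ((q.fromNormalization.app U).hom a) = (q.app U).hom a := by
  change (q.fromNormalization.app U ≫ q.toNormalization.appLE _ _ _).hom a = _
  rw [Scheme.Hom.app_eq_appLE, Scheme.Hom.appLE_comp_appLE]
  simp only [Scheme.Hom.toNormalization_fromNormalization]
  rw [Scheme.Hom.app_eq_appLE]

-- Above an affine open the functions on the normalization are the integral closure, a subring of
-- the functions on `Y`. The next three lemmas read off injectivity and the description of the
-- image.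
variable {q} in
theorem normApp_eq_val {U : X.Opens} (hU : IsAffineOpen U)
    (b : Γ(q.normalization, q.fromNormalization ⁻¹ᵁ U)) :
    normApp q U b = ((q.normalizationObjIso hU).hom.hom b).1 :=
  congr($(q.normalizationObjIso_hom_val hU) b).symm

variable {q} in
theorem normApp_injective {U : X.Opens} (hU : IsAffineOpen U) :
    Function.Injective (normApp q U) := fun b b' h => by
  rw [normApp_eq_val hU, normApp_eq_val hU] at h
  exact (ConcreteCategory.bijective_of_isIso (q.normalizationObjIso hU).hom).1 (Subtype.ext h)

variable {q} in
theorem exists_normApp_eq {U : X.Opens} (hU : IsAffineOpen U) {x : Γ(Y, q ⁻¹ᵁ U)}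
    (hx : (q.app U).hom.IsIntegralElem x) : ∃ b, normApp q U b = x := by
  let _ := (q.app U).hom.toAlgebra
  obtain ⟨b, hb⟩ := (ConcreteCategory.bijective_of_isIso (q.normalizationObjIso hU).hom).2 ⟨x, hx⟩
  exact ⟨b, (normApp_eq_val hU b).trans (congrArg Subtype.val hb)⟩

variable {q} in
theorem isIntegralElem_normApp {U : X.Opens} (hU : IsAffineOpen U)
    (b : Γ(q.normalization, q.fromNormalization ⁻¹ᵁ U)) :
    (q.app U).hom.IsIntegralElem (normApp q U b) := by
  rw [normApp_eq_val hU]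
  exact ((q.normalizationObjIso hU).hom.hom b).2

variable {q}

theorem eq_comp_toNormalization {ρ : Y ⟶ Y} (hρ : ρ ≫ q = q) :
    q = (ρ ≫ q.toNormalization) ≫ q.fromNormalization := by
  rw [Category.assoc, Scheme.Hom.toNormalization_fromNormalization, hρ]

/-- The endomorphism of the normalization induced by an endomorphism of `Y` over `X`. -/
noncomputable def normEnd {ρ : Y ⟶ Y} (hρ : ρ ≫ q = q) : q.normalization ⟶ q.normalization :=
  q.normalizationDesc (ρ ≫ q.toNormalization) q.fromNormalization (eq_comp_toNormalization hρ)

theorem toNormalization_normEnd {ρ : Y ⟶ Y} (hρ : ρ ≫ q = q) :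
    q.toNormalization ≫ normEnd hρ = ρ ≫ q.toNormalization :=
  q.toNormalization_normalizationDesc _ _ _

theorem normEnd_comp {ρ : Y ⟶ Y} (hρ : ρ ≫ q = q) :
    normEnd hρ ≫ q.fromNormalization = q.fromNormalization :=
  q.normalizationDesc_comp _ _ _

/-- Endomorphisms of the normalization over `X` are determined by their restriction along
`toNormalization`; here and in the next lemma the group law passes from `Y` to the normalization. -/
theorem normEnd_eq_id {ρ : Y ⟶ Y} (hρ : ρ ≫ q = q) (h : ρ = 𝟙 Y) : normEnd hρ = 𝟙 _ :=
  Scheme.Hom.normalization.hom_ext q _ _ q.fromNormalization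
    (by rw [toNormalization_normEnd, h, Category.id_comp, Category.comp_id]) (normEnd_comp hρ)
    (Category.id_comp _)

theorem normEnd_eq_comp {ρ σ τ : Y ⟶ Y} (hρ : ρ ≫ q = q) (hσ : σ ≫ q = q) (hτ : τ ≫ q = q)
    (h : τ = ρ ≫ σ) : normEnd hτ = normEnd hρ ≫ normEnd hσ :=
  Scheme.Hom.normalization.hom_ext q _ _ q.fromNormalization
    (by rw [toNormalization_normEnd, ← Category.assoc, toNormalization_normEnd, Category.assoc,
      toNormalization_normEnd, h, Category.assoc]) (normEnd_comp hτ)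
    (by rw [Category.assoc, normEnd_comp, normEnd_comp])

theorem normApp_secAct {ρ : Y ⟶ Y} (hρ : ρ ≫ q = q) (U : X.Opens)
    (b : Γ(q.normalization, q.fromNormalization ⁻¹ᵁ U)) :
    normApp q U (secAct q.fromNormalization (normEnd_comp hρ) U b) =
      secAct q hρ U (normApp q U b) := by
  change ((normEnd hρ).appLE _ _ _ ≫ q.toNormalization.appLE _ _ _).hom b =
    (q.toNormalization.appLE _ _ _ ≫ ρ.appLE _ _ _).hom b
  rw [Scheme.Hom.appLE_comp_appLE, Scheme.Hom.appLE_comp_appLE]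
  simp only [toNormalization_normEnd]

theorem normApp_scal {R : CommRingCat.{u}} (x : X ⟶ Spec R) (U : X.Opens) (r : R) :
    normApp q U (scal (q.fromNormalization ≫ x) (q.fromNormalization ⁻¹ᵁ U) r) =
      scal (q ≫ x) (q ⁻¹ᵁ U) r :=
  appLE_scal _ _ (by rw [← Category.assoc, Scheme.Hom.toNormalization_fromNormalization]) _ r

theorem isEigen_of_normApp {G : Type v} [CommGroup G] {R : CommRingCat.{u}} (x : X ⟶ Spec R)
    {ρ : G → (Y ⟶ Y)} (hρ : ∀ g, ρ g ≫ q = q) {χ : G →* Rˣ} {U : X.Opens} (hU : IsAffineOpen U)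
    {b : Γ(q.normalization, q.fromNormalization ⁻¹ᵁ U)}
    (hb : IsEigen q (q ≫ x) hρ χ U (normApp q U b)) :
    IsEigen q.fromNormalization (q.fromNormalization ≫ x) (fun g => normEnd_comp (hρ g)) χ U b :=
  fun g => normApp_injective hU (by rw [normApp_secAct, map_mul, normApp_scal]; exact hb g)

end Normalization

/-! ### Invariants and invertible eigenfunctions on the normalization. -/

section Model

variable {R : Type u} [CommRing R] [IsDomain R] [IsDiscreteValuationRing R]
  {K : Type u} [Field K] [Algebra R K] [IsFractionRing R K]
  {G : Type v} [CommGroup G] [Finite G] {X : Over (Spec (.of R))}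
  {YK : Over (Spec (.of K))} [IsNoetherian YK.left] {fK : YK ⟶ genericFibre K X}
  {ρ : G → (YK.left ⟶ YK.left)} (hG : IsGaloisCover fK.left ρ)

omit [IsDomain R] [IsDiscreteValuationRing R] [IsFractionRing R K]
  [AlgebraicGeometry.IsNoetherian YK.left] in
theorem toModel_app (fK : YK ⟶ genericFibre K X) (U : X.left.Opens) (a : Γ(X.left, U)) :
    ((toModel fK).app U).hom a =
      (fK.left.app (genericFibreι K X ⁻¹ᵁ U)).hom (((genericFibreι K X).app U).hom a) :=
  congr($(Scheme.Hom.comp_app fK.left (genericFibreι K X) U) a)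

omit [IsDomain R] [IsDiscreteValuationRing R] [IsFractionRing R K]
  [AlgebraicGeometry.IsNoetherian YK.left] in
include hG in
theorem IsGaloisCover.act_comp_toModel (g : G) : ρ g ≫ toModel fK = toModel fK := by
  rw [← Category.assoc, hG.act_comp]

omit [AlgebraicGeometry.IsNoetherian YK.left] in
include hG in
theorem IsGaloisCover.toModel_app_injective [Flat X.hom] {U : X.left.Opens} (hU : IsAffineOpen U) :
    Function.Injective ((toModel fK).app U).hom := fun a b h => by
  rw [toModel_app, toModel_app] at h
  exact genericFibre_app_injective K X hU (hG.injective _ h)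

/-- Invariant functions on the normalization come from the base. -/
theorem IsGaloisCover.exists_app_eq_of_normalization [Flat X.hom] [IsNormalScheme X.left]
    [IsIntegral (genericFibre K X).left] {U : X.left.Opens} (hU : IsAffineOpen U)
    (c : Γ((toModel fK).normalization, (toModel fK).fromNormalization ⁻¹ᵁ U))
    (hc : ∀ g, secAct (toModel fK).fromNormalization
      (normEnd_comp (hG.act_comp_toModel g)) U c = c) :
    ∃ a, ((toModel fK).fromNormalization.app U).hom a = c := by
  rcases isEmpty_or_nonempty U with hempty | hne
  · exact ⟨0, subsingleton_app ((toModel fK).fromNormalization ⁻¹ᵁ U)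
      ⟨fun y => hempty.false ⟨_, y.2⟩⟩ _ _⟩
  -- On the generic fibre `c` descends to `a'`. Integrality of `c` passes to `a'` by injectivity of
  -- pull-back, and normality of `X` then puts `a'` into the functions on `U`.
  obtain ⟨a', ha'⟩ := hG.invariants (genericFibreι K X ⁻¹ᵁ U) (normApp (toModel fK) U c)
    fun g => (normApp_secAct (hG.act_comp_toModel g) U c).symm.trans (congrArg _ (hc g))
  obtain ⟨ϖ, hϖ⟩ := IsDiscreteValuationRing.exists_irreducible R
  have := isDomain_of_genericFibre K X hU
  have := isIntegrallyClosed_of_isNormalScheme X.left hU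
  let _ := ((genericFibreι K X).app U).hom.toAlgebra
  have := isLocalization_genericFibre hϖ K X hU
  have hint : _root_.IsIntegral Γ(X.left, U) a' := by
    obtain ⟨P, hP, hP'⟩ := isIntegralElem_normApp hU c
    have hcomp : (fK.left.app (genericFibreι K X ⁻¹ᵁ U)).hom.comp ((genericFibreι K X).app U).hom =
        ((toModel fK).app U).hom := RingHom.ext fun a => (toModel_app fK U a).symm
    refine ⟨P, hP, hG.injective _ ?_⟩
    exact ((Polynomial.hom_eval₂ P _ (fK.left.app _).hom a').trans
      ((congrArg₂ (fun φ x => Polynomial.eval₂ φ x P) hcomp ha').trans hP')).trans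
        (map_zero (fK.left.app (genericFibreι K X ⁻¹ᵁ U)).hom).symm
  obtain ⟨a, ha⟩ := exists_algebraMap_eq_of_isIntegral
    (nonZeroDivisors.ne_zero (scal_mem_nonZeroDivisors X hU hϖ.ne_zero)) hint
  refine ⟨a, normApp_injective hU ?_⟩
  rw [normApp_app, toModel_app, ← ha']
  exact congrArg _ ha

/-- If the special fibre of the normalization is reduced, then invertible eigenfunctions on the
generic fibre can be rescaled to become invertible functions on the normalization. -/
theorem IsGaloisCover.exists_isEigen_normalization [Flat X.hom]
    [IsIntegral (genericFibre K X).left] [IsIntegral (specialFibre X).left]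
    [IsReduced (specialFibre (normalizationIn fK)).left] {U : X.left.Opens} (hU : IsAffineOpen U)
    [Nonempty U] (χ : G →* Rˣ)
    (e : Γ(YK.left, toModel fK ⁻¹ᵁ U)ˣ)
    (he : IsEigen (R := .of R) (toModel fK) (toModel fK ≫ X.hom) hG.act_comp_toModel χ U e) :
    ∃ ε : Γ((toModel fK).normalization, (toModel fK).fromNormalization ⁻¹ᵁ U)ˣ,
      IsEigen (R := .of R) (toModel fK).fromNormalization ((toModel fK).fromNormalization ≫ X.hom)
        (fun g => normEnd_comp (hG.act_comp_toModel g)) χ U ε := by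
  obtain ⟨ϖ, hϖ⟩ := IsDiscreteValuationRing.exists_irreducible R
  have := isDomain_of_genericFibre K X hU
  let _ := ((genericFibreι K X).app U).hom.toAlgebra
  have hloc := isLocalization_genericFibre hϖ K X hU
  let _ := ((toModel fK).app U).hom.toAlgebra
  have : FaithfulSMul Γ(X.left, U) Γ(YK.left, (toModel fK) ⁻¹ᵁ U) :=
    (faithfulSMul_iff_algebraMap_injective _ _).2 (hG.toModel_app_injective hU)
  obtain ⟨v, hv⟩ := IsLocalization.Away.algebraMap_isUnit
    (S := Γ((genericFibre K X).left, genericFibreι K X ⁻¹ᵁ U)) (scal X.hom U ϖ)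
  let u : Γ(YK.left, toModel fK ⁻¹ᵁ U)ˣ := appUnits fK.left _ v
  have hu : (u : Γ(YK.left, toModel fK ⁻¹ᵁ U)) =
      algebraMap Γ(X.left, U) Γ(YK.left, toModel fK ⁻¹ᵁ U) (scal X.hom U ϖ) :=
    (congrArg (fK.left.app _).hom hv).trans (toModel_app fK U _).symm
  -- Invariant functions come from the localization at `ϖ` of the functions on `U`, so a power of
  -- `ϖ` clears their denominators. This is applied to the `|G|`-th powers of `e` and of its
  -- inverse.
  have hinv : ∀ w : Γ(YK.left, toModel fK ⁻¹ᵁ U),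
      (∀ g, secAct (toModel fK) (hG.act_comp_toModel g) U w = w) →
        ∃ (n : ℕ) (a : Γ(X.left, U)), algebraMap Γ(X.left, U) Γ(YK.left, toModel fK ⁻¹ᵁ U) a =
          u ^ n * w := fun w hw => by
    obtain ⟨a', rfl⟩ := hG.invariants (genericFibreι K X ⁻¹ᵁ U) w hw
    obtain ⟨n, a, ha⟩ := IsLocalization.Away.surj (scal X.hom U ϖ) a'
    refine ⟨n, a, ?_⟩
    refine (toModel_app fK U a).trans ((congrArg (fK.left.app _).hom ha.symm).trans ?_)
    rw [map_mul, map_pow, ← hv, mul_comm]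
    rfl
  have hχ : ∀ g, (χ ^ Nat.card G) g = 1 := fun g => by
    rw [MonoidHom.pow_apply, ← map_pow, pow_card_eq_one', map_one]
  obtain ⟨n, a, ha⟩ := hinv _ (((he.pow (Nat.card G)).congr (ψ := 1) hχ).secAct_eq)
  obtain ⟨n', a', ha'⟩ := hinv _ (((he.inv.pow (Nat.card G)).congr (ψ := 1) fun g => by
    have := hχ g
    rw [MonoidHom.pow_apply] at this
    rw [MonoidHom.pow_apply, MonoidHom.inv_apply, inv_pow, this, inv_one, MonoidHom.one_apply]).secAct_eq)
  let t : Γ((toModel fK).normalization, (toModel fK).fromNormalization ⁻¹ᵁ U) :=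
    scal (normalizationIn fK).hom ((toModel fK).fromNormalization ⁻¹ᵁ U) ϖ
  have ht : normApp (toModel fK) U t = u := ((normApp_scal X.hom U ϖ).trans
    (app_scal X.hom (toModel fK) U ϖ).symm).trans hu.symm
  -- The radicality condition holds because integral elements are functions on the normalization,
  -- whose special fibre is reduced.
  obtain ⟨k, hk, hk'⟩ := exists_isIntegral_rescale (dvd_or_dvd_of_specialFibre hϖ X hU)
    u hu Nat.card_pos (fun x hx ⟨y, hy, hxy⟩ => by
      obtain ⟨c, rfl⟩ := exists_normApp_eq hU hx
      obtain ⟨d, rfl⟩ := exists_normApp_eq hU hy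
      have hpow : c ^ Nat.card G = t * d := normApp_injective hU (by
        rw [map_mul, map_pow, hxy, ht])
      obtain ⟨c', rfl⟩ := dvd_of_dvd_pow_of_specialFibre hϖ (normalizationIn fK)
        (W := (toModel fK).fromNormalization ⁻¹ᵁ U) (hU.preimage (toModel fK).fromNormalization)
        (a := c) (n := Nat.card G) ⟨d, hpow⟩
      refine ⟨normApp _ U c', isIntegralElem_normApp hU c', ?_⟩
      exact (map_mul (normApp (toModel fK) U) _ _).trans (congrArg (· * _) ht)) e ha ha'
  obtain ⟨ε, hε⟩ := exists_normApp_eq hU hk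
  obtain ⟨ε', hε'⟩ := exists_normApp_eq hU hk'
  have hεε : ε * ε' = 1 := normApp_injective hU (by
    rw [map_mul, hε, hε', map_one, Units.mul_inv])
  refine ⟨⟨ε, ε', hεε, (mul_comm _ _).trans hεε⟩, isEigen_of_normApp X.hom
    (hG.act_comp_toModel) hU ?_⟩
  -- `u` comes from the base, so its powers are invariant and rescaling does not change the
  -- character.
  have h1 : IsEigen (R := .of R) (toModel fK) (toModel fK ≫ X.hom) hG.act_comp_toModel 1 U
      (u ^ k : Γ(YK.left, toModel fK ⁻¹ᵁ U)ˣ) := by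
    have := isEigen_appUnits (R := .of R) (h := toModel fK ≫ X.hom) hG.act_comp (v ^ k)
    rw [map_zpow] at this
    exact this
  have h2 := (he.mul h1).congr (ψ := χ) fun g => mul_one (χ g)
  rw [← Units.val_mul, ← hε] at h2
  exact h2

/-- If torsion line bundles extend and the special fibre of the normalization is reduced, then
invertible eigenfunctions on the normalization exist locally on the base. -/
theorem IsGaloisCover.exists_forall_isEigen_normalization [Flat X.hom]
    [IsIntegral (genericFibre K X).left] [IsIntegral (specialFibre X).left]
    [IsReduced (specialFibre (normalizationIn fK)).left] (hm : IsUnit (Nat.card G : R))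
    [Finite (G →* Rˣ)] (hPic : Set.SurjOn (Pic.pullback (genericFibreι K X))
      (Pic.torsion (Nat.card G) X.left) (Pic.torsion (Nat.card G) (genericFibre K X).left))
    (z : X.left) :
    ∃ U : X.left.Opens, IsAffineOpen U ∧ z ∈ U ∧ ∀ χ : G →* Rˣ,
      ∃ ε : Γ((toModel fK).normalization, (toModel fK).fromNormalization ⁻¹ᵁ U)ˣ,
        IsEigen (R := .of R) (toModel fK).fromNormalization
          ((toModel fK).fromNormalization ≫ X.hom)
          (fun g => normEnd_comp (hG.act_comp_toModel g)) χ U ε := by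
  have key := fun χ : G →* Rˣ => hG.exists_isEigen_preimage (R := .of R) (h := toModel fK ≫ X.hom)
    (genericFibreι K X ≫ X.hom) (Category.assoc _ _ _).symm hm (genericFibreι K X) hPic χ z
  choose V hV e he using key
  -- There are finitely many characters, so one affine neighbourhood serves all of them.
  obtain ⟨_, ⟨U, hU, rfl⟩, hz, hUV⟩ := X.left.isBasis_affineOpens.exists_subset_of_mem_open
    (Set.mem_iInter.2 hV) (isOpen_iInter_of_finite fun χ => (V χ).2)
  have : Nonempty U := ⟨⟨z, hz⟩⟩
  refine ⟨U, hU, hz, fun χ => ?_⟩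
  have hle : U ≤ V χ := fun y hy => Set.mem_iInter.1 (hUV hy) χ
  exact hG.exists_isEigen_normalization hU χ
    (resUnits YK.left ((toModel fK).preimage_mono hle) (e χ))
    ((he χ).secRes ((genericFibreι K X).preimage_mono hle))

end Model

/-! ### Fourier inversion on a finite abelian group. -/

section Fourier

variable {R : Type*} [CommRing R] [IsDomain R] {G : Type*} [CommGroup G] [Fintype G]
  [Fintype (G →* Rˣ)]

omit [Fintype (G →* Rˣ)] in
theorem sum_character_eq_zero {χ : G →* Rˣ} (hχ : χ ≠ 1) : ∑ g, (χ g : R) = 0 := by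
  have := sum_hom_units_eq_zero ((Units.coeHom R).comp χ) fun h => hχ (MonoidHom.ext fun g =>
    Units.ext (DFunLike.congr_fun h g))
  simpa using this

variable [HasEnoughRootsOfUnity R (Monoid.exponent G)]

/-- A character `ψ` with `ψ g ≠ 1` permutes the characters by multiplication, so the sum equals its
product with `ψ g`. -/
theorem sum_dual_eq_zero {g : G} (hg : g ≠ 1) : ∑ χ : G →* Rˣ, (χ g : R) = 0 := by
  obtain ⟨ψ, hψ⟩ := CommGroup.exists_apply_ne_one_of_hasEnoughRootsOfUnity G R hg
  have h : (ψ g : R) * ∑ χ : G →* Rˣ, (χ g : R) = ∑ χ : G →* Rˣ, (χ g : R) := by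
    rw [Finset.mul_sum]
    exact Fintype.sum_equiv (Equiv.mulLeft ψ) _ _ fun χ => by simp
  have h' : ((ψ g : R) - 1) * ∑ χ : G →* Rˣ, (χ g : R) = 0 := by
    rw [sub_mul, h, one_mul, sub_self]
  refine (mul_eq_zero.1 h').resolve_left (sub_ne_zero.2 fun h1 => hψ (Units.ext h1))

omit [IsDomain R] in
theorem card_dual : Fintype.card (G →* Rˣ) = Fintype.card G := by
  have := CommGroup.card_monoidHom_of_hasEnoughRootsOfUnity G R
  rwa [Nat.card_eq_fintype_card, Nat.card_eq_fintype_card] at this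

variable {C : Type*} [CommRing C] (κ : R →+* C) (hm : IsUnit (Fintype.card G : R))

/-- The Fourier coefficients of a function on a finite abelian group. -/
noncomputable def fourierCoeff (s : G → C) (χ : G →* Rˣ) : C :=
  κ (Ring.inverse (Fintype.card G : R)) * ∑ g, κ (χ g⁻¹ : Rˣ) * s g

theorem map_inverse_card_mul {R G C : Type*} [CommRing R] [Fintype G] [CommRing C] (κ : R →+* C)
    (hm : IsUnit (Fintype.card G : R)) :
    κ (Ring.inverse (Fintype.card G : R)) * κ (Fintype.card G) = 1 := by
  rw [← map_mul, Ring.inverse_mul_cancel _ hm, map_one]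

include hm in
theorem sum_fourierCoeff (s : G → C) (g : G) :
    ∑ χ : G →* Rˣ, κ (χ g : Rˣ) * fourierCoeff κ s χ = s g := by
  classical
  have key : ∀ h : G, ∑ χ : G →* Rˣ, κ (χ g : Rˣ) * κ (χ h⁻¹ : Rˣ) =
      if h = g then κ (Fintype.card G) else 0 := fun h => by
    have e : ∀ χ : G →* Rˣ, κ (χ g : Rˣ) * κ (χ h⁻¹ : Rˣ) = κ (χ (g * h⁻¹) : Rˣ) := fun χ => by
      rw [map_mul χ, Units.val_mul, map_mul]
    rw [Finset.sum_congr rfl fun χ _ => e χ, ← map_sum]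
    split_ifs with hgh
    · subst hgh
      simp [card_dual]
    · rw [sum_dual_eq_zero, map_zero]
      rwa [Ne, mul_inv_eq_one, eq_comm]
  calc ∑ χ : G →* Rˣ, κ (χ g : Rˣ) * fourierCoeff κ s χ
      = κ (Ring.inverse (Fintype.card G : R)) *
          ∑ h, (∑ χ : G →* Rˣ, κ (χ g : Rˣ) * κ (χ h⁻¹ : Rˣ)) * s h := by
        simp only [fourierCoeff, Finset.mul_sum, Finset.sum_mul]
        rw [Finset.sum_comm]
        refine Finset.sum_congr rfl fun h _ => Finset.sum_congr rfl fun χ _ => ?_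
        ring
    _ = _ := by
        simp only [key, ite_mul, zero_mul, Finset.sum_ite_eq', Finset.mem_univ, if_true]
        rw [← mul_assoc, map_inverse_card_mul κ hm, one_mul]

-- Pairing with `ψ g⁻¹` isolates `|G|` times `d ψ`. As `C` need not be a domain, invertibility of
-- `|G|` takes the place of Dedekind's independence argument.
omit [HasEnoughRootsOfUnity R (Monoid.exponent G)] in
include hm in
theorem eq_zero_of_sum_character_mul (d : (G →* Rˣ) → C)
    (hd : ∀ g, ∑ χ, κ (χ g : Rˣ) * d χ = 0) (ψ : G →* Rˣ) : d ψ = 0 := by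
  classical
  have key : ∀ χ : G →* Rˣ, ∑ g, κ (ψ g⁻¹ : Rˣ) * κ (χ g : Rˣ) =
      if χ = ψ then κ (Fintype.card G) else 0 := fun χ => by
    have e : ∀ g, κ (ψ g⁻¹ : Rˣ) * κ (χ g : Rˣ) = κ ((χ * ψ⁻¹) g : Rˣ) := fun g => by
      rw [map_inv ψ, MonoidHom.mul_apply, MonoidHom.inv_apply, mul_comm, ← map_mul, Units.val_mul]
    rw [Finset.sum_congr rfl fun g _ => e g, ← map_sum]
    split_ifs with h
    · subst h
      simp
    · rw [sum_character_eq_zero, map_zero]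
      exact fun hc => h (MonoidHom.ext fun g => mul_inv_eq_one.1 (DFunLike.congr_fun hc g))
  have h : ∑ g, κ (ψ g⁻¹ : Rˣ) * ∑ χ, κ (χ g : Rˣ) * d χ = κ (Fintype.card G) * d ψ := by
    simp only [Finset.mul_sum]
    rw [Finset.sum_comm]
    simp only [← mul_assoc, ← Finset.sum_mul, key, ite_mul, zero_mul, Finset.sum_ite_eq',
      Finset.mem_univ, if_true]
  simp only [hd, mul_zero, Finset.sum_const_zero] at h
  rw [← one_mul (d ψ), ← map_inverse_card_mul κ hm, mul_assoc, ← h, mul_zero]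

end Fourier

/-! ### Testing on affine opens, and the structure of Kummer coverings. -/

section LocalAtTarget

theorem of_forall_exists_affine (P : MorphismProperty Scheme.{u}) [IsZariskiLocalAtTarget P]
    {Y X : Scheme.{u}} (f : Y ⟶ X) [IsAffineHom f]
    (h : ∀ x, ∃ U : X.Opens, IsAffineOpen U ∧ x ∈ U ∧ P (Spec.map (f.app U))) : P f := by
  choose U hU hx hP using h
  refine (IsZariskiLocalAtTarget.iff_of_iSup_eq_top (P := P) U
    (eq_top_iff.2 fun x _ => TopologicalSpace.Opens.mem_iSup.2 ⟨x, hx x⟩)).2 fun x => ?_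
  have : IsAffine (U x) := hU x
  have : IsAffine (f ⁻¹ᵁ U x) := (hU x).preimage f
  have h1 : IsIso (U x).toSpecΓ := inferInstanceAs (IsIso (hU x).isoSpec.hom)
  have h2 : IsIso (f ⁻¹ᵁ U x).toSpecΓ := inferInstanceAs (IsIso ((hU x).preimage f).isoSpec.hom)
  have e : Arrow.mk (f ∣_ U x) ≅ Arrow.mk (Spec.map (f.app (U x))) :=
    Arrow.isoMk (asIso (f ⁻¹ᵁ U x).toSpecΓ) (asIso (U x).toSpecΓ)
      (Scheme.Opens.toSpecΓ_naturality ..)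
  exact (P.arrow_mk_iso_iff e).2 (hP x)

end LocalAtTarget

/-- Over the open `U`, the morphism `f` is a Kummer covering: the invariant functions come from the
base, and there are invertible eigenfunctions for all characters. -/
structure IsKummerOn {G : Type v} [CommGroup G] {R : CommRingCat.{u}} {Y X : Scheme.{u}} (f : Y ⟶ X)
    (h : Y ⟶ Spec R) {ρ : G → (Y ⟶ Y)} (hρ : ∀ g, ρ g ≫ f = f) (U : X.Opens) : Prop where
  isAffineOpen : IsAffineOpen U
  injective : Function.Injective (f.app U).hom
  invariants : ∀ b : Γ(Y, f ⁻¹ᵁ U), (∀ g, secAct f (hρ g) U b = b) → ∃ a, (f.app U).hom a = b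
  exists_isEigen : ∀ χ : G →* Rˣ, ∃ ε : Γ(Y, f ⁻¹ᵁ U)ˣ, IsEigen f h hρ χ U ε

section Kummer

variable {G : Type v} [CommGroup G] [Fintype G] {R : Type u} [CommRing R] [IsDomain R]
  [Fintype (G →* Rˣ)] [HasEnoughRootsOfUnity R (Monoid.exponent G)]
  (hm : IsUnit (Fintype.card G : R))
  {Y X : Scheme.{u}} {f : Y ⟶ X} {h : Y ⟶ Spec (.of R)} {ρ : G → (Y ⟶ Y)}
  {hρ : ∀ g, ρ g ≫ f = f} (hh : ∀ g, ρ g ≫ h = h) (hmul : ∀ g k, ρ (g * k) = ρ k ≫ ρ g)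
  (hone : ρ 1 = 𝟙 Y)
  {U : X.Opens} (hU : IsKummerOn (R := .of R) f h hρ U)

-- Translating the summation variable by `k` pulls out the factor `χ k`.
omit [IsDomain R] [Fintype (G →* Rˣ)] [HasEnoughRootsOfUnity R (Monoid.exponent G)] in
include hh hmul in
theorem isEigen_fourierCoeff (b : Γ(Y, f ⁻¹ᵁ U)) (χ : G →* Rˣ) :
    IsEigen (R := .of R) f h hρ χ U
      (fourierCoeff (scal (R := .of R) h (f ⁻¹ᵁ U)) (fun g => secAct f (hρ g) U b) χ) := fun k => by
  have hscal : ∀ r : R, secAct f (hρ k) U (scal (R := .of R) h (f ⁻¹ᵁ U) r) =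
    scal (R := .of R) h (f ⁻¹ᵁ U) r := fun r => secAct_scal h f _ (hh k) U r
  rw [fourierCoeff, map_mul, hscal, mul_left_comm, map_sum]
  refine congrArg _ ?_
  rw [Finset.mul_sum]
  refine Fintype.sum_equiv (Equiv.mulRight k) _ _ fun g => ?_
  rw [map_mul, hscal, ← secAct_comp f (hρ k) (hρ g) (hρ (g * k)) (hmul g k), ← mul_assoc, ← map_mul]
  congr 2
  rw [← Units.val_mul, ← map_mul, Equiv.coe_mulRight, mul_inv, mul_comm g⁻¹, mul_inv_cancel_left]

include hm hh hmul hone hU in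
theorem IsKummerOn.exists_eq_sum {ε : (G →* Rˣ) → Γ(Y, f ⁻¹ᵁ U)ˣ}
    (hε : ∀ χ, IsEigen (R := .of R) f h hρ χ U (ε χ)) (b : Γ(Y, f ⁻¹ᵁ U)) :
    ∃ a : (G →* Rˣ) → Γ(X, U), b = ∑ χ, (f.app U).hom (a χ) * ε χ := by
  set κ : R →+* Γ(Y, f ⁻¹ᵁ U) := scal (R := .of R) h (f ⁻¹ᵁ U)
  -- Divided by `ε χ`, the `χ`-component of `b` becomes invariant and hence a function on the base.
  have key : ∀ χ : G →* Rˣ, ∃ a, (f.app U).hom a =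
      fourierCoeff κ (fun g => secAct f (hρ g) U b) χ * ((ε χ)⁻¹ : Γ(Y, f ⁻¹ᵁ U)ˣ) := fun χ => by
    refine hU.invariants _ (IsEigen.secAct_eq (R := .of R) (h := h) ?_)
    exact ((isEigen_fourierCoeff hh hmul b χ).mul (hε χ).inv).congr fun g => mul_inv_cancel (χ g)
  choose a ha using key
  refine ⟨a, ?_⟩
  -- Inversion at the identity element recovers `b` as the sum of its components.
  have e := sum_fourierCoeff κ hm (fun g => secAct f (hρ g) U b) 1
  have e1 : secAct f (hρ 1) U b = b := by
    have := secAct_id f U b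
    convert this
  simp only [e1] at e
  rw [← e]
  refine Finset.sum_congr rfl fun χ _ => ?_
  rw [ha, Units.inv_mul_cancel_right, map_one, Units.val_one, map_one, one_mul]

omit [HasEnoughRootsOfUnity R (Monoid.exponent G)] in
include hm in
theorem IsEigen.eq_zero_of_sum {b : (G →* Rˣ) → Γ(Y, f ⁻¹ᵁ U)}
    (hb : ∀ χ, IsEigen (R := .of R) f h hρ χ U (b χ)) (hsum : ∑ χ, b χ = 0) (χ : G →* Rˣ) :
    b χ = 0 := by
  refine eq_zero_of_sum_character_mul (scal (R := .of R) h (f ⁻¹ᵁ U)) hm b (fun g => ?_) χ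
  have := congrArg (secAct f (hρ g) U) hsum
  rw [map_sum, map_zero] at this
  rw [← this]
  exact Finset.sum_congr rfl fun χ _ => (hb χ g).symm

-- The `ε χ` form a basis: they span by Fourier inversion, and they are independent because
-- eigenfunctions for different characters are and each `ε χ` is a unit.
include hm hh hmul hone hU in
theorem IsKummerOn.exists_linearEquiv :
    letI := (f.app U).hom.toAlgebra
    Nonempty (((G →* Rˣ) → Γ(X, U)) ≃ₗ[Γ(X, U)] Γ(Y, f ⁻¹ᵁ U)) := by
  choose ε hε using hU.exists_isEigen
  let _ := (f.app U).hom.toAlgebra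
  let φ : ((G →* Rˣ) → Γ(X, U)) →ₗ[Γ(X, U)] Γ(Y, f ⁻¹ᵁ U) :=
    Fintype.linearCombination Γ(X, U) fun χ => (ε χ : Γ(Y, f ⁻¹ᵁ U))
  have hφ : ∀ a, φ a = ∑ χ, (f.app U).hom (a χ) * ε χ := fun a => by
    rw [Fintype.linearCombination_apply]
    exact Finset.sum_congr rfl fun χ _ => Algebra.smul_def _ _
  refine ⟨LinearEquiv.ofBijective φ ⟨?_, fun b => ?_⟩⟩
  · rw [injective_iff_map_eq_zero]
    intro a ha
    rw [hφ] at ha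
    funext χ
    have hb : ∀ χ : G →* Rˣ, IsEigen (R := .of R) f h hρ χ U ((f.app U).hom (a χ) * ε χ) :=
      fun χ g => by rw [map_mul, secAct_app, hε χ g, mul_left_comm]
    have := IsEigen.eq_zero_of_sum hm hb ha χ
    rw [Units.mul_left_eq_zero] at this
    exact hU.injective (this.trans (map_zero _).symm)
  · obtain ⟨a, ha⟩ := hU.exists_eq_sum hm hh hmul hone hε b
    exact ⟨a, (hφ a).trans ha.symm⟩

include hm hh hmul hone hU in
theorem IsKummerOn.faithfullyFlat : (f.app U).hom.FaithfullyFlat := by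
  obtain ⟨e⟩ := hU.exists_linearEquiv hm hh hmul hone
  let _ := (f.app U).hom.toAlgebra
  exact Module.FaithfullyFlat.of_linearEquiv _ _
    (e.symm.trans (Finsupp.linearEquivFunOnFinite Γ(X, U) Γ(X, U) (G →* Rˣ)).symm)

include hm hh hmul hone hU in
theorem IsKummerOn.finitePresentation : (f.app U).hom.FinitePresentation := by
  obtain ⟨e⟩ := hU.exists_linearEquiv hm hh hmul hone
  let _ := (f.app U).hom.toAlgebra
  have := Module.FinitePresentation.of_equiv e
  exact Algebra.FinitePresentation.of_finitePresentation Γ(X, U) Γ(Y, f ⁻¹ᵁ U)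

end Kummer

section Galois

variable {G : Type v} [CommGroup G] [Fintype G] {R : Type u} [CommRing R] [IsDomain R]
  [Fintype (G →* Rˣ)] [HasEnoughRootsOfUnity R (Monoid.exponent G)]
  (hm : IsUnit (Fintype.card G : R))
  {P Y X : Scheme.{u}} {f : Y ⟶ X} {h : Y ⟶ Spec (.of R)} {ρ : G → (Y ⟶ Y)}
  {hρ : ∀ g, ρ g ≫ f = f} (hh : ∀ g, ρ g ≫ h = h) (hmul : ∀ g k, ρ (g * k) = ρ k ≫ ρ g)
  (hone : ρ 1 = 𝟙 Y) {U : X.Opens} (hU : IsKummerOn (R := .of R) f h hρ U)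

include hm hh hmul hone hU in
/-- The fibre square of a Kummer covering is computed by the group action. -/
theorem IsKummerOn.bijective_app [IsAffineHom f] {T : Scheme.{u}} {p₁ p₂ : T ⟶ Y}
    (hp : IsPullback p₁ p₂ f f) (ψ : P ⟶ T) (i : G → (Y ⟶ P)) (hi₁ : ∀ g, i g ≫ ψ ≫ p₁ = ρ g)
    (hi₂ : ∀ g, i g ≫ ψ ≫ p₂ = 𝟙 Y)
    (hext : ∀ (W : P.Opens) (x y : Γ(P, W)),
      (∀ g, ((i g).app W).hom x = ((i g).app W).hom y) → x = y) :
    Function.Bijective (ψ.app (p₂ ⁻¹ᵁ (f ⁻¹ᵁ U))).hom := by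
  choose ε hε using hU.exists_isEigen
  set κ : R →+* Γ(Y, f ⁻¹ᵁ U) := scal (R := .of R) h (f ⁻¹ᵁ U)
  have hp1 := preimage_le_of_isPullback hp U
  have hle : ∀ g, f ⁻¹ᵁ U ≤ (i g) ⁻¹ᵁ (ψ ⁻¹ᵁ (p₂ ⁻¹ᵁ (f ⁻¹ᵁ U))) := fun g =>
    le_section_preimage (s := ψ ≫ p₂) (hi₂ g) U
  -- `ev g` restricts a function on `P` to the copy of `Y` of index `g`.
  let ev : ∀ g, Γ(P, ψ ⁻¹ᵁ (p₂ ⁻¹ᵁ (f ⁻¹ᵁ U))) →+* Γ(Y, f ⁻¹ᵁ U) := fun g =>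
    ((i g).appLE _ _ (hle g)).hom
  have hev : ∀ x y, (∀ g, ev g x = ev g y) → x = y := fun x y hxy => hext _ _ _ fun g => by
    have hinj : Function.Injective (Y.presheaf.map (homOfLE (hle g)).op).hom := by
      have : f ⁻¹ᵁ U = (i g) ⁻¹ᵁ (ψ ⁻¹ᵁ (p₂ ⁻¹ᵁ (f ⁻¹ᵁ U))) := by
        rw [← Scheme.Hom.comp_preimage, ← Scheme.Hom.comp_preimage, Category.assoc, hi₂,
          Scheme.Hom.id_preimage]
      have : IsIso (homOfLE (hle g)) := ⟨homOfLE this.ge, rfl, rfl⟩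
      exact (ConcreteCategory.bijective_of_isIso (Y.presheaf.map (homOfLE (hle g)).op)).1
    exact hinj (hxy g)
  let l : Γ(Y, f ⁻¹ᵁ U) →+* Γ(T, p₂ ⁻¹ᵁ (f ⁻¹ᵁ U)) := (p₁.appLE _ _ hp1).hom
  let r : Γ(Y, f ⁻¹ᵁ U) →+* Γ(T, p₂ ⁻¹ᵁ (f ⁻¹ᵁ U)) := (p₂.app (f ⁻¹ᵁ U)).hom
  have hlr : ∀ a, l ((f.app U).hom a) = r ((f.app U).hom a) := fun a =>
    congr($((isPushout_of_isPullback hp hU.isAffineOpen).w) a)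
  have hevl : ∀ g b, ev g ((ψ.app _).hom (l b)) = secAct f (hρ g) U b := fun g b => by
    change (p₁.appLE _ _ hp1 ≫ ψ.app _ ≫ (i g).appLE _ _ (hle g)).hom b = _
    rw [Scheme.Hom.app_eq_appLE, Scheme.Hom.appLE_comp_appLE, Scheme.Hom.appLE_comp_appLE]
    simp only [secAct, ← hi₁ g, Category.assoc]
  have hevr : ∀ g b, ev g ((ψ.app _).hom (r b)) = b := fun g b => by
    change (p₂.app _ ≫ ψ.app _ ≫ (i g).appLE _ _ (hle g)).hom b = _
    rw [Scheme.Hom.app_eq_appLE, Scheme.Hom.app_eq_appLE, Scheme.Hom.appLE_comp_appLE,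
      Scheme.Hom.appLE_comp_appLE]
    simp only [Category.assoc, hi₂]
    exact secAct_id f U b
  -- In the basis of eigenfunctions, restriction to the copies is a Fourier transform with
  -- coefficients `ε χ * d χ`. As the `ε χ` are units, both halves of bijectivity follow from
  -- Fourier inversion.
  have hsum : ∀ (d : (G →* Rˣ) → Γ(Y, f ⁻¹ᵁ U)) g,
      ev g ((ψ.app _).hom (∑ χ, l (ε χ) * r (d χ))) = ∑ χ, κ (χ g : Rˣ) * (ε χ * d χ) :=
    fun d g => by
      rw [map_sum, map_sum]
      refine Finset.sum_congr rfl fun χ _ => ?_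
      rw [map_mul, map_mul, hevl, hevr, hε χ g, mul_assoc]
  refine ⟨?_, fun x => ?_⟩
  · rw [injective_iff_map_eq_zero]
    intro t ht
    obtain ⟨n, b, c, hbc⟩ := pushout_exists_sum (isPushout_of_isPullback hp hU.isAffineOpen) t
    choose a ha using fun k => hU.exists_eq_sum hm hh hmul hone hε (b k)
    -- Expanding the left factors in the basis and moving the coefficients, which come from the
    -- base, to the right factor by `hlr`.
    have ht' : t = ∑ χ, l (ε χ) * r (∑ k, (f.app U).hom (a k χ) * c k) := by
      have hb : ∀ k, l (b k) = ∑ χ, r ((f.app U).hom (a k χ)) * l (ε χ) := fun k => by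
        rw [ha k, map_sum]
        exact Finset.sum_congr rfl fun χ _ => by rw [map_mul, hlr]
      calc t = ∑ k, l (b k) * r (c k) := hbc
        _ = _ := by
          simp only [hb, map_sum, map_mul, Finset.sum_mul, Finset.mul_sum]
          rw [Finset.sum_comm]
          exact Finset.sum_congr rfl fun χ _ => Finset.sum_congr rfl fun k _ => by ring
    have h0 := eq_zero_of_sum_character_mul κ hm
      (fun χ => ε χ * ∑ k, (f.app U).hom (a k χ) * c k) fun g => by
        rw [← hsum, ← ht', ht, map_zero]
    rw [ht']
    refine Finset.sum_eq_zero fun χ _ => ?_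
    have := h0 χ
    rw [Units.mul_right_eq_zero] at this
    rw [this, map_zero, mul_zero]
  -- By `hsum` the preimage is forced: `ε χ * d χ` has to be the Fourier coefficient of `g ↦ ev g
  -- x`.
  · refine ⟨∑ χ, l (ε χ) * r (((ε χ)⁻¹ : Γ(Y, f ⁻¹ᵁ U)ˣ) * fourierCoeff κ (fun g => ev g x) χ),
      hev _ _ fun g => ?_⟩
    rw [hsum]
    simp only [Units.mul_inv_cancel_left]
    exact sum_fourierCoeff κ hm (fun g => ev g x) g

end Galois

end TorsorExtension

namespace TorsorExtension

open MonoidalCategory CartesianMonoidalCategory MonObj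

/-! ### Kummer coverings are torsors. -/

section KummerTorsor

variable {G : Type v} [CommGroup G] [Fintype G] {R : Type u} [CommRing R] [IsDomain R]
  [Fintype (G →* Rˣ)] [HasEnoughRootsOfUnity R (Monoid.exponent G)]
  {Y X : Over (Spec (.of R))} {π : Y ⟶ X} {ρ : G → (Y ⟶ Y)}

/-- A morphism which is locally a Kummer covering is a torsor. -/
theorem isTorsor_of_isKummerOn (hm : IsUnit (Fintype.card G : R)) [IsAffineHom π.left]
    (hone : ρ 1 = 𝟙 Y) (hmul : ∀ g k, ρ (g * k) = ρ k ≫ ρ g)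
    (hρ : ∀ g, (ρ g).left ≫ π.left = π.left)
    (hK : ∀ x, ∃ U, x ∈ U ∧
      IsKummerOn (R := .of R) π.left Y.hom (ρ := fun g => (ρ g).left) hρ U) :
    letI := modObjOfAct ρ hone hmul
    IsTorsor (constScheme G (Spec (.of R))) π := by
  let _ := modObjOfAct ρ hone hmul
  have hh : ∀ g, (ρ g).left ≫ Y.hom = Y.hom := fun g => Over.w (ρ g)
  have hone' : (ρ 1).left = 𝟙 Y.left := congr_arg CommaMorphism.left hone
  have hmul' : ∀ g k, (ρ (g * k)).left = (ρ k).left ≫ (ρ g).left := fun g k =>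
    congr_arg CommaMorphism.left (hmul g k)
  have : IsZariskiLocalAtTarget (@Flat : MorphismProperty Scheme.{u}) :=
    HasRingHomProperty.instIsZariskiLocalAtTarget _
  have : IsZariskiLocalAtTarget (@LocallyOfFinitePresentation : MorphismProperty Scheme.{u}) :=
    HasRingHomProperty.instIsZariskiLocalAtTarget _
  have : IsAffineHom (pullback.snd π.left π.left) :=
    isAffineHom_isStableUnderBaseChange.of_isPullback (.of_hasPullback _ _) inferInstance
  have hflat : Flat π.left := of_forall_exists_affine _ _ fun x => by
    obtain ⟨U, hx, hU⟩ := hK x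
    exact ⟨U, hU.isAffineOpen, hx, ((flat_and_surjective_SpecMap_iff _).2
      (hU.faithfullyFlat hm hh hmul' hone')).1⟩
  have hsurj : Surjective π.left := of_forall_exists_affine _ _ fun x => by
    obtain ⟨U, hx, hU⟩ := hK x
    exact ⟨U, hU.isAffineOpen, hx, ((flat_and_surjective_SpecMap_iff _).2
      (hU.faithfullyFlat hm hh hmul' hone')).2⟩
  have hfp : LocallyOfFinitePresentation π.left := of_forall_exists_affine _ _ fun x => by
    obtain ⟨U, hx, hU⟩ := hK x
    exact ⟨U, hU.isAffineOpen, hx,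
      (HasRingHomProperty.Spec_iff (P := @LocallyOfFinitePresentation)).2
        (hU.finitePresentation hm hh hmul' hone')⟩
  refine ⟨hflat, hsurj, hfp, ?_⟩
  · have hact : ∀ g, inc Y g ≫ γ[constScheme G (Spec (.of R)), Y] = ρ g := fun g =>
      inc_incDesc ρ g
    have hw : γ[constScheme G (Spec (.of R)), Y] ≫ π = snd _ _ ≫ π :=
      inc_over_hom_ext fun g => by
        rw [← Category.assoc, hact, inc_snd_assoc]
        exact Over.OverMorphism.ext (hρ g)
    have hw' : (γ[constScheme G (Spec (.of R)), Y] : _ ⟶ Y).left ≫ π.left =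
        pullback.snd (constScheme G (Spec (.of R))).hom Y.hom ≫ π.left :=
      congr_arg CommaMorphism.left hw
    -- The map `(h, y) ↦ (h y, y)` into the fibre square.
    let ψ : (constScheme G (Spec (.of R)) ⊗ Y).left ⟶ pullback π.left π.left :=
      pullback.lift (γ[constScheme G (Spec (.of R)), Y] : _ ⟶ Y).left
        (pullback.snd (constScheme G (Spec (.of R))).hom Y.hom) hw'
    have hψ₁ : ψ ≫ pullback.fst _ _ = (γ[constScheme G (Spec (.of R)), Y] : _ ⟶ Y).left :=
      pullback.lift_fst _ _ _
    have hψ₂ : ψ ≫ pullback.snd _ _ = pullback.snd (constScheme G (Spec (.of R))).hom Y.hom :=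
      pullback.lift_snd _ _ _
    -- The composite of `ψ` with the separated second projection is finite, so `ψ` is affine, and on
    -- affine opens it is an isomorphism once it is one on functions.
    have haff : IsAffineHom ψ := by
      refine MorphismProperty.of_postcomp (W := @IsAffineHom) (W' := @IsSeparated) ψ
        (pullback.snd π.left π.left) inferInstance ?_
      rw [hψ₂]
      have := isFinite_snd_constScheme (G := G) Y
      infer_instance
    choose U hx hU using hK
    have hiso : IsIso ψ := by
      refine (IsZariskiLocalAtTarget.iff_of_iSup_eq_top (P := .isomorphisms Scheme.{u})
        (fun x => pullback.snd π.left π.left ⁻¹ᵁ (π.left ⁻¹ᵁ U x))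
        (eq_top_iff.2 fun z _ => TopologicalSpace.Opens.mem_iSup.2 ⟨_, hx _⟩)).2 fun x => ?_
      have hA : IsAffineOpen (pullback.snd π.left π.left ⁻¹ᵁ (π.left ⁻¹ᵁ U x)) :=
        ((hU x).isAffineOpen.preimage _).preimage _
      have : IsAffine (pullback.snd π.left π.left ⁻¹ᵁ (π.left ⁻¹ᵁ U x)) := hA
      have : IsAffine (ψ ⁻¹ᵁ (pullback.snd π.left π.left ⁻¹ᵁ (π.left ⁻¹ᵁ U x))) := hA.preimage ψ
      refine (isIso_morphismRestrict_iff_isIso_app ψ hA).2 ?_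
      rw [ConcreteCategory.isIso_iff_bijective]
      refine (hU x).bijective_app hm hh hmul' hone' (.of_hasPullback _ _) ψ
        (fun g => (inc Y g).left) (fun g => ?_) (fun g => ?_) fun W x y => inc_app_ext Y
      · rw [hψ₁]
        exact congr_arg CommaMorphism.left (hact g)
      · rw [hψ₂]
        exact congr_arg CommaMorphism.left (inc_snd Y g)
    have hp : IsPullback (γ[constScheme G (Spec (.of R)), Y] : _ ⟶ Y).left
        (pullback.snd (constScheme G (Spec (.of R))).hom Y.hom) π.left π.left :=
      IsPullback.of_iso_pullback ⟨hw'⟩ (asIso ψ) hψ₁ hψ₂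
    exact IsPullback.of_map_of_faithful (Over.forget _) hp

end KummerTorsor

theorem isUnit_natCast_of_coprime (R : Type u) [CommRing R] [IsLocalRing R] {p m : ℕ}
    (hp : p.Prime) [CharP (IsLocalRing.ResidueField R) p] (h : m.Coprime p) :
    IsUnit (m : R) := by
  rw [← IsLocalRing.residue_ne_zero_iff_isUnit, map_natCast, Ne,
    CharP.cast_eq_zero_iff (IsLocalRing.ResidueField R) p]
  exact (Nat.Prime.coprime_iff_not_dvd hp).1 h.symm

theorem hasEnoughRootsOfUnity_exponent (R : Type u) [CommRing R] [IsDomain R] (G : Type v)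
    [Group G] [Finite G] (h : ∃ ζ : R, IsPrimitiveRoot ζ (Nat.card G)) :
    HasEnoughRootsOfUnity R (Monoid.exponent G) := by
  have : NeZero (Nat.card G) := ⟨Nat.card_pos.ne'⟩
  have : HasEnoughRootsOfUnity R (Nat.card G) := ⟨h, inferInstance⟩
  exact HasEnoughRootsOfUnity.of_dvd R Group.exponent_dvd_nat_card

/-! ### The constant group acting on the normalization. -/

section ModelTorsor

variable {R : Type u} [CommRing R] [IsDomain R] [IsDiscreteValuationRing R]
  {K : Type u} [Field K] [Algebra R K] [IsFractionRing R K]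
  {G : Type v} [CommGroup G] [Finite G] {X : Over (Spec (.of R))}
  {YK : Over (Spec (.of K))} [IsNoetherian YK.left] {fK : YK ⟶ genericFibre K X}

section

variable {ρ : G → (YK.left ⟶ YK.left)} (hG : IsGaloisCover fK.left ρ)

/-- The automorphism of the normalization of `X` in `Y_K` induced by a group element. -/
noncomputable def IsGaloisCover.normAct (g : G) : normalizationIn fK ⟶ normalizationIn fK :=
  Over.homMk (normEnd (hG.act_comp_toModel g)) (by
    change _ ≫ (toModel fK).fromNormalization ≫ X.hom = (toModel fK).fromNormalization ≫ X.hom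
    rw [← Category.assoc, normEnd_comp])

omit [IsDomain R] [IsDiscreteValuationRing R] [IsFractionRing R K] in
theorem IsGaloisCover.normAct_one : hG.normAct 1 = 𝟙 (normalizationIn fK) :=
  Over.OverMorphism.ext (normEnd_eq_id (hG.act_comp_toModel 1) hG.act_one)

omit [IsDomain R] [IsDiscreteValuationRing R] [IsFractionRing R K] in
theorem IsGaloisCover.normAct_mul (g k : G) : hG.normAct (g * k) = hG.normAct k ≫ hG.normAct g :=
  Over.OverMorphism.ext (normEnd_eq_comp (hG.act_comp_toModel k) (hG.act_comp_toModel g)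
    (hG.act_comp_toModel (g * k)) (hG.act_mul g k))

/-- Injectivity is inherited from the generic fibre by flatness, the description of invariants comes
from normality, and the eigenfunctions come from the Picard and reducedness hypotheses. -/
theorem IsGaloisCover.exists_isKummerOn [Flat X.hom] [IsNormalScheme X.left]
    [IsIntegral (genericFibre K X).left] [IsIntegral (specialFibre X).left]
    [IsReduced (specialFibre (normalizationIn fK)).left] (hm : IsUnit (Nat.card G : R))
    [Finite (G →* Rˣ)] (hPic : Set.SurjOn (Pic.pullback (genericFibreι K X))
      (Pic.torsion (Nat.card G) X.left) (Pic.torsion (Nat.card G) (genericFibre K X).left))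
    (z : X.left) :
    ∃ U, z ∈ U ∧ IsKummerOn (R := .of R) (normalizationInHom fK).left (normalizationIn fK).hom
      (ρ := fun g => (hG.normAct g).left) (fun g => normEnd_comp (hG.act_comp_toModel g)) U := by
  obtain ⟨U, hU, hz, hε⟩ := hG.exists_forall_isEigen_normalization hm hPic z
  refine ⟨U, hz, hU, fun a b hab => ?_, fun c hc => hG.exists_app_eq_of_normalization hU c hc, hε⟩
  refine hG.toModel_app_injective hU ?_
  have h := congrArg (normApp (toModel fK) U) hab
  exact (normApp_app (toModel fK) U a).symm.trans (h.trans (normApp_app (toModel fK) U b))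

end

-- `modelMap` carries the copy of index `g` to the copy of the same index, where the claim becomes
-- `toNormalization_normEnd`.
omit [IsDomain R] [IsDiscreteValuationRing R] [IsFractionRing R K] in
theorem modelMap_smul [ModObj (constScheme G (Spec (.of K))) YK]
    (hG : IsGaloisCover fK.left fun g : G => (act YK g).left) :
    letI := modObjOfAct (S := Spec (.of R)) hG.normAct hG.normAct_one hG.normAct_mul
    modelMap fK (constPullbackIso (G := G) (specMap R K)) ≫
        (γ[constScheme G (Spec (.of R)), normalizationIn fK] : _ ⟶ normalizationIn fK).left =
      (γ[constScheme G (Spec (.of K)), YK] : _ ⟶ YK).left ≫ toNormalizationIn fK := by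
  let _ := modObjOfAct (S := Spec (.of R)) hG.normAct hG.normAct_one hG.normAct_mul
  refine inc_hom_ext fun g => ?_
  have h1 : (inc YK g).left ≫ modelMap fK (constPullbackIso (G := G) (specMap R K)) =
      toNormalizationIn fK ≫ (inc (normalizationIn fK) g).left := by
    have hf : (inc YK g).left ≫ pullback.fst (constScheme G (Spec (.of K))).hom YK.hom =
        YK.hom ≫ constι G _ g := congr_arg CommaMorphism.left (inc_fst YK g)
    have hs : (inc YK g).left ≫ pullback.snd (constScheme G (Spec (.of K))).hom YK.hom = 𝟙 _ :=
      congr_arg CommaMorphism.left (inc_snd YK g)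
    have hf' : (inc (normalizationIn fK) g).left ≫
        pullback.fst (constScheme G (Spec (.of R))).hom (normalizationIn fK).hom =
        (normalizationIn fK).hom ≫ constι G _ g :=
      congr_arg CommaMorphism.left (inc_fst (normalizationIn fK) g)
    have hs' : (inc (normalizationIn fK) g).left ≫
        pullback.snd (constScheme G (Spec (.of R))).hom (normalizationIn fK).hom = 𝟙 _ :=
      congr_arg CommaMorphism.left (inc_snd (normalizationIn fK) g)
    refine pullback.hom_ext ?_ ?_
    · rw [Category.assoc, Category.assoc, hf', modelMap, pullback.lift_fst,
        constPullbackIso_inv_fst, ← Category.assoc, hf, Category.assoc, constι_constProj,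
        ← Category.assoc, ← Category.assoc, toNormalizationIn_hom]
    · rw [Category.assoc, Category.assoc, hs', modelMap, pullback.lift_snd, ← Category.assoc, hs,
        Category.id_comp, Category.comp_id]
  have h2 : (inc (normalizationIn fK) g).left ≫
      (γ[constScheme G (Spec (.of R)), normalizationIn fK] : _ ⟶ normalizationIn fK).left =
      normEnd (hG.act_comp_toModel g) :=
    congr_arg CommaMorphism.left (inc_incDesc hG.normAct g)
  rw [← Category.assoc, h1, Category.assoc, h2]
  exact (toNormalization_normEnd (hG.act_comp_toModel g)).trans (Category.assoc _ _ _)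

end ModelTorsor

end TorsorExtension

theorem mainTheorem9
    -- a discrete valuation ring of unequal characteristic
    (R : Type u) [CommRing R] [IsDomain R] [IsDiscreteValuationRing R]
    (K : Type u) [Field K] [Algebra R K] [IsFractionRing R K] [CharZero K]
    (p : ℕ) (hp : p.Prime) [CharP (IsLocalRing.ResidueField R) p]
    -- a finite abelian group of order prime to `p`, and a root of unity
    (G : Type v) [CommGroup G] [Finite G] (m : ℕ) (hm : Nat.card G = m) (hmp : m.Coprime p)
    (hζ : ∃ ζ : R, IsPrimitiveRoot ζ m)
    -- a normal faithfully flat `R`-scheme with integral fibres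
    (X : Over (Spec (.of R))) [IsNoetherian X.left] [TorsorExtension.IsNormalScheme X.left]
    [Flat X.hom] [Surjective X.hom]
    [IsIntegral (TorsorExtension.genericFibre K X).left]
    [IsIntegral (TorsorExtension.specialFibre X).left]
    -- the restriction map `ₘPic(X) ⟶ ₘPic(X_K)` is bijective
    (hPic : Set.BijOn (TorsorExtension.Pic.pullback (TorsorExtension.genericFibreι K X))
      (TorsorExtension.Pic.torsion m X.left)
      (TorsorExtension.Pic.torsion m (TorsorExtension.genericFibre K X).left))
    -- a connected `G`-torsor over `X_K`
    (YK : Over (Spec (.of K))) [IsNoetherian YK.left] [ConnectedSpace YK.left]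
    [ModObj (TorsorExtension.constScheme G (Spec (.of K))) YK]
    (fK : YK ⟶ TorsorExtension.genericFibre K X)
    (hfK : TorsorExtension.IsTorsor (TorsorExtension.constScheme G (Spec (.of K))) fK)
    -- the special fibre of the normalization of `X` in `Y_K` is reduced
    (hred : IsReduced
      (TorsorExtension.specialFibre (TorsorExtension.normalizationIn fK)).left) :
    TorsorExtension.IsStronglyExtendible fK
      (TorsorExtension.constScheme G (Spec (.of K))) := by
  subst hm
  have hG := hfK.isGaloisCover
  have hunit := TorsorExtension.isUnit_natCast_of_coprime R hp hmp
  have := TorsorExtension.hasEnoughRootsOfUnity_exponent R G hζ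
  have := Fintype.ofFinite G
  have := Fintype.ofFinite (G →* Rˣ)
  have : IsAffineHom (TorsorExtension.normalizationInHom fK).left :=
    inferInstanceAs (IsAffineHom (TorsorExtension.toModel fK).fromNormalization)
  -- The model is the constant group over `R`, acting on `Y` through the functoriality of the
  -- normalization.
  refine ⟨TorsorExtension.constScheme G (Spec (.of R)), inferInstance,
    TorsorExtension.constPullbackIso (TorsorExtension.specMap R K),
    TorsorExtension.modObjOfAct hG.normAct hG.normAct_one hG.normAct_mul,
    TorsorExtension.isFinite_constScheme G _, TorsorExtension.flat_constScheme G _,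
    TorsorExtension.isMonHom_constPullbackIso _, ?_, TorsorExtension.modelMap_smul hG⟩
  exact TorsorExtension.isTorsor_of_isKummerOn (Nat.card_eq_fintype_card (α := G) ▸ hunit)
    hG.normAct_one hG.normAct_mul
    (fun g => TorsorExtension.normEnd_comp (hG.act_comp_toModel g))
    (hG.exists_isKummerOn hunit hPic.surjOn)
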